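/- Let $n\ge 1$ and $\Gamma_n=\langle a,b \mid a^n b a^{-n} b^{-1}=1\rangle$. Let $X(\Gamma_n,\mathrm{SU}(2))=\mathrm{Hom}(\Gamma_n,\mathrm{SU}(2))/\mathrm{SU}(2)$ be the orbit space of the conjugation action, with the quotient topology, and let $X(\Gamma_n,\mathrm{SL}(2,\mathbb C))=\mathrm{Hom}(\Gamma_n,\mathrm{SL}(2,\mathbb C))/\!/\mathrm{SL}(2,\mathbb C)$ be the complex points of the affine GIT quotient of the conjugation action, with the classical topology. Let $X^{\mathrm{TR}}$ and $X^{*}$ be the sets of classes in $X(\Gamma_n,\mathrm{SU}(2))$ of totally reducible representations (those for which $\mathbb C^2$ is a direct sum of two invariant lines) and of irreducible representations. Let $\overline{\mathbf D}\subset\mathbb C$ be the closed unit disc, $\mathbf D$ the open unit disc and $S^1$ the unit circle. For $z,w\in S^1$ let $\rho_{z,w}:\Gamma_n\to \mathrm{SU}(2)$ be the representation $a\mapsto \mathrm{diag}(z,z^{-1})$, $b\mapsto\mathrm{diag}(w,w^{-1})$. Let $\mathrm{SSym}^2(S^1\times S^1)$ (the pillowcase) be the space of unordered pairs $\{(z_1,w_1),(z_2,w_2)\}$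 in $S^1\times S^1$ with $z_1z_2=w_1w_2=1$, a subspace of the symmetric square $\mathrm{Sym}^2(S^1\times S^1)$. 1. $X(\Gamma_n,\mathrm{SU}(2))=X^{\mathrm{TR}}\sqcup X^{*}$. 2. There is a homeomorphism $\mathrm{SSym}^2(S^1\times S^1)\to X^{\mathrm{TR}}$ that sends $\{(z,w),(z^{-1},w^{-1})\}$ to $[\rho_{z,w}]$, and $X^{\mathrm{TR}}$ is homeomorphic to the 2-sphere $S^2$. 3. $X(\Gamma_n,\mathrm{SU}(2))$ is obtained from $X^{\mathrm{TR}}$ by attaching $n-1$ closed 2-discs along disjoint circles. Precisely, let $\lambda_1,\dots,\lambda_{n-1}$ be a suitable enumeration without repetition of $\{z\in S^1 : z^{2n}=1,\ \mathrm{Im}\, z>0\}$. Then there are continuous maps $\Phi_k:\overline{\mathbf D}\to X(\Gamma_n,\mathrm{SU}(2))$, $1\le k\le n-1$, such that: - $\Phi_k(\partial\overline{\mathbf D})\subset X^{\mathrm{TR}}$ and $\Phi_k(\mathbf D)\cap X^{\mathrm{TR}}=\emptyset$; - the $\Phi_k$ together map $\bigsqcup_k\mathbf D$ bijectively onto $X^{*}$,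 and $\Phi_k(\mathbf D)$ is the set of classes of irreducible $\rho$ for which $\lambda_k$ is an eigenvalue of $\rho(a)$; - $X(\Gamma_n,\mathrm{SU}(2))$ carries the quotient topology of $X^{\mathrm{TR}}\sqcup\bigsqcup_k\overline{\mathbf D}$; - $\Phi_k(w)=[\rho_{\lambda_k,w}]$ for all $w\in S^1=\partial\overline{\mathbf D}$, each $\Phi_k|_{S^1}$ is injective, and the circles $\Phi_k(S^1)$ are pairwise disjoint. 4. $X(\Gamma_n,\mathrm{SU}(2))$ and $X(\Gamma_n,\mathrm{SL}(2,\mathbb C))$ are both homotopy equivalent to the wedge of $n$ copies of $S^2$. -/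

import Mathlib

open Topology ContinuousMap

noncomputable section

namespace TwistedHopf

/-! ### The group of the twisted Hopf link -/

/-- The relator `[aⁿ, b] = aⁿ b a⁻ⁿ b⁻¹`, where `a` and `b` are the free generators indexed by `0` and `1`. -/
def relator (n : ℕ) : FreeGroup (Fin 2) :=
  FreeGroup.of 0 ^ n * FreeGroup.of 1 * (FreeGroup.of 0 ^ n)⁻¹ * (FreeGroup.of 1)⁻¹

/-- `Γ_n = ⟨a, b ∣ [aⁿ, b] = 1⟩`. -/
abbrev LinkGroup (n : ℕ) : Type := PresentedGroup ({relator n} : Set (FreeGroup (Fin 2)))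

/-- The generator `a` of `Γ_n`. -/
def genA (n : ℕ) : LinkGroup n := PresentedGroup.of 0

/-- The generator `b` of `Γ_n`. -/
def genB (n : ℕ) : LinkGroup n := PresentedGroup.of 1

/-- The homomorphism `Γ_n → G` given by `a ↦ A`, `b ↦ B`, when `Aⁿ` and `B` commute. -/
def homOfPair (n : ℕ) {G : Type*} [Group G] (A B : G) (h : A ^ n * B = B * A ^ n) :
    LinkGroup n →* G :=
  PresentedGroup.toGroup (f := ![A, B]) (by
    intro r hr
    rw [Set.mem_singleton_iff.mp hr, relator]
    simp [h])

theorem homOfPair_genA (n : ℕ) {G : Type*} [Group G] (A B : G) (h : A ^ n * B = B * A ^ n) :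
    homOfPair n A B h (genA n) = A := by
  simp [homOfPair, genA]

theorem homOfPair_genB (n : ℕ) {G : Type*} [Group G] (A B : G) (h : A ^ n * B = B * A ^ n) :
    homOfPair n A B h (genB n) = B := by
  simp [homOfPair, genB]

/-! ### Representation spaces -/

/-- The representation space `R(Γ, G) = Hom(Γ, G)`. -/
def RepSpace (Γ G : Type*) [Group Γ] [Group G] : Type _ := Γ →* G

/-- The topology of pointwise convergence on `Hom(Γ, G)`; for `Γ` generated by `γ₁, …, γ_k` and
`G` a topological group it is the subspace topology coming from `ρ ↦ (ρ γ₁, …, ρ γ_k) ∈ G ^ k`. -/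
instance (Γ G : Type*) [Group Γ] [Group G] [TopologicalSpace G] :
    TopologicalSpace (RepSpace Γ G) :=
  TopologicalSpace.induced (fun (ρ : Γ →* G) (γ : Γ) => ρ γ) inferInstance

/-- The conjugation action `(g · ρ)(γ) = g ρ(γ) g⁻¹` of `G` on `Hom(Γ, G)`. -/
def conjRep {Γ G : Type*} [Group Γ] [Group G] (g : G) (ρ : RepSpace Γ G) : RepSpace Γ G :=
  (MulAut.conj g).toMonoidHom.comp ρ

theorem conjRep_one {Γ G : Type*} [Group Γ] [Group G] (ρ : Γ →* G) : conjRep 1 ρ = ρ := by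
  refine MonoidHom.ext fun γ => ?_
  change 1 * ρ γ * 1⁻¹ = ρ γ
  simp

theorem conjRep_conjRep {Γ G : Type*} [Group Γ] [Group G] (g h : G) (ρ : Γ →* G) :
    conjRep g (conjRep h ρ) = conjRep (g * h) ρ := by
  refine MonoidHom.ext fun γ => ?_
  change g * (h * ρ γ * h⁻¹) * g⁻¹ = (g * h) * ρ γ * (g * h)⁻¹
  group

/-- Equivalence of representations: lying in the same orbit of the conjugation action. -/
def conjSetoid (Γ G : Type*) [Group Γ] [Group G] : Setoid (RepSpace Γ G) where
  r ρ σ := ∃ g : G, σ = conjRep g ρ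
  iseqv :=
    { refl := fun ρ => ⟨1, (conjRep_one ρ).symm⟩
      symm := by
        rintro ρ σ ⟨g, rfl⟩
        refine ⟨g⁻¹, ((conjRep_conjRep g⁻¹ g ρ).trans ?_).symm⟩
        rw [inv_mul_cancel]
        exact conjRep_one ρ
      trans := by
        rintro ρ σ τ ⟨g, rfl⟩ ⟨h, rfl⟩
        exact ⟨h * g, conjRep_conjRep h g ρ⟩ }

/-! ### The `SU(2)`-character variety -/

/-- The compact group `SU(2)`. -/
abbrev SU2 : Type := Matrix.specialUnitaryGroup (Fin 2) ℂ

/-- The character variety `X(Γ, SU(2))`: since `SU(2)` is compact, all orbits are closed and the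
quotient `Hom(Γ, SU(2)) // SU(2)` is the orbit space, with the quotient topology. -/
abbrev SUCharVar (Γ : Type*) [Group Γ] : Type _ := Quotient (conjSetoid Γ SU2)

/-- The point of `X(Γ, SU(2))` defined by a representation. -/
def suClass {Γ : Type*} [Group Γ] (ρ : Γ →* SU2) : SUCharVar Γ :=
  Quotient.mk (conjSetoid Γ SU2) ρ

/-- `W ⊆ ℂ²` is invariant under all `ρ γ`. -/
def IsInvariant {Γ : Type*} [Group Γ] (ρ : Γ →* SU2) (W : Submodule ℂ (Fin 2 → ℂ)) : Prop :=
  ∀ γ : Γ, ∀ w ∈ W, (ρ γ : Matrix (Fin 2) (Fin 2) ℂ).mulVec w ∈ W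

/-- `ρ` is irreducible: `ℂ²` has no nonzero proper invariant subspace. -/
def IsIrred {Γ : Type*} [Group Γ] (ρ : Γ →* SU2) : Prop :=
  ∀ W : Submodule ℂ (Fin 2 → ℂ), IsInvariant ρ W → W = ⊥ ∨ W = ⊤

/-- `ρ` is totally reducible: `ℂ²` is the direct sum of two invariant lines. -/
def IsTotallyReducible {Γ : Type*} [Group Γ] (ρ : Γ →* SU2) : Prop :=
  ∃ W₁ W₂ : Submodule ℂ (Fin 2 → ℂ), IsInvariant ρ W₁ ∧ IsInvariant ρ W₂ ∧
    Module.finrank ℂ W₁ = 1 ∧ Module.finrank ℂ W₂ = 1 ∧ IsCompl W₁ W₂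

/-- The totally reducible locus of `X(Γ, SU(2))`. -/
def totallyReducibleLocus (Γ : Type*) [Group Γ] : Set (SUCharVar Γ) :=
  {x | ∃ ρ : Γ →* SU2, IsTotallyReducible ρ ∧ suClass ρ = x}

/-- The irreducible locus of `X(Γ, SU(2))`. -/
def irreducibleLocus (Γ : Type*) [Group Γ] : Set (SUCharVar Γ) :=
  {x | ∃ ρ : Γ →* SU2, IsIrred ρ ∧ suClass ρ = x}

/-- `z ↦ diag(z, z⁻¹)`. -/
def diagSU : Circle →* SU2 where
  toFun z := ⟨!![(z : ℂ), 0; 0, ((z⁻¹ : Circle) : ℂ)], by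
    have h : (z : ℂ) * (starRingEnd ℂ) (z : ℂ) = 1 := by
      rw [Complex.mul_conj, Circle.normSq_coe]; simp
    have h' : ((z : ℂ))⁻¹ * ((starRingEnd ℂ) (z : ℂ))⁻¹ = 1 := by rw [← mul_inv, h, inv_one]
    rw [Matrix.mem_specialUnitaryGroup_iff, Matrix.mem_unitaryGroup_iff]
    refine ⟨?_, ?_⟩
    · ext i j
      fin_cases i <;> fin_cases j <;>
        simp [Matrix.mul_apply, Fin.sum_univ_two, Matrix.star_apply, h, h']
    · simp [Matrix.det_fin_two]⟩
  map_one' := by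
    apply Subtype.ext
    ext i j
    fin_cases i <;> fin_cases j <;> simp
  map_mul' z w := by
    apply Subtype.ext
    ext i j
    fin_cases i <;> fin_cases j <;> simp [mul_comm]

/-- The representation `a ↦ diag(z, z⁻¹)`, `b ↦ diag(w, w⁻¹)` of `Γ_n`. -/
def diagRep (n : ℕ) (z w : Circle) : LinkGroup n →* SU2 :=
  diagSU.comp (homOfPair n z w (mul_comm _ _))

/-! ### The pillowcase -/

/-- The symmetric square `Sym²(X) = X² / S₂` carries the quotient topology. -/
instance (X : Type*) [TopologicalSpace X] : TopologicalSpace (Sym2 X) :=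
  TopologicalSpace.coinduced (fun p : X × X => s(p.1, p.2)) inferInstance

/-- `SSym²(S¹ × S¹)`: the unordered pairs `{(z₁, w₁), (z₂, w₂)}` in `S¹ × S¹` such that
`z₁ z₂ = 1` and `w₁ w₂ = 1`. -/
abbrev Pillowcase : Type :=
  {p : Sym2 (Circle × Circle) // ∃ z₁ w₁ z₂ w₂ : Circle,
    p = s((z₁, w₁), (z₂, w₂)) ∧ z₁ * z₂ = 1 ∧ w₁ * w₂ = 1}

/-- The point `{(z, w), (z⁻¹, w⁻¹)}` of the pillowcase. -/
def pillowPoint (z w : Circle) : Pillowcase :=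
  ⟨s((z, w), (z⁻¹, w⁻¹)), z, w, z⁻¹, w⁻¹, rfl, mul_inv_cancel z, mul_inv_cancel w⟩

/-! ### Attaching discs, spheres and wedges -/

/-- The closed unit disc. -/
abbrev ClosedDisc : Type := Metric.closedBall (0 : ℂ) 1

/-- The space `X` is obtained from its subspace `Y` by attaching closed 2-discs along their boundary
circles, with characteristic maps `Φ i`: each `Φ i` is continuous and maps the boundary circle into
`Y`, the open discs are mapped bijectively onto the complement of `Y`, and `X` has the quotient
topology of the disjoint union of `Y` and the discs. Equivalently, the canonical map from the
adjunction space of `Y` and the discs along the maps `Φ i ∣ S¹` to `X` is a homeomorphism. -/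
structure IsDiscAttachment {X : Type*} [TopologicalSpace X] (Y : Set X) {ι : Type*}
    (Φ : ι → ClosedDisc → X) : Prop where
  continuous : ∀ i, Continuous (Φ i)
  boundary : ∀ i, ∀ z : ClosedDisc, ‖(z : ℂ)‖ = 1 → Φ i z ∈ Y
  interior : ∀ i, ∀ z : ClosedDisc, ‖(z : ℂ)‖ < 1 → Φ i z ∉ Y
  injective : ∀ i j, ∀ z w : ClosedDisc, ‖(z : ℂ)‖ < 1 → ‖(w : ℂ)‖ < 1 →
    Φ i z = Φ j w → i = j ∧ z = w
  quotient : IsQuotientMap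
    (Sum.elim (fun y : Y => (y : X)) (fun p : (Σ _ : ι, ClosedDisc) => Φ p.1 p.2))

/-- The 2-sphere. -/
abbrev Sphere2 : Type := Metric.sphere (0 : EuclideanSpace ℝ (Fin 3)) 1

/-- The wedge of copies of the pointed space `(X, x₀)` indexed by a nonempty type `ι`. -/
def Wedge (ι X : Type*) (x₀ : X) : Type _ :=
  Quot (fun p q : (Σ _ : ι, X) => p.2 = x₀ ∧ q.2 = x₀)

instance (ι X : Type*) [TopologicalSpace X] (x₀ : X) : TopologicalSpace (Wedge ι X x₀) :=
  inferInstanceAs (TopologicalSpace (Quot _))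

/-- A base point of the 2-sphere. -/
def basePoint : Sphere2 := ⟨EuclideanSpace.single 0 1, by simp⟩

/-! ### The `SL(2, ℂ)`-character variety -/

/-- The complex algebraic group `SL(2, ℂ)`. -/
abbrev SL2C : Type := Matrix.SpecialLinearGroup (Fin 2) ℂ

/-- The coordinate ring of the representation variety `R(Γ, SL(2, ℂ))`: the polynomial functions in
the matrix entries of `ρ`. (If `γ₁, …, γ_k` generate `Γ`, the entries of the `ρ γᵢ` suffice, because
inverting a matrix in `SL(2, ℂ)` is polynomial.) -/
def regularFunctions (Γ : Type*) [Group Γ] : Subalgebra ℂ (RepSpace Γ SL2C → ℂ) :=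
  Algebra.adjoin ℂ {f | ∃ (γ : Γ) (i j : Fin 2),
    f = fun ρ : Γ →* SL2C => (ρ γ : Matrix (Fin 2) (Fin 2) ℂ) i j}

/-- The ring of regular functions on `R(Γ, SL(2, ℂ))` that are invariant under conjugation. -/
def invariantFunctions (Γ : Type*) [Group Γ] : Subalgebra ℂ (RepSpace Γ SL2C → ℂ) where
  carrier := {f | f ∈ regularFunctions Γ ∧
    ∀ (g : SL2C) (ρ : RepSpace Γ SL2C), f (conjRep g ρ) = f ρ}
  mul_mem' := fun ha hb => ⟨mul_mem ha.1 hb.1, fun g ρ => by simp [ha.2 g ρ, hb.2 g ρ]⟩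
  add_mem' := fun ha hb => ⟨add_mem ha.1 hb.1, fun g ρ => by simp [ha.2 g ρ, hb.2 g ρ]⟩
  algebraMap_mem' := fun c => ⟨Subalgebra.algebraMap_mem _ c, fun _ _ => rfl⟩

/-- The character variety `X(Γ, SL(2, ℂ))`: the set of complex points of the affine GIT quotient
`R(Γ, SL(2, ℂ)) // SL(2, ℂ) = Spec (ℂ[R]^{SL(2, ℂ)})`. -/
def SLCharVar (Γ : Type*) [Group Γ] : Type _ := invariantFunctions Γ →ₐ[ℂ] ℂ

/-- The classical (analytic) topology on the complex points of an affine variety: the coarsest one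
for which the regular functions are continuous. -/
instance (Γ : Type*) [Group Γ] : TopologicalSpace (SLCharVar Γ) :=
  TopologicalSpace.induced (fun (x : invariantFunctions Γ →ₐ[ℂ] ℂ) f => x f) inferInstance

end TwistedHopf

end

noncomputable section

namespace TwistedHopf

/-! ### Collapsing a contractible subspace -/

/-! Everything is read off from the half traces (x, y, z) of the images of a, b and ab.

SU(2). Conjugate so that a becomes diag(ζ, ζ⁻¹) with Im ζ ≥ 0 and b has diagonal (p, p̄) and a
nonnegative real lower left entry. Since aⁿ commutes with b, either |p| = 1, and both matrices are
diagonal, or ζ²ⁿ = 1 (`exists_normal_form`). In these terms x = Re ζ, y = Re p and z − xy = −Im ζ ·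
Im p, so the half traces separate classes (`normal_params_unique`). The character variety is
compact, hence homeomorphic to its image `slicedBody` in ℝ³: the surface (z − xy)² = (1 − x²)(1 −
y²) over the square |x|, |y| ≤ 1, together with the flat slices at x = cos(πj/n), 0 < j < n, of the
body that it bounds. The surface is both the totally reducible locus and the pillowcase; every ray
from the origin meets it exactly once, so it is a sphere. The slices are the attached discs, and
their interiors are the irreducible classes.

Homotopy type. The slices, including the degenerate ones at x = ±1, and the curve y = 1, z = x form
a contractible set, because each slice slides along segments to its point on the curve. What remains
is n open squares, parametrized by (θ, φ) ↦ (cos θ, cos φ, cos(θ + φ)) with θ between consecutive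
multiples of π/n. Collapsing the contractible set leaves a wedge of n spheres
(`IsSquareAttachment.homotopyEquiv`).

SL(2, ℂ). Up to conjugation, and up to replacing triangular representations by their diagonal parts,
which invariant functions do not notice, a representation is diagonal or sends a to diag(ζ, ζ⁻¹), ζ
= exp(πij/n), and b to a matrix with lower left entry 1 (`exists_standard_rep`). On diagonal
representations an invariant function is a polynomial in the half traces by Weyl symmetry, and this
polynomial can be corrected slice by slice until it is right everywhere (`exists_poly_slices`).
Hence the GIT quotient is `complexModel`: a cubic surface and n − 1 planes in ℂ³. It is the quotient
of `coverModel` by (w, d) ↦ (−w, −d). The deformation `shrink` pushes the conic y² − d² = 1 to its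
compact real circle and ℂ² to the disc bounded by that circle, and it commutes with the sign change;
applied to both factors it descends to a deformation of `complexModel` onto the real points, which
are `slicedBody`. -/

/-- The square `[-1, 1]²`, as the unit ball of `ℝ × ℝ` with the sup norm. -/
abbrev Square : Type := Metric.closedBall (0 : ℝ × ℝ) 1

theorem Square.norm_le (p : Square) : ‖(p : ℝ × ℝ)‖ ≤ 1 := mem_closedBall_zero_iff.mp p.2

theorem Square.norm_eq (p : ℝ × ℝ) : ‖p‖ = max |p.1| |p.2| := rfl

theorem squareDenom_pos (p : ℝ × ℝ) : 0 < p.1 ^ 2 + p.2 ^ 2 + (1 - ‖p‖) ^ 2 := by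
  by_cases h : ‖p‖ = 1
  · have : p ≠ 0 := by rintro rfl; simp at h
    have h2 : p.1 ≠ 0 ∨ p.2 ≠ 0 := by
      by_contra! h3
      exact this (Prod.ext h3.1 h3.2)
    rcases h2 with h2 | h2 <;> positivity
  · have : 1 - ‖p‖ ≠ 0 := fun h' => h (by linarith)
    positivity

/-- The map from the square onto the sphere that collapses the boundary of the square. -/
def squareToSphere (p : Square) : Sphere2 :=
  -- Inverse stereographic projection from `basePoint`, applied to p / (1 − ‖p‖). With denominators
  -- cleared the formula also makes sense on the boundary, which goes to the pole.
  ⟨WithLp.toLp 2 ![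
      ((p.1.1 ^ 2 + p.1.2 ^ 2 - (1 - ‖p.1‖) ^ 2) / (p.1.1 ^ 2 + p.1.2 ^ 2 + (1 - ‖p.1‖) ^ 2)),
      (2 * (1 - ‖p.1‖) * p.1.1 / (p.1.1 ^ 2 + p.1.2 ^ 2 + (1 - ‖p.1‖) ^ 2)),
      (2 * (1 - ‖p.1‖) * p.1.2 / (p.1.1 ^ 2 + p.1.2 ^ 2 + (1 - ‖p.1‖) ^ 2))], by
    have h := squareDenom_pos p.1
    rw [mem_sphere_zero_iff_norm, EuclideanSpace.norm_eq, Real.sqrt_eq_one]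
    simp only [Fin.sum_univ_three, Real.norm_eq_abs, sq_abs]
    simp only [Matrix.cons_val_zero, Matrix.cons_val_one, Matrix.cons_val]
    field_simp
    ring⟩

theorem continuous_squareToSphere : Continuous squareToSphere := by
  refine Continuous.subtype_mk ?_ _
  refine (PiLp.continuous_toLp 2 _).comp ?_
  refine continuous_pi fun i => ?_
  have h : ∀ p : Square, (p.1.1 ^ 2 + p.1.2 ^ 2 + (1 - ‖p.1‖) ^ 2) ≠ 0 :=
    fun p => (squareDenom_pos p.1).ne'
  fin_cases i
  · exact Continuous.div (by fun_prop) (by fun_prop) h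
  · exact Continuous.div (by fun_prop) (by fun_prop) h
  · exact Continuous.div (by fun_prop) (by fun_prop) h

theorem sphere2_sq (v : Sphere2) : v.1 0 ^ 2 + v.1 1 ^ 2 + v.1 2 ^ 2 = 1 := by
  have h := mem_sphere_zero_iff_norm.mp v.2
  rw [EuclideanSpace.norm_eq, Real.sqrt_eq_one] at h
  simpa [Fin.sum_univ_three] using h

theorem sphere2_eq_basePoint {v : Sphere2} (h : v.1 0 = 1) : v = basePoint := by
  have h1 := sphere2_sq v
  rw [h] at h1
  have h2 : v.1 1 = 0 := by nlinarith [sq_nonneg (v.1 1), sq_nonneg (v.1 2)]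
  have h3 : v.1 2 = 0 := by nlinarith [sq_nonneg (v.1 1), sq_nonneg (v.1 2)]
  apply Subtype.ext
  ext i
  fin_cases i
  · simpa [basePoint] using h
  · simpa [basePoint] using h2
  · simpa [basePoint] using h3

theorem squareToSphere_eq_basePoint_iff (p : Square) :
    squareToSphere p = basePoint ↔ ‖p.1‖ = 1 := by
  have h := squareDenom_pos p.1
  constructor
  · intro hp
    have h0 : (squareToSphere p).1 0 = 1 := by rw [hp]; simp [basePoint]
    have h1 : (p.1.1 ^ 2 + p.1.2 ^ 2 - (1 - ‖p.1‖) ^ 2) /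
      (p.1.1 ^ 2 + p.1.2 ^ 2 + (1 - ‖p.1‖) ^ 2) = 1 := h0
    rw [div_eq_one_iff_eq h.ne'] at h1
    have : (1 - ‖p.1‖) ^ 2 = 0 := by linarith
    have := pow_eq_zero_iff (two_ne_zero) |>.mp this
    linarith
  · intro hp
    apply sphere2_eq_basePoint
    change (p.1.1 ^ 2 + p.1.2 ^ 2 - (1 - ‖p.1‖) ^ 2) /
      (p.1.1 ^ 2 + p.1.2 ^ 2 + (1 - ‖p.1‖) ^ 2) = 1
    rw [div_eq_one_iff_eq h.ne', hp]
    ring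

theorem norm_div_pos (p : ℝ × ℝ) {s : ℝ} (hs : 0 < s) :
    max |p.1 / s| |p.2 / s| = ‖p‖ / s := by
  rw [abs_div, abs_div, abs_of_pos hs, max_div_div_right hs.le, Square.norm_eq]

/-- Stereographic projection recovers p / (1 − ‖p‖). This vector determines p, because its norm ‖p‖
/ (1 − ‖p‖) determines ‖p‖; injectivity on the open square follows. -/
theorem squareToSphere_ratio (p : Square) (hp : ‖p.1‖ < 1) :
    (squareToSphere p).1 1 / (1 - (squareToSphere p).1 0) = p.1.1 / (1 - ‖p.1‖) ∧
    (squareToSphere p).1 2 / (1 - (squareToSphere p).1 0) = p.1.2 / (1 - ‖p.1‖) := by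
  have h := squareDenom_pos p.1
  have hs : 0 < 1 - ‖p.1‖ := by linarith
  have e0 : 1 - (squareToSphere p).1 0 =
      2 * (1 - ‖p.1‖) ^ 2 / (p.1.1 ^ 2 + p.1.2 ^ 2 + (1 - ‖p.1‖) ^ 2) := by
    change 1 - (p.1.1 ^ 2 + p.1.2 ^ 2 - (1 - ‖p.1‖) ^ 2) /
      (p.1.1 ^ 2 + p.1.2 ^ 2 + (1 - ‖p.1‖) ^ 2) = _
    field_simp
    ring
  rw [e0]
  constructor
  · change (2 * (1 - ‖p.1‖) * p.1.1 / (p.1.1 ^ 2 + p.1.2 ^ 2 + (1 - ‖p.1‖) ^ 2)) / _ = _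
    field_simp
  · change (2 * (1 - ‖p.1‖) * p.1.2 / (p.1.1 ^ 2 + p.1.2 ^ 2 + (1 - ‖p.1‖) ^ 2)) / _ = _
    field_simp

theorem squareToSphere_injective_interior {p q : Square} (hp : ‖p.1‖ < 1) (hq : ‖q.1‖ < 1)
    (h : squareToSphere p = squareToSphere q) : p = q := by
  have hsp : 0 < 1 - ‖p.1‖ := by linarith
  have hsq : 0 < 1 - ‖q.1‖ := by linarith
  have h1 : p.1.1 / (1 - ‖p.1‖) = q.1.1 / (1 - ‖q.1‖) := by
    rw [← (squareToSphere_ratio p hp).1, h, (squareToSphere_ratio q hq).1]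
  have h2 : p.1.2 / (1 - ‖p.1‖) = q.1.2 / (1 - ‖q.1‖) := by
    rw [← (squareToSphere_ratio p hp).2, h, (squareToSphere_ratio q hq).2]
  have h3 : ‖p.1‖ / (1 - ‖p.1‖) = ‖q.1‖ / (1 - ‖q.1‖) := by
    rw [← norm_div_pos _ hsp, ← norm_div_pos _ hsq, h1, h2]
  have h4 : ‖p.1‖ = ‖q.1‖ := by
    rw [div_eq_div_iff hsp.ne' hsq.ne'] at h3
    linarith
  rw [h4, div_left_inj' hsq.ne'] at h1 h2
  exact Subtype.ext (Prod.ext h1 h2)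

theorem squareToSphere_surjective : Function.Surjective squareToSphere := by
  intro v
  have hv := sphere2_sq v
  by_cases h0 : v.1 0 = 1
  · refine ⟨⟨(1, 1), by simp⟩, ?_⟩
    rw [sphere2_eq_basePoint h0, squareToSphere_eq_basePoint_iff]
    simp
  · have h0' : 0 < 1 - v.1 0 := by
      have : v.1 0 ≤ 1 := by nlinarith [sq_nonneg (v.1 1), sq_nonneg (v.1 2)]
      exact sub_pos.mpr (lt_of_le_of_ne this h0)
    -- u is the stereographic projection of v, and u / (1 + ‖u‖) inverts p ↦ p / (1 − ‖p‖).
    set u : ℝ × ℝ := (v.1 1 / (1 - v.1 0), v.1 2 / (1 - v.1 0)) with hu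
    have hpos : 0 < 1 + ‖u‖ := by positivity
    have hn : ‖(1 + ‖u‖)⁻¹ • u‖ = ‖u‖ / (1 + ‖u‖) := by
      rw [norm_smul, norm_inv, Real.norm_of_nonneg hpos.le]
      ring
    have hlt : ‖u‖ / (1 + ‖u‖) < 1 := by rw [div_lt_one hpos]; linarith
    refine ⟨⟨(1 + ‖u‖)⁻¹ • u, by rw [mem_closedBall_zero_iff, hn]; exact hlt.le⟩, ?_⟩
    have hs : 1 - ‖u‖ / (1 + ‖u‖) = (1 + ‖u‖)⁻¹ := by field_simp; ring
    have hu2 : u.1 ^ 2 + u.2 ^ 2 + 1 = 2 / (1 - v.1 0) := by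
      rw [hu]
      field_simp
      nlinarith
    have hu3 : u.1 ^ 2 + u.2 ^ 2 - 1 = 2 * v.1 0 / (1 - v.1 0) := by
      rw [hu]
      field_simp
      nlinarith
    have hne := hpos.ne'
    apply Subtype.ext
    ext i
    fin_cases i
    · change (((1 + ‖u‖)⁻¹ * u.1) ^ 2 + ((1 + ‖u‖)⁻¹ * u.2) ^ 2 - (1 - ‖(1 + ‖u‖)⁻¹ • u‖) ^ 2) /
        (((1 + ‖u‖)⁻¹ * u.1) ^ 2 + ((1 + ‖u‖)⁻¹ * u.2) ^ 2 + (1 - ‖(1 + ‖u‖)⁻¹ • u‖) ^ 2) = v.1 0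
      rw [hn, hs]
      have e1 : ((1 + ‖u‖)⁻¹ * u.1) ^ 2 + ((1 + ‖u‖)⁻¹ * u.2) ^ 2 - (1 + ‖u‖)⁻¹ ^ 2 =
        (1 + ‖u‖)⁻¹ ^ 2 * (u.1 ^ 2 + u.2 ^ 2 - 1) := by ring
      have e2 : ((1 + ‖u‖)⁻¹ * u.1) ^ 2 + ((1 + ‖u‖)⁻¹ * u.2) ^ 2 + (1 + ‖u‖)⁻¹ ^ 2 =
        (1 + ‖u‖)⁻¹ ^ 2 * (u.1 ^ 2 + u.2 ^ 2 + 1) := by ring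
      rw [e1, e2, hu2, hu3]
      field_simp
    · change (2 * (1 - ‖(1 + ‖u‖)⁻¹ • u‖) * ((1 + ‖u‖)⁻¹ * u.1)) /
        (((1 + ‖u‖)⁻¹ * u.1) ^ 2 + ((1 + ‖u‖)⁻¹ * u.2) ^ 2 + (1 - ‖(1 + ‖u‖)⁻¹ • u‖) ^ 2) = v.1 1
      rw [hn, hs]
      have e2 : ((1 + ‖u‖)⁻¹ * u.1) ^ 2 + ((1 + ‖u‖)⁻¹ * u.2) ^ 2 + (1 + ‖u‖)⁻¹ ^ 2 =
        (1 + ‖u‖)⁻¹ ^ 2 * (u.1 ^ 2 + u.2 ^ 2 + 1) := by ring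
      have e3 : u.1 = v.1 1 / (1 - v.1 0) := rfl
      rw [e2, hu2, e3]
      field_simp
    · change (2 * (1 - ‖(1 + ‖u‖)⁻¹ • u‖) * ((1 + ‖u‖)⁻¹ * u.2)) /
        (((1 + ‖u‖)⁻¹ * u.1) ^ 2 + ((1 + ‖u‖)⁻¹ * u.2) ^ 2 + (1 - ‖(1 + ‖u‖)⁻¹ • u‖) ^ 2) = v.1 2
      rw [hn, hs]
      have e2 : ((1 + ‖u‖)⁻¹ * u.1) ^ 2 + ((1 + ‖u‖)⁻¹ * u.2) ^ 2 + (1 + ‖u‖)⁻¹ ^ 2 =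
        (1 + ‖u‖)⁻¹ ^ 2 * (u.1 ^ 2 + u.2 ^ 2 + 1) := by ring
      have e3 : u.2 = v.1 2 / (1 - v.1 0) := rfl
      rw [e2, hu2, e3]
      field_simp

/-! ### Maps out of a wedge of spheres -/

/-- The characteristic map of a cell of the wedge of spheres. -/
def wedgeCell {ι : Type*} (i : ι) (p : Square) : Wedge ι Sphere2 basePoint :=
  Quot.mk _ ⟨i, squareToSphere p⟩

theorem continuous_wedgeCell {ι : Type*} (i : ι) : Continuous (wedgeCell i) :=
  continuous_quot_mk.comp (continuous_sigmaMk.comp continuous_squareToSphere)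

theorem wedgeCell_boundary {ι : Type*} {i j : ι} {p q : Square} (hp : ‖p.1‖ = 1)
    (hq : ‖q.1‖ = 1) : wedgeCell i p = wedgeCell j q :=
  Quot.sound ⟨(squareToSphere_eq_basePoint_iff p).mpr hp, (squareToSphere_eq_basePoint_iff q).mpr hq⟩

theorem wedgeCell_surjective {ι : Type*} (w : Wedge ι Sphere2 basePoint) :
    ∃ (i : ι) (p : Square), wedgeCell i p = w := by
  induction w using Quot.ind with
  | mk a =>
    obtain ⟨i, v⟩ := a
    obtain ⟨p, rfl⟩ := squareToSphere_surjective v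
    exact ⟨i, p, rfl⟩

/-- A map out of a wedge of spheres is given by maps on the cells that are constant on the
boundaries. -/
theorem exists_wedge_lift {ι Y : Type*} [TopologicalSpace Y] (G : ι → C(Square, Y)) (y : Y)
    (hG : ∀ i p, ‖p.1‖ = 1 → G i p = y) :
    ∃ g : C(Wedge ι Sphere2 basePoint, Y), ∀ i p, g (wedgeCell i p) = G i p := by
  have hq : IsQuotientMap (⟨squareToSphere, continuous_squareToSphere⟩ : C(Square, Sphere2)) :=
    IsQuotientMap.of_surjective_continuous squareToSphere_surjective continuous_squareToSphere
  have hf : ∀ i, Function.FactorsThrough (G i)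
      (⟨squareToSphere, continuous_squareToSphere⟩ : C(Square, Sphere2)) := by
    intro i p q hpq
    change squareToSphere p = squareToSphere q at hpq
    by_cases hp : ‖p.1‖ = 1
    · have hq : ‖q.1‖ = 1 := by
        rw [← squareToSphere_eq_basePoint_iff, ← hpq, squareToSphere_eq_basePoint_iff, hp]
      rw [hG i p hp, hG i q hq]
    · have hq : ‖q.1‖ ≠ 1 := by
        rwa [Ne, ← squareToSphere_eq_basePoint_iff, ← hpq, squareToSphere_eq_basePoint_iff]
      rw [squareToSphere_injective_interior (lt_of_le_of_ne p.norm_le hp)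
        (lt_of_le_of_ne q.norm_le hq) hpq]
  let g' : (Σ _ : ι, Sphere2) → Y := fun a => hq.lift (G a.1) (hf a.1) a.2
  have hg'c : Continuous g' := by
    rw [continuous_sigma_iff]
    intro i
    exact (hq.lift (G i) (hf i)).continuous
  have hval : ∀ i p, g' ⟨i, squareToSphere p⟩ = G i p := fun i p =>
    DFunLike.congr_fun (hq.lift_comp (G i) (hf i)) p
  have hb : ∀ i, g' ⟨i, basePoint⟩ = y := by
    intro i
    have h1 : ‖((⟨(1, 1), by simp⟩ : Square) : ℝ × ℝ)‖ = 1 := by simp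
    rw [← (squareToSphere_eq_basePoint_iff _).mpr h1, hval, hG _ _ h1]
  have hr : ∀ a b : (Σ _ : ι, Sphere2), a.2 = basePoint ∧ b.2 = basePoint → g' a = g' b := by
    rintro ⟨i, v⟩ ⟨j, w⟩ ⟨rfl, rfl⟩
    rw [hb, hb]
  exact ⟨⟨Quot.lift g' hr, continuous_quot_lift hr hg'c⟩, hval⟩

/-! ### Spaces obtained by attaching squares -/

/-- `X` arises from the closed subspace `K` by attaching squares. -/
structure IsSquareAttachment {X : Type*} [TopologicalSpace X] (K : Set X) {ι : Type*}
    (q : ι → C(Square, X)) : Prop where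
  isClosed : IsClosed K
  boundary : ∀ i p, ‖p.1‖ = 1 → q i p ∈ K
  interior : ∀ i p, ‖p.1‖ < 1 → q i p ∉ K
  injective : ∀ i j p p', ‖p.1‖ < 1 → ‖p'.1‖ < 1 → q i p = q j p' → i = j ∧ p = p'
  exhaust : ∀ x, x ∉ K → ∃ i p, q i p = x

/-- The disjoint union of K and finitely many squares is compact and X is Hausdorff, so its
surjection onto X is automatically a quotient map. This is why `IsSquareAttachment` carries no
condition on the topology of X. -/
theorem IsSquareAttachment.exists_glue {X Y ι : Type*} [TopologicalSpace X] [CompactSpace X]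
    [T2Space X] [TopologicalSpace Y] [Finite ι] {K : Set X} {q : ι → C(Square, X)}
    (h : IsSquareAttachment K q) (F : C(K, Y)) (G : ι → C(Square, Y))
    (hFG : ∀ i p (hp : ‖p.1‖ = 1), G i p = F ⟨q i p, h.boundary i p hp⟩) :
    ∃ f : C(X, Y), (∀ x : K, f x = F x) ∧ ∀ i p, f (q i p) = G i p := by
  let Q : C(K ⊕ (Σ _ : ι, Square), X) :=
    ⟨Sum.elim (fun x => (x : X)) (fun a => q a.1 a.2), continuous_subtype_val.sumElim
      (continuous_sigma fun i => (q i).continuous)⟩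
  let R : C(K ⊕ (Σ _ : ι, Square), Y) :=
    ⟨Sum.elim F (fun a => G a.1 a.2), F.continuous.sumElim
      (continuous_sigma fun i => (G i).continuous)⟩
  have : CompactSpace K := isCompact_iff_compactSpace.mp h.isClosed.isCompact
  have hQ : IsQuotientMap Q := by
    refine IsQuotientMap.of_surjective_continuous ?_ Q.continuous
    intro x
    by_cases hx : x ∈ K
    · exact ⟨Sum.inl ⟨x, hx⟩, rfl⟩
    · obtain ⟨i, p, hp⟩ := h.exhaust x hx
      exact ⟨Sum.inr ⟨i, p⟩, hp⟩
  have key : ∀ i p (hp : q i p ∈ K), G i p = F ⟨q i p, hp⟩ := by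
    intro i p hp
    by_cases h1 : ‖p.1‖ = 1
    · exact hFG i p h1
    · exact absurd hp (h.interior i p (lt_of_le_of_ne p.norm_le h1))
  have hfac : Function.FactorsThrough R Q := by
    rintro (x | ⟨i, p⟩) (y | ⟨j, p'⟩) hxy
    · rw [Subtype.ext (show (x : X) = y from hxy)]
    · obtain ⟨x, hx⟩ := x
      have hxy' : x = q j p' := hxy
      subst hxy'
      exact (key j p' hx).symm
    · obtain ⟨y, hy⟩ := y
      have hxy' : q i p = y := hxy
      subst hxy'
      exact key i p hy
    · have hxy' : q i p = q j p' := hxy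
      change G i p = G j p'
      by_cases hK : q i p ∈ K
      · rw [key i p hK, key j p' (hxy' ▸ hK)]
        congr 2
      · have h1 : ‖p.1‖ < 1 := lt_of_le_of_ne p.norm_le fun h1 => hK (h.boundary i p h1)
        have h2 : ‖p'.1‖ < 1 :=
          lt_of_le_of_ne p'.norm_le fun h1 => hK (hxy' ▸ h.boundary j p' h1)
        obtain ⟨rfl, rfl⟩ := h.injective i j p p' h1 h2 hxy'
        rfl
  have hl : ∀ a, hQ.lift R hfac (Q a) = R a := DFunLike.congr_fun (hQ.lift_comp R hfac)
  exact ⟨hQ.lift R hfac, fun x => hl (Sum.inl x), fun i p => hl (Sum.inr ⟨i, p⟩)⟩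

/-! ### Extending a contraction of the subspace over the cells -/

/-- Dilation of the square by the factor `1 + t`, followed by radial retraction to the square. -/
def dilate (t : unitInterval) (p : Square) : Square :=
  ⟨(max 1 ((1 + (t : ℝ)) * ‖p.1‖))⁻¹ • (1 + (t : ℝ)) • p.1, by
    have h0 : 0 ≤ 1 + (t : ℝ) := by linarith [t.2.1]
    have h1 : 0 < max 1 ((1 + (t : ℝ)) * ‖p.1‖) := lt_max_of_lt_left one_pos
    rw [mem_closedBall_zero_iff, norm_smul, norm_smul, norm_inv, Real.norm_of_nonneg h1.le,
      Real.norm_of_nonneg h0, inv_mul_le_one₀ h1]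
    exact le_max_right _ _⟩

theorem continuous_dilate : Continuous fun a : unitInterval × Square => dilate a.1 a.2 := by
  refine Continuous.subtype_mk ?_ _
  have h1 : Continuous fun a : unitInterval × Square =>
      max 1 ((1 + (a.1 : ℝ)) * ‖a.2.1‖) := by fun_prop
  have h2 : Continuous fun a : unitInterval × Square => (1 + (a.1 : ℝ)) • a.2.1 := by fun_prop
  exact (h1.inv₀ fun a => (lt_max_of_lt_left one_pos).ne').smul h2

theorem norm_dilate {t : unitInterval} {p : Square} (h : 1 ≤ (1 + (t : ℝ)) * ‖p.1‖) :
    ‖(dilate t p).1‖ = 1 := by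
  have h0 : 0 ≤ 1 + (t : ℝ) := by linarith [t.2.1]
  have h1 : 0 < (1 + (t : ℝ)) * ‖p.1‖ := by linarith
  change ‖(max 1 ((1 + (t : ℝ)) * ‖p.1‖))⁻¹ • (1 + (t : ℝ)) • p.1‖ = 1
  rw [max_eq_right h, norm_smul, norm_smul, norm_inv, Real.norm_of_nonneg h1.le,
      Real.norm_of_nonneg h0, inv_mul_cancel₀ h1.ne']

theorem dilate_zero (p : Square) : dilate 0 p = p := by
  apply Subtype.ext
  change (max 1 ((1 + (0 : ℝ)) * ‖p.1‖))⁻¹ • (1 + (0 : ℝ)) • p.1 = p.1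
  rw [max_eq_left (by linarith [p.norm_le])]
  simp

theorem dilate_boundary (t : unitInterval) {p : Square} (hp : ‖p.1‖ = 1) : dilate t p = p := by
  apply Subtype.ext
  have h0 : 0 < 1 + (t : ℝ) := by linarith [t.2.1]
  change (max 1 ((1 + (t : ℝ)) * ‖p.1‖))⁻¹ • (1 + (t : ℝ)) • p.1 = p.1
  rw [max_eq_right (by rw [hp]; linarith [t.2.1]), hp, mul_one, inv_smul_smul₀ h0.ne']

section Collapse

variable {X ι : Type*} [TopologicalSpace X] {K : Set X} {q : ι → C(Square, X)} {b : K}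

open Classical in
/-- The extension to a cell of a contraction of `K`. -/
def cellHomotopy (h : IsSquareAttachment K q)
    (c : (ContinuousMap.id K).Homotopy (ContinuousMap.const K b)) (i : ι)
    (a : Square × unitInterval) : X :=
  -- At time t the points with ‖p‖ ≥ 1/(1 + t) have been pushed to the boundary, hence into K. There
  -- the contraction has run for time (1 + t)‖p‖ − 1, which is 0 where the two regions meet and t on
  -- the boundary of the square.
  if ha : 1 ≤ (1 + (a.2 : ℝ)) * ‖a.1.1‖ then
    c (Set.projIcc 0 1 zero_le_one ((1 + (a.2 : ℝ)) * ‖a.1.1‖ - 1),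
      ⟨q i (dilate a.2 a.1), h.boundary i _ (norm_dilate ha)⟩)
  else q i (dilate a.2 a.1)

variable (h : IsSquareAttachment K q)
    (c : (ContinuousMap.id K).Homotopy (ContinuousMap.const K b))

/-- Where the two regions meet, the contraction is at time 0 and is the identity, so both formulas
hold on closed sets and can be pasted. -/
theorem cellHomotopy_of_le (i : ι) {a : Square × unitInterval}
    (ha : (1 + (a.2 : ℝ)) * ‖a.1.1‖ ≤ 1) : cellHomotopy h c i a = q i (dilate a.2 a.1) := by
  unfold cellHomotopy
  split_ifs with h1
  · have h2 : (1 + (a.2 : ℝ)) * ‖a.1.1‖ - 1 = 0 := by linarith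
    rw [h2, Set.projIcc_left]
    simp
  · rfl

theorem cellHomotopy_of_ge (i : ι) {a : Square × unitInterval}
    (ha : 1 ≤ (1 + (a.2 : ℝ)) * ‖a.1.1‖) : cellHomotopy h c i a =
      c (Set.projIcc 0 1 zero_le_one ((1 + (a.2 : ℝ)) * ‖a.1.1‖ - 1),
      ⟨q i (dilate a.2 a.1), h.boundary i _ (norm_dilate ha)⟩) := by
  unfold cellHomotopy
  rw [dif_pos ha]

theorem continuous_cellHomotopy (i : ι) : Continuous (cellHomotopy h c i) := by
  have hcd : Continuous fun a : Square × unitInterval => dilate a.2 a.1 :=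
    continuous_dilate.comp continuous_swap
  have hr : Continuous fun a : Square × unitInterval => (1 + (a.2 : ℝ)) * ‖a.1.1‖ := by fun_prop
  have hA : IsClosed {a : Square × unitInterval | (1 + (a.2 : ℝ)) * ‖a.1.1‖ ≤ 1} :=
    isClosed_le hr continuous_const
  have hB : IsClosed {a : Square × unitInterval | 1 ≤ (1 + (a.2 : ℝ)) * ‖a.1.1‖} :=
    isClosed_le continuous_const hr
  have hU : {a : Square × unitInterval | (1 + (a.2 : ℝ)) * ‖a.1.1‖ ≤ 1} ∪
      {a | 1 ≤ (1 + (a.2 : ℝ)) * ‖a.1.1‖} = Set.univ :=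
    Set.eq_univ_of_forall fun a => le_total ((1 + (a.2 : ℝ)) * ‖a.1.1‖) 1
  rw [← continuousOn_univ, ← hU]
  refine ContinuousOn.union_of_isClosed ?_ ?_ hA hB
  · exact ((q i).continuous.comp hcd).continuousOn.congr fun a ha => cellHomotopy_of_le h c i ha
  · rw [continuousOn_iff_continuous_domRestrict]
    have : Set.domRestrict {a : Square × unitInterval | 1 ≤ (1 + (a.2 : ℝ)) * ‖a.1.1‖}
        (cellHomotopy h c i) = fun a => (c (Set.projIcc 0 1 zero_le_one
          ((1 + (a.1.2 : ℝ)) * ‖a.1.1.1‖ - 1),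
          ⟨q i (dilate a.1.2 a.1.1), h.boundary i _ (norm_dilate a.2)⟩) : X) :=
      funext fun a => cellHomotopy_of_ge h c i a.2
    rw [this]
    refine continuous_subtype_val.comp (c.continuous.comp (Continuous.prodMk ?_ ?_))
    · exact continuous_projIcc.comp (((hr.comp continuous_subtype_val)).sub continuous_const)
    · exact Continuous.subtype_mk ((q i).continuous.comp (hcd.comp continuous_subtype_val)) _

theorem cellHomotopy_zero (i : ι) (p : Square) : cellHomotopy h c i (p, 0) = q i p := by
  rw [cellHomotopy_of_le h c i (by simpa using p.norm_le), dilate_zero]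

theorem cellHomotopy_boundary (i : ι) (p : Square) (t : unitInterval) (hp : ‖p.1‖ = 1) :
    cellHomotopy h c i (p, t) = c (t, ⟨q i p, h.boundary i p hp⟩) := by
  have h1 : 1 ≤ (1 + (t : ℝ)) * ‖p.1‖ := by rw [hp]; linarith [t.2.1]
  rw [cellHomotopy_of_ge h c i h1]
  simp only [dilate_boundary t hp]
  congr
  rw [hp, mul_one, add_sub_cancel_left, Set.projIcc_val]

/-- Collapsing a closed contractible subspace to which squares are attached gives a wedge of
spheres, up to homotopy. -/
theorem IsSquareAttachment.homotopyEquiv (h : IsSquareAttachment K q) [CompactSpace X] [T2Space X] [Finite ι] [Nonempty ι]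
    [ContractibleSpace K] : Nonempty (X ≃ₕ Wedge ι Sphere2 basePoint) := by
  obtain ⟨b, ⟨c⟩⟩ := id_nullhomotopic K
  obtain ⟨i₀⟩ := ‹Nonempty ι›
  let p₀ : Square := ⟨(1, 1), by simp⟩
  have hp₀ : ‖p₀.1‖ = 1 := by simp [p₀]
  -- f collapses K. Its homotopy inverse g is the end of the cell homotopy: it stretches the inner
  -- half of each square over the whole cell and sends the outer half into K by the contraction. The
  -- homotopies below are built as maps into path spaces, so gluing applies to them directly and no
  -- quotient map has to be multiplied by the interval.
  obtain ⟨f, hfK, hfq⟩ := h.exists_glue (ContinuousMap.const K (wedgeCell i₀ p₀))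
    (fun i => ⟨wedgeCell i, continuous_wedgeCell i⟩) fun i p hp => wedgeCell_boundary hp hp₀
  have hfb : ∀ x ∈ K, f x = wedgeCell i₀ p₀ := fun x hx => hfK ⟨x, hx⟩
  obtain ⟨g, hg⟩ := exists_wedge_lift (fun i => (⟨fun p => cellHomotopy h c i (p, 1),
    (continuous_cellHomotopy h c i).comp (by fun_prop)⟩ : C(Square, X))) (b : X) (by
      intro i p hp
      change cellHomotopy h c i (p, 1) = b
      rw [cellHomotopy_boundary h c i p 1 hp]
      simp)
  have hg : ∀ i p, g (wedgeCell i p) = cellHomotopy h c i (p, 1) := hg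
  -- the homotopy on `X`
  obtain ⟨H, hHK, hHq⟩ := h.exists_glue (Y := C(unitInterval, X))
    (ContinuousMap.curry ⟨fun a : K × unitInterval => (c (a.2, a.1) : X), by fun_prop⟩)
    (fun i => ContinuousMap.curry ⟨cellHomotopy h c i, continuous_cellHomotopy h c i⟩) (by
      intro i p hp
      ext t
      exact cellHomotopy_boundary h c i p t hp)
  have hHK : ∀ x (hx : x ∈ K) t, H x t = c (t, ⟨x, hx⟩) := fun x hx t =>
    DFunLike.congr_fun (hHK ⟨x, hx⟩) t
  have hHq : ∀ i p t, H (q i p) t = cellHomotopy h c i (p, t) := fun i p t =>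
    DFunLike.congr_fun (hHq i p) t
  -- the homotopy on the wedge
  obtain ⟨W, hW⟩ := exists_wedge_lift (Y := C(unitInterval, Wedge ι Sphere2 basePoint))
    (fun i => ContinuousMap.curry ⟨fun a : Square × unitInterval => wedgeCell i (dilate a.2 a.1),
      (continuous_wedgeCell i).comp (continuous_dilate.comp continuous_swap)⟩)
    (ContinuousMap.const _ (wedgeCell i₀ p₀)) (by
      intro i p hp
      ext t
      change wedgeCell i (dilate t p) = wedgeCell i₀ p₀
      rw [dilate_boundary t hp]
      exact wedgeCell_boundary hp hp₀)
  have hW : ∀ i p t, W (wedgeCell i p) t = wedgeCell i (dilate t p) := fun i p t =>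
    DFunLike.congr_fun (hW i p) t
  have hX : (ContinuousMap.id X).Homotopic (g.comp f) := by
    refine ⟨⟨⟨fun a => H a.2 a.1, by fun_prop⟩, fun x => ?_, fun x => ?_⟩⟩
    · change H x 0 = x
      by_cases hx : x ∈ K
      · rw [hHK x hx]; simp
      · obtain ⟨i, p, rfl⟩ := h.exhaust x hx
        rw [hHq, cellHomotopy_zero]
    · change H x 1 = g (f x)
      by_cases hx : x ∈ K
      · rw [hHK x hx, hfb x hx, hg, cellHomotopy_boundary h c i₀ p₀ 1 hp₀]
        simp
      · obtain ⟨i, p, rfl⟩ := h.exhaust x hx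
        rw [hHq, hfq]
        exact (hg i p).symm
  have hWedge : (ContinuousMap.id (Wedge ι Sphere2 basePoint)).Homotopic (f.comp g) := by
    refine ⟨⟨⟨fun a => W a.2 a.1, by fun_prop⟩, fun w => ?_, fun w => ?_⟩⟩
    · obtain ⟨i, p, rfl⟩ := wedgeCell_surjective w
      change W (wedgeCell i p) 0 = wedgeCell i p
      rw [hW, dilate_zero]
    · obtain ⟨i, p, rfl⟩ := wedgeCell_surjective w
      change W (wedgeCell i p) 1 = f (g (wedgeCell i p))
      rw [hW, hg]
      -- On the inner half both sides are the dilated cell. On the outer half g lands in K, which f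
      -- sends to the base point, and the dilated point is on the boundary.
      rcases le_total ((1 + ((1 : unitInterval) : ℝ)) * ‖p.1‖) 1 with h1 | h1
      · rw [cellHomotopy_of_le h c i h1, hfq]
        rfl
      · rw [cellHomotopy_of_ge h c i h1, hfb _ (Subtype.coe_prop _)]
        exact wedgeCell_boundary (norm_dilate h1) hp₀
  exact ⟨⟨f, g, hX.symm, hWedge.symm⟩⟩

end Collapse

/-! ### A model of the character variety in `ℝ³` -/

/-- The surface `1 - x² - y² - z² + 2xyz = 0` in the cube `[-1, 1]³`. -/
def pillowSurface : Set (ℝ × ℝ × ℝ) :=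
  {p | |p.1| ≤ 1 ∧ |p.2.1| ≤ 1 ∧ (p.2.2 - p.1 * p.2.1) ^ 2 = (1 - p.1 ^ 2) * (1 - p.2.1 ^ 2)}

/-- The surface together with the slices of the body that it bounds at the heights
`cos (π j / n)`. -/
def slicedBody (n : ℕ) : Set (ℝ × ℝ × ℝ) :=
  {p | |p.1| ≤ 1 ∧ |p.2.1| ≤ 1 ∧ (p.2.2 - p.1 * p.2.1) ^ 2 ≤ (1 - p.1 ^ 2) * (1 - p.2.1 ^ 2) ∧
    ((p.2.2 - p.1 * p.2.1) ^ 2 = (1 - p.1 ^ 2) * (1 - p.2.1 ^ 2) ∨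
      ∃ j : ℕ, 0 < j ∧ j < n ∧ p.1 = Real.cos (Real.pi * j / n))}

theorem pillowSurface_subset_slicedBody (n : ℕ) : pillowSurface ⊆ slicedBody n :=
  fun _ h => ⟨h.1, h.2.1, h.2.2.le, Or.inl h.2.2⟩

/-- By the addition formula z − xy = −sin θ sin φ. -/
theorem cos_mem_pillowSurface (θ φ : ℝ) :
    (Real.cos θ, Real.cos φ, Real.cos (θ + φ)) ∈ pillowSurface := by
  refine ⟨Real.abs_cos_le_one θ, Real.abs_cos_le_one φ, ?_⟩
  simp only [Real.cos_add]
  rw [← Real.sin_sq, ← Real.sin_sq]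
  ring

/-- The equation says z − xy = ± sin θ sin φ for θ = arccos x, φ = arccos y. Both signs are reached
with θ in [0, π] by replacing φ with 2π − φ. -/
theorem exists_angles_of_mem_pillowSurface {p : ℝ × ℝ × ℝ} (hp : p ∈ pillowSurface) :
    ∃ θ φ : ℝ, θ ∈ Set.Icc 0 Real.pi ∧ φ ∈ Set.Icc 0 (2 * Real.pi) ∧
      p = (Real.cos θ, Real.cos φ, Real.cos (θ + φ)) := by
  obtain ⟨x, y, z⟩ := p
  obtain ⟨hx, hy, h⟩ := hp
  simp only at hx hy h
  obtain ⟨hx1, hx2⟩ := abs_le.mp hx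
  obtain ⟨hy1, hy2⟩ := abs_le.mp hy
  have cx := Real.cos_arccos hx1 hx2
  have cy := Real.cos_arccos hy1 hy2
  have h2 : (z - x * y) ^ 2 = (Real.sin (Real.arccos x) * Real.sin (Real.arccos y)) ^ 2 := by
    rw [h, mul_pow, Real.sin_sq, Real.sin_sq, cx, cy]
  have hpi := Real.pi_pos
  have ax := Real.arccos_nonneg x
  have ay := Real.arccos_nonneg y
  have bx := Real.arccos_le_pi x
  have bY := Real.arccos_le_pi y
  rcases sq_eq_sq_iff_eq_or_eq_neg.mp h2 with h3 | h3
  · refine ⟨Real.arccos x, 2 * Real.pi - Real.arccos y, ⟨ax, bx⟩,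
      ⟨by linarith, by linarith⟩, ?_⟩
    rw [Real.cos_add, Real.cos_two_pi_sub, Real.sin_two_pi_sub, cx, cy]
    simp only [Prod.mk.injEq, true_and]
    linarith
  · refine ⟨Real.arccos x, Real.arccos y, ⟨ax, bx⟩, ⟨ay, by linarith⟩, ?_⟩
    rw [Real.cos_add, cx, cy]
    simp only [Prod.mk.injEq, true_and]
    linarith

theorem isClosed_pillowSurface : IsClosed pillowSurface := by
  simp only [pillowSurface, Set.ofPred_and]
  refine IsClosed.inter (isClosed_le (by fun_prop) (by fun_prop)) (IsClosed.inter
    (isClosed_le (by fun_prop) (by fun_prop)) (isClosed_eq (by fun_prop) (by fun_prop)))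

theorem isClosed_exists_lt_eq (n : ℕ) (P : ℕ → Prop) (f : ℕ → ℝ) :
    IsClosed {p : ℝ × ℝ × ℝ | ∃ j : ℕ, P j ∧ j < n ∧ p.1 = f j} := by
  have : {p : ℝ × ℝ × ℝ | ∃ j : ℕ, P j ∧ j < n ∧ p.1 = f j} =
      Prod.fst ⁻¹' (f '' {j | P j ∧ j < n}) := by
    ext p
    simp only [Set.mem_ofPred_eq, Set.mem_preimage, Set.mem_image]
    constructor
    · rintro ⟨j, h1, h2, h3⟩; exact ⟨j, ⟨h1, h2⟩, h3.symm⟩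
    · rintro ⟨j, ⟨h1, h2⟩, h3⟩; exact ⟨j, h1, h2, h3.symm⟩
  rw [this]
  refine IsClosed.preimage continuous_fst (Set.Finite.isClosed (Set.Finite.image _ ?_))
  exact (Set.finite_lt_nat n).subset fun j hj => hj.2

theorem isCompact_slicedBody (n : ℕ) : IsCompact (slicedBody n) := by
  have hcl : IsClosed (slicedBody n) := by
    simp only [slicedBody, Set.ofPred_and, Set.ofPred_or]
    refine IsClosed.inter (isClosed_le (by fun_prop) (by fun_prop)) (IsClosed.inter
      (isClosed_le (by fun_prop) (by fun_prop)) (IsClosed.inter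
      (isClosed_le (by fun_prop) (by fun_prop)) (IsClosed.union
      (isClosed_eq (by fun_prop) (by fun_prop)) ?_)))
    exact isClosed_exists_lt_eq n (fun j => 0 < j) _
  refine IsCompact.of_isClosed_subset (isCompact_Icc (a := ((-2, -2, -2) : ℝ × ℝ × ℝ))
    (b := (2, 2, 2))) hcl ?_
  rintro ⟨x, y, z⟩ ⟨hx, hy, h, -⟩
  simp only at hx hy h
  obtain ⟨hx1, hx2⟩ := abs_le.mp hx
  obtain ⟨hy1, hy2⟩ := abs_le.mp hy
  have hx3 : 0 ≤ 1 - x ^ 2 := by nlinarith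
  have hy3 : 0 ≤ 1 - y ^ 2 := by nlinarith
  have h1 : (z - x * y) ^ 2 ≤ 1 := by nlinarith [sq_nonneg x, sq_nonneg y]
  obtain ⟨h2, h3⟩ := abs_le.mp ((sq_le_one_iff_abs_le_one _).mp h1)
  have h4 : |x * y| ≤ 1 := by rw [abs_mul]; exact mul_le_one₀ hx (abs_nonneg _) hy
  obtain ⟨h5, h6⟩ := abs_le.mp h4
  refine ⟨⟨?_, ?_, ?_⟩, ⟨?_, ?_, ?_⟩⟩ <;> simp only <;> linarith

theorem isCompact_pillowSurface : IsCompact pillowSurface :=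
  (isCompact_slicedBody 0).of_isClosed_subset isClosed_pillowSurface
    (pillowSurface_subset_slicedBody 0)

/-! ### The surface is a sphere -/

theorem norm_pos_of_mem_pillowSurface {p : ℝ × ℝ × ℝ} (hp : p ∈ pillowSurface) :
    0 < √(p.1 ^ 2 + p.2.1 ^ 2 + p.2.2 ^ 2) := by
  obtain ⟨x, y, z⟩ := p
  obtain ⟨-, -, h⟩ := hp
  simp only at h ⊢
  rw [Real.sqrt_pos]
  by_contra! h0
  have hx : x = 0 := by nlinarith [sq_nonneg x, sq_nonneg y, sq_nonneg z]
  have hy : y = 0 := by nlinarith [sq_nonneg x, sq_nonneg y, sq_nonneg z]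
  have hz : z = 0 := by nlinarith [sq_nonneg x, sq_nonneg y, sq_nonneg z]
  subst hx hy hz
  norm_num at h

/-- The radial projection of the surface to the sphere. -/
def surfaceToSphere (p : pillowSurface) : Sphere2 :=
  ⟨WithLp.toLp 2 ![p.1.1 / √(p.1.1 ^ 2 + p.1.2.1 ^ 2 + p.1.2.2 ^ 2),
      p.1.2.1 / √(p.1.1 ^ 2 + p.1.2.1 ^ 2 + p.1.2.2 ^ 2),
      p.1.2.2 / √(p.1.1 ^ 2 + p.1.2.1 ^ 2 + p.1.2.2 ^ 2)], by
    have h := norm_pos_of_mem_pillowSurface p.2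
    rw [mem_sphere_zero_iff_norm, EuclideanSpace.norm_eq, Real.sqrt_eq_one]
    simp only [Fin.sum_univ_three, Real.norm_eq_abs, sq_abs, Matrix.cons_val_zero,
      Matrix.cons_val_one, Matrix.cons_val, div_pow, Real.sq_sqrt (Real.sqrt_pos.mp h).le]
    rw [← add_div, ← add_div, div_self (Real.sqrt_pos.mp h).ne']⟩

theorem continuous_surfaceToSphere : Continuous surfaceToSphere := by
  refine Continuous.subtype_mk ?_ _
  refine (PiLp.continuous_toLp 2 _).comp ?_
  refine continuous_pi fun i => ?_
  have h : ∀ p : pillowSurface, √(p.1.1 ^ 2 + p.1.2.1 ^ 2 + p.1.2.2 ^ 2) ≠ 0 :=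
    fun p => (norm_pos_of_mem_pillowSurface p.2).ne'
  fin_cases i
  · exact Continuous.div (by fun_prop) (by fun_prop) h
  · exact Continuous.div (by fun_prop) (by fun_prop) h
  · exact Continuous.div (by fun_prop) (by fun_prop) h

/-- The point of the surface on a ray is unique. Eliminating x² + y² + z² from the equations of p
and cp leaves (1 − c)(1 + c − 2c²xyz) = 0. Since xyz ≤ 1, the second factor is at least (1 − c)(1 +
2c), which is positive for c < 1. Used in both directions this gives c = 1. -/
theorem pillowSurface_scale {x y z c : ℝ} (hp : (x, y, z) ∈ pillowSurface)
    (hq : (c * x, c * y, c * z) ∈ pillowSurface) (hc : 0 < c) : 1 ≤ c := by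
  obtain ⟨θ, φ, -, -, h⟩ := exists_angles_of_mem_pillowSurface hp
  have hP : x * y * z ≤ 1 := by
    refine (le_abs_self _).trans ?_
    simp only [Prod.mk.injEq] at h
    rw [h.1, h.2.1, h.2.2, abs_mul, abs_mul]
    exact mul_le_one₀ (mul_le_one₀ (Real.abs_cos_le_one _) (abs_nonneg _) (Real.abs_cos_le_one _))
      (abs_nonneg _) (Real.abs_cos_le_one _)
  have h1 := hp.2.2
  have h2 := hq.2.2
  simp only at h1 h2
  have h3 : (1 - c) * (1 + c - 2 * c ^ 2 * (x * y * z)) = 0 := by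
    linear_combination h1 * c ^ 2 - h2
  by_contra! hlt
  have h4 : 1 + c - 2 * c ^ 2 * (x * y * z) > 0 := by nlinarith [sq_nonneg c]
  rcases mul_eq_zero.mp h3 with h5 | h5 <;> linarith

theorem surfaceToSphere_injective : Function.Injective surfaceToSphere := by
  rintro ⟨⟨x, y, z⟩, hp⟩ ⟨⟨x', y', z'⟩, hq⟩ h
  have hN := norm_pos_of_mem_pillowSurface hp
  have hN' := norm_pos_of_mem_pillowSurface hq
  have h0 : x / √(x ^ 2 + y ^ 2 + z ^ 2) = x' / √(x' ^ 2 + y' ^ 2 + z' ^ 2) :=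
    congrArg (fun v : Sphere2 => v.1 0) h
  have h1 : y / √(x ^ 2 + y ^ 2 + z ^ 2) = y' / √(x' ^ 2 + y' ^ 2 + z' ^ 2) :=
    congrArg (fun v : Sphere2 => v.1 1) h
  have h2 : z / √(x ^ 2 + y ^ 2 + z ^ 2) = z' / √(x' ^ 2 + y' ^ 2 + z' ^ 2) :=
    congrArg (fun v : Sphere2 => v.1 2) h
  simp only at hN hN'
  set N := √(x ^ 2 + y ^ 2 + z ^ 2)
  set N' := √(x' ^ 2 + y' ^ 2 + z' ^ 2)
  have hx : x' = N' / N * x := by field_simp; field_simp at h0; linarith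
  have hy : y' = N' / N * y := by field_simp; field_simp at h1; linarith
  have hz : z' = N' / N * z := by field_simp; field_simp at h2; linarith
  have hx' : x = N / N' * x' := by rw [hx]; field_simp
  have hy' : y = N / N' * y' := by rw [hy]; field_simp
  have hz' : z = N / N' * z' := by rw [hz]; field_simp
  have a1 := pillowSurface_scale hp (by rwa [← hx, ← hy, ← hz]) (div_pos hN' hN)
  have a2 := pillowSurface_scale hq (by rwa [← hx', ← hy', ← hz']) (div_pos hN hN')
  rw [one_le_div₀ hN] at a1
  rw [one_le_div₀ hN'] at a2
  have a3 : N' / N = 1 := by rw [le_antisymm a1 a2, div_self hN'.ne']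
  rw [a3, one_mul] at hx hy hz
  subst hx hy hz
  rfl

theorem surfaceToSphere_surjective : Function.Surjective surfaceToSphere := by
  intro v
  have hv := sphere2_sq v
  set x := v.1 0 with hx
  set y := v.1 1 with hy
  set z := v.1 2 with hz
  set m := max |x| (max |y| |z|) with hm
  have hxm : |x| ≤ m := le_max_left _ _
  have hym : |y| ≤ m := (le_max_left _ _).trans (le_max_right _ _)
  have hzm : |z| ≤ m := (le_max_right _ _).trans (le_max_right _ _)
  have hm0 : 0 < m := by
    by_contra! h
    have e1 : x = 0 := abs_eq_zero.mp (le_antisymm (hxm.trans h) (abs_nonneg _))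
    have e2 : y = 0 := abs_eq_zero.mp (le_antisymm (hym.trans h) (abs_nonneg _))
    have e3 : z = 0 := abs_eq_zero.mp (le_antisymm (hzm.trans h) (abs_nonneg _))
    rw [e1, e2, e3] at hv
    norm_num at hv
  -- The defining function of the surface along the ray through v. It is 1 at the origin and
  -- nonpositive at t = 1/m, where the ray reaches the boundary of the cube, so it vanishes in
  -- between.
  let f : ℝ → ℝ := fun t => 1 - (t * x) ^ 2 - (t * y) ^ 2 - (t * z) ^ 2 +
    2 * (t * x) * (t * y) * (t * z)
  have hf : Continuous f := by fun_prop
  -- On a face of the cube a² = 1, and the expression is −(c − ab)².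
  have key : ∀ a b c : ℝ, |a| = 1 → 1 - a ^ 2 - b ^ 2 - c ^ 2 + 2 * a * b * c ≤ 0 := by
    intro a b c ha
    have : a ^ 2 = 1 := by rw [← sq_abs, ha, one_pow]
    nlinarith [sq_nonneg (c - a * b)]
  have hfT : f m⁻¹ ≤ 0 := by
    have hab : ∀ a, |a| = m → |m⁻¹ * a| = 1 := by
      intro a ha
      rw [abs_mul, ha, abs_inv, abs_of_pos hm0, inv_mul_cancel₀ hm0.ne']
    have hor : |x| = m ∨ |y| = m ∨ |z| = m := by
      rcases max_choice |x| (max |y| |z|) with h | h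
      · exact Or.inl (by rw [hm, h])
      · rcases max_choice |y| |z| with h' | h'
        · exact Or.inr (Or.inl (by rw [hm, h, h']))
        · exact Or.inr (Or.inr (by rw [hm, h, h']))
    rcases hor with h | h | h
    · exact key _ _ _ (hab _ h)
    · have := key _ (m⁻¹ * x) (m⁻¹ * z) (hab _ h)
      simp only [f]; linarith
    · have := key _ (m⁻¹ * x) (m⁻¹ * y) (hab _ h)
      simp only [f]; linarith
  obtain ⟨t, ht, hft⟩ := intermediate_value_Icc' (inv_nonneg.mpr hm0.le) hf.continuousOn
    (show (0 : ℝ) ∈ Set.Icc (f m⁻¹) (f 0) from ⟨hfT, by simp [f]⟩)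
  have ht0 : 0 < t := by
    refine lt_of_le_of_ne ht.1 ?_
    rintro rfl
    simp [f] at hft
  have hle : ∀ a, |a| ≤ m → |t * a| ≤ 1 := by
    intro a ha
    rw [abs_mul, abs_of_pos ht0]
    calc t * |a| ≤ m⁻¹ * m := mul_le_mul ht.2 ha (abs_nonneg _) (inv_nonneg.mpr hm0.le)
      _ = 1 := inv_mul_cancel₀ hm0.ne'
  have hmem : (t * x, t * y, t * z) ∈ pillowSurface := by
    refine ⟨hle x hxm, hle y hym, ?_⟩
    simp only [f] at hft
    simp only
    linear_combination -hft
  have hnorm : √((t * x) ^ 2 + (t * y) ^ 2 + (t * z) ^ 2) = t := by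
    rw [show (t * x) ^ 2 + (t * y) ^ 2 + (t * z) ^ 2 = t ^ 2 by linear_combination t ^ 2 * hv,
      Real.sqrt_sq ht0.le]
  refine ⟨⟨_, hmem⟩, ?_⟩
  apply Subtype.ext
  ext i
  fin_cases i
  · change t * x / √((t * x) ^ 2 + (t * y) ^ 2 + (t * z) ^ 2) = v.1 0
    rw [hnorm, mul_div_cancel_left₀ _ ht0.ne']
  · change t * y / √((t * x) ^ 2 + (t * y) ^ 2 + (t * z) ^ 2) = v.1 1
    rw [hnorm, mul_div_cancel_left₀ _ ht0.ne']
  · change t * z / √((t * x) ^ 2 + (t * y) ^ 2 + (t * z) ^ 2) = v.1 2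
    rw [hnorm, mul_div_cancel_left₀ _ ht0.ne']

/-- The surface is a sphere. -/
def pillowSurfaceHomeo : pillowSurface ≃ₜ Sphere2 :=
  haveI : CompactSpace pillowSurface := isCompact_iff_compactSpace.mp isCompact_pillowSurface
  Continuous.homeoOfEquivCompactToT2
    (f := Equiv.ofBijective surfaceToSphere ⟨surfaceToSphere_injective, surfaceToSphere_surjective⟩)
    continuous_surfaceToSphere

/-! ### The homotopy type of the sliced body -/

/-- The slices and a curve on the surface that connects them. -/
def slicedBodyCore (n : ℕ) : Set (slicedBody n) :=
  -- The indices j = 0 and j = n are included: at x = ±1 the slice is the segment z = ±y, which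
  -- already lies in the surface.
  {p | (∃ j : ℕ, j ≤ n ∧ p.1.1 = Real.cos (Real.pi * j / n)) ∨ (p.1.2.1 = 1 ∧ p.1.2.2 = p.1.1)}

theorem isClosed_slicedBodyCore (n : ℕ) : IsClosed (slicedBodyCore n) := by
  simp only [slicedBodyCore, Set.ofPred_and, Set.ofPred_or]
  refine IsClosed.union ?_ (IsClosed.inter (isClosed_eq (by fun_prop) (by fun_prop))
    (isClosed_eq (by fun_prop) (by fun_prop)))
  have := (isClosed_exists_lt_eq (n + 1) (fun _ => True)
    (fun j => Real.cos (Real.pi * j / n))).preimage (continuous_subtype_val (p := (· ∈ slicedBody n)))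
  simpa [Set.preimage, Nat.lt_succ_iff] using this

theorem curve_mem_slicedBody (n : ℕ) {x : ℝ} (hx : |x| ≤ 1) : (x, 1, x) ∈ slicedBody n := by
  refine pillowSurface_subset_slicedBody n ⟨hx, by simp, ?_⟩
  simp

/-- Each slice is star-shaped about its point (x, 1, x) on the curve: along the segment z − xy is
multiplied by 1 − t, while 1 − y² becomes at least (1 − t)²(1 − y²). When j is 0 or n the factor 1 −
x² vanishes and the inequality is an equality, so the point stays in the surface. Points of the
curve do not move. -/
theorem slide_mem_slicedBody {n : ℕ} (hn : 1 ≤ n) {p : ℝ × ℝ × ℝ} (hp : p ∈ slicedBody n)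
    (hK : (∃ j : ℕ, j ≤ n ∧ p.1 = Real.cos (Real.pi * j / n)) ∨ (p.2.1 = 1 ∧ p.2.2 = p.1))
    {t : ℝ} (h0 : 0 ≤ t) (h1 : t ≤ 1) :
    (p.1, (1 - t) * p.2.1 + t, (1 - t) * p.2.2 + t * p.1) ∈ slicedBody n := by
  obtain ⟨x, y, z⟩ := p
  obtain ⟨hx, hy, h, h'⟩ := hp
  simp only at hx hy h h' hK ⊢
  rcases hK with ⟨j, hj, hxj⟩ | ⟨rfl, rfl⟩
  · obtain ⟨hx1, hx2⟩ := abs_le.mp hx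
    obtain ⟨hy1, hy2⟩ := abs_le.mp hy
    have hx3 : 0 ≤ 1 - x ^ 2 := by nlinarith
    have hy' : (1 - t) ^ 2 * (1 - y ^ 2) ≤ 1 - ((1 - t) * y + t) ^ 2 := by
      have : 0 ≤ (1 - t) * (1 - y) * t :=
        mul_nonneg (mul_nonneg (by linarith) (by linarith)) h0
      nlinarith
    have hle : ((1 - t) * z + t * x - x * ((1 - t) * y + t)) ^ 2 ≤
        (1 - x ^ 2) * (1 - ((1 - t) * y + t) ^ 2) := by
      calc ((1 - t) * z + t * x - x * ((1 - t) * y + t)) ^ 2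
          = (1 - t) ^ 2 * (z - x * y) ^ 2 := by ring
        _ ≤ (1 - t) ^ 2 * ((1 - x ^ 2) * (1 - y ^ 2)) :=
            mul_le_mul_of_nonneg_left h (sq_nonneg _)
        _ = (1 - x ^ 2) * ((1 - t) ^ 2 * (1 - y ^ 2)) := by ring
        _ ≤ _ := mul_le_mul_of_nonneg_left hy' hx3
    refine ⟨hx, ?_, hle, ?_⟩
    · simp only
      rw [abs_le]
      constructor <;> nlinarith
    · by_cases hj' : 0 < j ∧ j < n
      · exact Or.inr ⟨j, hj'.1, hj'.2, hxj⟩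
      · left
        have hx4 : 1 - x ^ 2 = 0 := by
          have hn0 : (n : ℝ) ≠ 0 := by positivity
          rcases Nat.eq_zero_or_pos j with rfl | hpos
          · rw [hxj]; simp
          · have : j = n := by omega
            subst this
            rw [hxj, mul_div_assoc, div_self hn0]
            simp
        simp only
        rw [hx4, zero_mul] at hle ⊢
        exact le_antisymm hle (sq_nonneg _)
  · have : ((z, (1 - t) * 1 + t, (1 - t) * z + t * z) : ℝ × ℝ × ℝ) = (z, 1, z) := by
      simp only [Prod.mk.injEq, true_and]
      constructor <;> ring
    rw [this]
    exact curve_mem_slicedBody n hx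

/-- Slide every slice to its point on the curve, then contract the curve, an interval with
coordinate x, to its end x = 1. -/
theorem contractibleSpace_slicedBodyCore {n : ℕ} (hn : 1 ≤ n) :
    ContractibleSpace (slicedBodyCore n) := by
  rw [contractible_iff_id_nullhomotopic]
  have hc : ∀ {x : ℝ} (hx : |x| ≤ 1), (⟨_, curve_mem_slicedBody n hx⟩ : slicedBody n) ∈
    slicedBodyCore n := fun hx => Or.inr ⟨rfl, rfl⟩
  let r : C(slicedBodyCore n, slicedBodyCore n) :=
    ⟨fun p => ⟨_, hc p.1.2.1⟩, by
      refine Continuous.subtype_mk (Continuous.subtype_mk ?_ _) _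
      fun_prop⟩
  let b : slicedBodyCore n := ⟨_, hc (x := 1) (by simp)⟩
  refine ⟨b, ContinuousMap.Homotopic.trans (g := r) ?_ ?_⟩
  · refine ⟨⟨⟨fun a => ⟨⟨_, slide_mem_slicedBody hn a.2.1.2 a.2.2 a.1.2.1 a.1.2.2⟩, ?_⟩, ?_⟩, ?_, ?_⟩⟩
    · rcases a.2.2 with h | ⟨h, h'⟩
      · exact Or.inl h
      · right
        simp only [h, h']
        constructor <;> ring
    · refine Continuous.subtype_mk (Continuous.subtype_mk ?_ _) _
      fun_prop
    · intro p
      apply Subtype.ext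
      apply Subtype.ext
      simp
    · intro p
      apply Subtype.ext
      apply Subtype.ext
      simp [r]
  · have hb : ∀ a : unitInterval × slicedBodyCore n,
        |(1 - (a.1 : ℝ)) * a.2.1.1.1 + a.1| ≤ 1 := by
      rintro ⟨⟨t, h0, h1⟩, p⟩
      obtain ⟨h2, h3⟩ := abs_le.mp p.1.2.1
      rw [abs_le]
      constructor <;> simp only <;> nlinarith
    refine ⟨⟨⟨fun a => ⟨_, hc (hb a)⟩, ?_⟩, ?_, ?_⟩⟩
    · refine Continuous.subtype_mk (Continuous.subtype_mk ?_ _) _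
      fun_prop
    · intro p
      apply Subtype.ext
      apply Subtype.ext
      simp [r]
    · intro p
      apply Subtype.ext
      apply Subtype.ext
      simp [b]

/-- The angles that a point of the square parametrizes. -/
def cellAngle (n j : ℕ) (s : ℝ) : ℝ := Real.pi * (j + (1 + s) / 2) / n

theorem cellAngle_mem {n j : ℕ} (hj : j < n) {s : ℝ} (h1 : -1 ≤ s) (h2 : s ≤ 1) :
    cellAngle n j s ∈ Set.Icc 0 Real.pi := by
  have hn : (0 : ℝ) < n := by exact_mod_cast (Nat.zero_le j).trans_lt hj
  have hj' : (j : ℝ) + 1 ≤ n := by exact_mod_cast hj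
  have hpi := Real.pi_pos
  have hj0 : (0 : ℝ) ≤ j := Nat.cast_nonneg j
  refine ⟨div_nonneg (mul_nonneg hpi.le (by linarith)) hn.le, ?_⟩
  rw [cellAngle, div_le_iff₀ hn]
  exact mul_le_mul_of_nonneg_left (by linarith) hpi.le

theorem angle_index_mem {n i : ℕ} (hi : i ≤ n) (hn : 0 < n) :
    Real.pi * i / n ∈ Set.Icc 0 Real.pi := by
  have hn' : (0 : ℝ) < n := by exact_mod_cast hn
  have hi' : (i : ℝ) ≤ n := by exact_mod_cast hi
  have hpi := Real.pi_pos
  refine ⟨by positivity, ?_⟩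
  rw [div_le_iff₀ hn']
  exact mul_le_mul_of_nonneg_left hi' hpi.le

/-- The cells of the sliced body. -/
def slicedBodyCell (n : ℕ) (j : Fin n) : C(Square, slicedBody n) where
  -- Cell j is the part of the surface with πj/n ≤ θ ≤ π(j + 1)/n and 0 ≤ φ ≤ 2π: the band between
  -- two consecutive slices, cut open along the curve φ = 0.
  toFun p := ⟨(Real.cos (cellAngle n j p.1.1), Real.cos (Real.pi * (1 + p.1.2)),
    Real.cos (cellAngle n j p.1.1 + Real.pi * (1 + p.1.2))),
    pillowSurface_subset_slicedBody n (cos_mem_pillowSurface _ _)⟩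
  continuous_toFun := by
    refine Continuous.subtype_mk ?_ _
    unfold cellAngle
    fun_prop

theorem cos_sin_injOn {a b : ℝ} (hab : |a - b| < 2 * Real.pi) (hc : Real.cos a = Real.cos b)
    (hs : Real.sin a = Real.sin b) : a = b := by
  have h := Real.Angle.cos_sin_inj hc hs
  rw [Real.Angle.angle_eq_iff_two_pi_dvd_sub] at h
  obtain ⟨k, hk⟩ := h
  have hpi := Real.pi_pos
  rw [hk, abs_mul, abs_of_pos (by positivity)] at hab
  have hk1 : |(k : ℝ)| < 1 := by nlinarith
  have hk2 : k = 0 := by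
    rw [← Int.abs_lt_one_iff]
    exact_mod_cast hk1
  rw [hk2] at hk
  simp at hk
  linarith

theorem Square.lt_iff {p : Square} : ‖p.1‖ < 1 ↔ (-1 < p.1.1 ∧ p.1.1 < 1) ∧ -1 < p.1.2 ∧ p.1.2 < 1 := by
  rw [Square.norm_eq, max_lt_iff, abs_lt, abs_lt]

theorem isSquareAttachment_slicedBody {n : ℕ} (hn : 1 ≤ n) :
    IsSquareAttachment (slicedBodyCore n) (slicedBodyCell n) := by
  have hn0 : (0 : ℝ) < n := by exact_mod_cast hn
  have hpi := Real.pi_pos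
  refine ⟨isClosed_slicedBodyCore n, ?_, ?_, ?_, ?_⟩
  · rintro j p hp
    have hp' : |p.1.1| = 1 ∨ |p.1.2| = 1 := by
      rw [Square.norm_eq] at hp
      rcases max_choice |p.1.1| |p.1.2| with h | h
      · exact Or.inl (by rw [← h, hp])
      · exact Or.inr (by rw [← h, hp])
    rcases hp' with h | h
    · left
      rcases (abs_eq zero_le_one).mp h with h | h
      · refine ⟨j + 1, j.2, ?_⟩
        change Real.cos (cellAngle n j p.1.1) = _
        rw [h, cellAngle]
        push_cast
        norm_num
      · refine ⟨j, j.2.le, ?_⟩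
        change Real.cos (cellAngle n j p.1.1) = _
        rw [h, cellAngle]
        norm_num
    · right
      change Real.cos (Real.pi * (1 + p.1.2)) = 1 ∧
        Real.cos (cellAngle n j p.1.1 + Real.pi * (1 + p.1.2)) = Real.cos (cellAngle n j p.1.1)
      rcases (abs_eq zero_le_one).mp h with h | h
      · rw [h, show Real.pi * (1 + 1) = 2 * Real.pi by ring]
        simp
      · rw [h]
        simp
  · rintro j p hp hK
    obtain ⟨⟨h1, h2⟩, h3, h4⟩ := Square.lt_iff.mp hp
    rcases hK with ⟨i, hi, hx⟩ | ⟨hy, -⟩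
    · change Real.cos (cellAngle n j p.1.1) = _ at hx
      have := Real.injOn_cos (cellAngle_mem j.2 h1.le h2.le) (angle_index_mem hi hn) hx
      rw [cellAngle, div_left_inj' hn0.ne', mul_right_inj' hpi.ne'] at this
      have e1 : ((j : ℕ) : ℝ) < i := by linarith
      have e2 : (i : ℝ) < ((j : ℕ) : ℝ) + 1 := by linarith
      have e3 : (j : ℕ) < i := by exact_mod_cast e1
      have e4 : i < (j : ℕ) + 1 := by exact_mod_cast e2
      omega
    · change Real.cos (Real.pi * (1 + p.1.2)) = 1 at hy
      have e0 : 0 < Real.pi * (1 + p.1.2) := mul_pos hpi (by linarith)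
      have e1 : Real.pi * (1 + p.1.2) < 2 * Real.pi := by nlinarith
      rw [Real.cos_eq_one_iff_of_lt_of_lt (by linarith) e1] at hy
      linarith
  · intro i j p p' hp hp' h
    obtain ⟨⟨h1, h2⟩, h3, h4⟩ := Square.lt_iff.mp hp
    obtain ⟨⟨h1', h2'⟩, h3', h4'⟩ := Square.lt_iff.mp hp'
    have hx : Real.cos (cellAngle n i p.1.1) = Real.cos (cellAngle n j p'.1.1) :=
      congrArg (fun a : slicedBody n => a.1.1) h
    have hy : Real.cos (Real.pi * (1 + p.1.2)) = Real.cos (Real.pi * (1 + p'.1.2)) :=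
      congrArg (fun a : slicedBody n => a.1.2.1) h
    have hz : Real.cos (cellAngle n i p.1.1 + Real.pi * (1 + p.1.2)) =
        Real.cos (cellAngle n j p'.1.1 + Real.pi * (1 + p'.1.2)) :=
      congrArg (fun a : slicedBody n => a.1.2.2) h
    have hθ := Real.injOn_cos (cellAngle_mem i.2 h1.le h2.le) (cellAngle_mem j.2 h1'.le h2'.le) hx
    have hθ' := hθ
    rw [cellAngle, cellAngle, div_left_inj' hn0.ne', mul_right_inj' hpi.ne'] at hθ'
    have hij : i = j := by
      have e1 : ((i : ℕ) : ℝ) < ((j : ℕ) : ℝ) + 1 := by linarith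
      have e2 : ((j : ℕ) : ℝ) < ((i : ℕ) : ℝ) + 1 := by linarith
      have e3 : (i : ℕ) < (j : ℕ) + 1 := by exact_mod_cast e1
      have e4 : (j : ℕ) < (i : ℕ) + 1 := by exact_mod_cast e2
      exact Fin.ext (by omega)
    subst hij
    refine ⟨rfl, ?_⟩
    have hs : p.1.1 = p'.1.1 := by linarith
    -- In the open square 0 < θ < π. As sin θ ≠ 0, the third coordinate determines sin φ, and with
    -- cos φ it determines φ.
    have hsin : 0 < Real.sin (cellAngle n i p.1.1) := by
      apply Real.sin_pos_of_pos_of_lt_pi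
      · exact div_pos (mul_pos hpi (by
          have : (0 : ℝ) ≤ ((i : ℕ) : ℝ) := Nat.cast_nonneg _
          linarith)) hn0
      · rw [cellAngle, div_lt_iff₀ hn0]
        apply mul_lt_mul_of_pos_left _ hpi
        have : ((i : ℕ) : ℝ) + 1 ≤ n := by exact_mod_cast i.2
        linarith
    rw [Real.cos_add, Real.cos_add, ← hθ, ← hy] at hz
    have hsin2 : Real.sin (Real.pi * (1 + p.1.2)) = Real.sin (Real.pi * (1 + p'.1.2)) :=
      mul_left_cancel₀ hsin.ne' (by linarith)
    have := cos_sin_injOn (by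
      rw [show Real.pi * (1 + p.1.2) - Real.pi * (1 + p'.1.2) = Real.pi * (p.1.2 - p'.1.2) by ring,
        abs_mul, abs_of_pos hpi, mul_comm]
      apply mul_lt_mul_of_pos_right _ hpi
      rw [abs_lt]
      constructor <;> linarith) hy hsin2
    rw [mul_right_inj' hpi.ne'] at this
    exact Subtype.ext (Prod.ext hs (by linarith))
  · intro x hx
    have hx1 : ¬∃ j : ℕ, j ≤ n ∧ x.1.1 = Real.cos (Real.pi * j / n) := fun h => hx (Or.inl h)
    have hmem : x.1 ∈ pillowSurface := by
      refine ⟨x.2.1, x.2.2.1, ?_⟩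
      rcases x.2.2.2.2 with h | ⟨j, -, hj, h⟩
      · exact h
      · exact absurd ⟨j, hj.le, h⟩ hx1
    obtain ⟨θ, φ, hθ, hφ, h⟩ := exists_angles_of_mem_pillowSurface hmem
    have hu0 : 0 ≤ n * θ / Real.pi := div_nonneg (mul_nonneg hn0.le hθ.1) hpi.le
    have hun : n * θ / Real.pi ≤ n := by
      rw [div_le_iff₀ hpi]
      exact mul_le_mul_of_nonneg_left hθ.2 hn0.le
    have hfl1 := Nat.floor_le hu0
    have hfl2 := Nat.lt_floor_add_one (n * θ / Real.pi)
    set j := ⌊n * θ / Real.pi⌋₊ with hj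
    -- The floor could be n only for θ = π, and then the point lies in the slice n, which belongs to
    -- the core.
    have hjn : j < n := by
      by_contra! hjn
      apply hx1
      refine ⟨n, le_rfl, ?_⟩
      have : (n : ℝ) ≤ j := by exact_mod_cast hjn
      have h2 : n * θ / Real.pi = n := le_antisymm hun (by linarith)
      have h3 : θ = Real.pi := by
        rw [div_eq_iff hpi.ne'] at h2
        exact mul_left_cancel₀ hn0.ne' h2
      rw [h, h3, mul_div_assoc, div_self hn0.ne', mul_one]
    have e1 : cellAngle n j (2 * (n * θ / Real.pi - j) - 1) = θ := by
      rw [cellAngle]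
      field_simp
      ring
    have e2 : Real.pi * (1 + (φ / Real.pi - 1)) = φ := by
      field_simp
      ring
    have e3 : φ / Real.pi ≤ 2 := by rw [div_le_iff₀ hpi]; exact hφ.2
    have e4 : 0 ≤ φ / Real.pi := div_nonneg hφ.1 hpi.le
    refine ⟨⟨j, hjn⟩, ⟨(2 * (n * θ / Real.pi - j) - 1, φ / Real.pi - 1), ?_⟩, ?_⟩
    · rw [mem_closedBall_zero_iff, Square.norm_eq, max_le_iff, abs_le, abs_le]
      refine ⟨⟨?_, ?_⟩, ?_, ?_⟩ <;> simp only <;> linarith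
    · apply Subtype.ext
      rw [h]
      change (Real.cos (cellAngle n j (2 * (n * θ / Real.pi - j) - 1)),
        Real.cos (Real.pi * (1 + (φ / Real.pi - 1))),
        Real.cos (cellAngle n j (2 * (n * θ / Real.pi - j) - 1) +
          Real.pi * (1 + (φ / Real.pi - 1)))) = _
      rw [e1, e2]

/-- The sliced body is homotopy equivalent to a wedge of spheres. -/
theorem slicedBody_homotopyEquiv {n : ℕ} (hn : 1 ≤ n) :
    Nonempty (slicedBody n ≃ₕ Wedge (Fin n) Sphere2 basePoint) := by
  have : CompactSpace (slicedBody n) := isCompact_iff_compactSpace.mp (isCompact_slicedBody n)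
  have : Nonempty (Fin n) := ⟨⟨0, hn⟩⟩
  have := contractibleSpace_slicedBodyCore hn
  exact (isSquareAttachment_slicedBody hn).homotopyEquiv

/-! ### A model of the complex character variety in `ℂ³` -/

/-- The affine variety with components the cubic surface `1 - x² - y² - z² + 2xyz = 0` and the
planes `x = cos (π j / n)`. -/
def complexModel (n : ℕ) : Set (ℂ × ℂ × ℂ) :=
  {p | (p.2.2 - p.1 * p.2.1) ^ 2 = (1 - p.1 ^ 2) * (1 - p.2.1 ^ 2) ∨
    ∃ j : ℕ, 0 < j ∧ j < n ∧ p.1 = Real.cos (Real.pi * j / n)}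

/-- A double cover of `complexModel`; a point `((x, w), (y, d))` corresponds to the matrices
with diagonals `(x + w, x - w)` and `(y + d, y - d)`. -/
def coverModel (n : ℕ) : Set ((ℂ × ℂ) × (ℂ × ℂ)) :=
  {q | q.1.1 ^ 2 - q.1.2 ^ 2 = 1 ∧ (q.2.1 ^ 2 - q.2.2 ^ 2 = 1 ∨
    ∃ j : ℕ, 0 < j ∧ j < n ∧ q.1.1 = Real.cos (Real.pi * j / n))}

/-- The half traces of the matrices with the given diagonals. -/
def halfTraces (q : (ℂ × ℂ) × (ℂ × ℂ)) : ℂ × ℂ × ℂ :=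
  (q.1.1, q.2.1, q.1.1 * q.2.1 + q.1.2 * q.2.2)

theorem continuous_halfTraces : Continuous halfTraces := by unfold halfTraces; fun_prop

/-- Here z − xy = wd, and on the two conics w² = x² − 1 and d² = y² − 1. -/
theorem halfTraces_mem {n : ℕ} {q : (ℂ × ℂ) × (ℂ × ℂ)} (hq : q ∈ coverModel n) :
    halfTraces q ∈ complexModel n := by
  obtain ⟨⟨x, w⟩, y, d⟩ := q
  obtain ⟨h1, h2⟩ := hq
  rcases h2 with h2 | h2
  · left
    simp only [halfTraces] at *
    linear_combination (1 - y ^ 2) * h1 - w ^ 2 * h2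
  · exact Or.inr h2

theorem sin_index_pos {n j : ℕ} (h0 : 0 < j) (h1 : j < n) : 0 < Real.sin (Real.pi * j / n) := by
  have hn : (0 : ℝ) < n := by exact_mod_cast h0.trans h1
  have hj : (0 : ℝ) < j := by exact_mod_cast h0
  have hjn : (j : ℝ) < n := by exact_mod_cast h1
  have hpi := Real.pi_pos
  apply Real.sin_pos_of_pos_of_lt_pi (by positivity)
  rw [div_lt_iff₀ hn]
  exact mul_lt_mul_of_pos_left hjn hpi

/-- On a slice, `w = ± i sin (π j / n)`. -/
theorem slice_eq {n j : ℕ} {x w : ℂ} (hx : x = Real.cos (Real.pi * j / n))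
    (h : x ^ 2 - w ^ 2 = 1) : w = Complex.I * Real.sin (Real.pi * j / n) ∨
      w = -(Complex.I * Real.sin (Real.pi * j / n)) := by
  rw [← sq_eq_sq_iff_eq_or_eq_neg, mul_pow, Complex.I_sq]
  have : (Real.sin (Real.pi * j / n) : ℂ) ^ 2 + (Real.cos (Real.pi * j / n) : ℂ) ^ 2 = 1 := by
    exact_mod_cast Real.sin_sq_add_cos_sq _
  rw [hx] at h
  linear_combination -h + this

theorem slice_ne_zero {n j : ℕ} (h0 : 0 < j) (h1 : j < n) {x w : ℂ}
    (hx : x = Real.cos (Real.pi * j / n)) (h : x ^ 2 - w ^ 2 = 1) : w ≠ 0 := by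
  have hs : (Real.sin (Real.pi * j / n) : ℂ) ≠ 0 := by
    exact_mod_cast (sin_index_pos h0 h1).ne'
  rcases slice_eq hx h with h | h
  · rw [h]; exact mul_ne_zero Complex.I_ne_zero hs
  · rw [h]; exact neg_ne_zero.mpr (mul_ne_zero Complex.I_ne_zero hs)

/-- The covering map. -/
def coverMap (n : ℕ) : C(coverModel n, complexModel n) where
  toFun q := ⟨halfTraces q, halfTraces_mem q.2⟩
  continuous_toFun := (continuous_halfTraces.comp continuous_subtype_val).subtype_mk _

/-- Take w with w² = x² − 1. If w ≠ 0, then z = xy + wd determines d. If w = 0, the point is not on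
any of the planes, because w ≠ 0 there; so it is on the cubic surface, z = xy, and d may be any root
of d² = y² − 1. -/
theorem coverMap_surjective (n : ℕ) : Function.Surjective (coverMap n) := by
  rintro ⟨⟨x, y, z⟩, h⟩
  obtain ⟨w, hw⟩ := IsAlgClosed.exists_pow_nat_eq (x ^ 2 - 1) (zero_lt_two)
  by_cases hw0 : w = 0
  · obtain ⟨d, hd⟩ := IsAlgClosed.exists_pow_nat_eq (y ^ 2 - 1) (zero_lt_two)
    refine ⟨⟨((x, w), (y, d)), ?_, ?_⟩, ?_⟩
    · simp only; linear_combination -hw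
    · left; simp only; linear_combination -hd
    · apply Subtype.ext
      change (x, y, x * y + w * d) = (x, y, z)
      have hzxy : z - x * y = 0 := by
        rcases h with h | ⟨j, h0, h1, hj⟩
        · simp only at h
          rw [hw0] at hw
          have : 1 - x ^ 2 = 0 := by linear_combination hw
          rw [this, zero_mul] at h
          exact pow_eq_zero_iff two_ne_zero |>.mp h
        · exact absurd hw0 (slice_ne_zero h0 h1 hj (by simp only; linear_combination -hw))
      simp only [Prod.mk.injEq, true_and, hw0]
      linear_combination -hzxy
  · refine ⟨⟨((x, w), (y, (z - x * y) / w)), ?_, ?_⟩, ?_⟩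
    · simp only; linear_combination -hw
    · rcases h with h | h
      · left
        simp only at h ⊢
        field_simp
        linear_combination (y ^ 2 - 1) * hw - h
      · exact Or.inr h
    · apply Subtype.ext
      change (x, y, x * y + w * ((z - x * y) / w)) = (x, y, z)
      rw [mul_div_cancel₀ _ hw0]
      ring_nf

/-- The fibres of the covering map are the orbits of (w, d) ↦ (−w, −d). The two signs are linked by
the value of wd, except when w = 0, where only the sign of d matters. -/
theorem eq_or_eq_swap_of_halfTraces_eq {n : ℕ} {q q' : (ℂ × ℂ) × (ℂ × ℂ)} (hq : q ∈ coverModel n)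
    (hq' : q' ∈ coverModel n) (h : halfTraces q = halfTraces q') :
    q' = q ∨ q' = ((q.1.1, -q.1.2), (q.2.1, -q.2.2)) := by
  obtain ⟨⟨x, w⟩, y, d⟩ := q
  obtain ⟨⟨x', w'⟩, y', d'⟩ := q'
  simp only [halfTraces, Prod.mk.injEq] at h
  obtain ⟨rfl, rfl, h⟩ := h
  have h1 : x ^ 2 - w ^ 2 = 1 := hq.1
  have h1' : x ^ 2 - w' ^ 2 = 1 := hq'.1
  have hww : w' = w ∨ w' = -w := by
    rw [← sq_eq_sq_iff_eq_or_eq_neg]; linear_combination h1 - h1'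
  by_cases hw0 : w = 0
  · subst hw0
    have hw' : w' = 0 := by simpa using hww
    subst hw'
    have h2 : y ^ 2 - d ^ 2 = 1 := by
      rcases hq.2 with h2 | ⟨j, h0, hj, hx⟩
      · exact h2
      · exact absurd rfl (slice_ne_zero h0 hj hx h1)
    have h2' : y ^ 2 - d' ^ 2 = 1 := by
      rcases hq'.2 with h2 | ⟨j, h0, hj, hx⟩
      · exact h2
      · exact absurd rfl (slice_ne_zero h0 hj hx h1')
    have hdd : d' = d ∨ d' = -d := by
      rw [← sq_eq_sq_iff_eq_or_eq_neg]; linear_combination h2 - h2'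
    rcases hdd with rfl | rfl <;> simp
  · rcases hww with rfl | rfl
    · left
      have : d' = d := mul_left_cancel₀ hw0 (by linear_combination -h)
      rw [this]
    · right
      have : d' = -d := mul_left_cancel₀ hw0 (by linear_combination h)
      rw [this]

theorem isClosed_coverModel (n : ℕ) : IsClosed (coverModel n) := by
  simp only [coverModel, Set.ofPred_and, Set.ofPred_or]
  refine IsClosed.inter (isClosed_eq (by fun_prop) (by fun_prop)) (IsClosed.union
    (isClosed_eq (by fun_prop) (by fun_prop)) ?_)
  have : {q : (ℂ × ℂ) × (ℂ × ℂ) | ∃ j : ℕ, 0 < j ∧ j < n ∧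
      q.1.1 = Real.cos (Real.pi * j / n)} = (fun q => q.1.1) ⁻¹'
      ((fun j : ℕ => (Real.cos (Real.pi * j / n) : ℂ)) '' {j | 0 < j ∧ j < n}) := by
    ext p
    simp only [Set.mem_ofPred_eq, Set.mem_preimage, Set.mem_image]
    constructor
    · rintro ⟨j, h1, h2, h3⟩; exact ⟨j, ⟨h1, h2⟩, h3.symm⟩
    · rintro ⟨j, ⟨h1, h2⟩, h3⟩; exact ⟨j, h1, h2, h3.symm⟩
  rw [this]
  refine IsClosed.preimage (by fun_prop) (Set.Finite.isClosed (Set.Finite.image _ ?_))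
  exact (Set.finite_lt_nat n).subset fun j hj => hj.2

theorem norm_le_of_sq_sub_sq {x w : ℂ} {C : ℝ} (hC : 0 ≤ C) (h : x ^ 2 - w ^ 2 = 1)
    (hx : ‖x‖ ≤ C) : ‖w‖ ≤ C + 1 := by
  have h1 : ‖w‖ ^ 2 ≤ C ^ 2 + 1 := by
    rw [← norm_pow, show w ^ 2 = x ^ 2 - 1 by linear_combination -h]
    refine (norm_sub_le _ _).trans ?_
    rw [norm_pow, norm_one]
    gcongr
  nlinarith [norm_nonneg w]

/-- A bound on x and y bounds w, and it bounds d on the conic. Over the planes d = (z − xy)/w, where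
|w| is one of the finitely many nonzero numbers |sin(πj/n)|. -/
theorem isProperMap_halfTraces (n : ℕ) :
    IsProperMap fun q : coverModel n => halfTraces q := by
  rw [isProperMap_iff_isCompact_preimage]
  refine ⟨continuous_halfTraces.comp continuous_subtype_val, fun K hK => ?_⟩
  rw [Subtype.isCompact_iff]
  have himg : Subtype.val '' ((fun q : coverModel n => halfTraces q) ⁻¹' K) =
      coverModel n ∩ halfTraces ⁻¹' K := by
    ext q
    simp only [Set.mem_image, Set.mem_preimage, Set.mem_inter_iff]
    constructor
    · rintro ⟨q, h, rfl⟩; exact ⟨q.2, h⟩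
    · rintro ⟨h1, h2⟩; exact ⟨⟨q, h1⟩, h2, rfl⟩
  rw [himg]
  refine Metric.isCompact_of_isClosed_isBounded
    ((isClosed_coverModel n).inter (hK.isClosed.preimage continuous_halfTraces)) ?_
  obtain ⟨C, hC⟩ := hK.isBounded.exists_norm_le
  have hC0 : 0 ≤ max C 0 := le_max_right _ _
  set C' := max C 0 with hC'
  -- A common bound for the relevant values of 1/|w|. The extra term j = 0 is 0⁻¹ = 0.
  set σ := ∑ j ∈ Finset.range n, |Real.sin (Real.pi * j / n)|⁻¹ with hσ
  have hσ0 : 0 ≤ σ := Finset.sum_nonneg fun j _ => by positivity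
  refine isBounded_iff_forall_norm_le.mpr ⟨C' + 1 + (C' + C' * C') * σ, ?_⟩
  rintro ⟨⟨x, w⟩, y, d⟩ ⟨hq, hqK⟩
  have hb := (hC _ hqK).trans (le_max_left C 0)
  rw [← hC'] at hb
  simp only [halfTraces, Prod.norm_mk, max_le_iff] at hb
  obtain ⟨hx, hy, hz⟩ := hb
  have hw := norm_le_of_sq_sub_sq hC0 hq.1 hx
  have hσ1 : 0 ≤ (C' + C' * C') * σ := by positivity
  have hd : ‖d‖ ≤ C' + 1 + (C' + C' * C') * σ := by
    rcases hq.2 with h | ⟨j, h0, h1, hj⟩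
    · have := norm_le_of_sq_sub_sq hC0 h hy
      linarith
    · have hw1 : ‖w‖ = |Real.sin (Real.pi * j / n)| := by
        rcases slice_eq hj hq.1 with h | h
        · have h : w = _ := h
          rw [h, norm_mul, Complex.norm_I, one_mul, Complex.norm_real, Real.norm_eq_abs]
        · have h : w = _ := h
          rw [h, norm_neg, norm_mul, Complex.norm_I, one_mul, Complex.norm_real, Real.norm_eq_abs]
      have hw2 : 0 < ‖w‖ := norm_pos_iff.mpr (slice_ne_zero h0 h1 hj hq.1)
      have hw3 : ‖w‖⁻¹ ≤ σ := by
        rw [hw1]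
        exact Finset.single_le_sum (f := fun j : ℕ => |Real.sin (Real.pi * j / n)|⁻¹)
          (fun j _ => by positivity) (Finset.mem_range.mpr h1)
      have hd1 : ‖w‖ * ‖d‖ ≤ C' + C' * C' := by
        rw [← norm_mul, show w * d = (x * y + w * d) - x * y by ring]
        refine (norm_sub_le _ _).trans (add_le_add hz ?_)
        rw [norm_mul]
        exact mul_le_mul hx hy (norm_nonneg _) hC0
      have hd2 : ‖d‖ ≤ (C' + C' * C') * σ := by
        calc ‖d‖ = (‖w‖ * ‖d‖) * ‖w‖⁻¹ := by field_simp
          _ ≤ (C' + C' * C') * σ := by gcongr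
      linarith
  simp only [Prod.norm_mk, max_le_iff]
  refine ⟨⟨?_, ?_⟩, ?_, hd⟩ <;> linarith

theorem isQuotientMap_coverMap (n : ℕ) : IsQuotientMap (coverMap n) := by
  refine IsClosedMap.isQuotientMap ?_ (coverMap n).continuous (coverMap_surjective n)
  intro s hs
  have h := (isProperMap_halfTraces n).isClosedMap s hs
  convert h.preimage (continuous_subtype_val (p := (· ∈ complexModel n))) using 1
  ext v
  simp only [Set.mem_image, Set.mem_preimage]
  constructor
  · rintro ⟨q, hq, rfl⟩; exact ⟨q, hq, rfl⟩
  · rintro ⟨q, hq, h⟩; exact ⟨q, hq, Subtype.ext h⟩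

/-! ### The retraction to the real points -/

/-- The radius to which the deformation shrinks `(Re y, Im d)`. -/
def shrinkRadius (t : ℝ) (q : ℂ × ℂ) : ℝ :=
  -- On the conic, (Re y)² + (Im d)² = 1 + (Im y)² + (Re d)². Scaling Im y and Re d by 1 − t
  -- therefore forces this radius. The second entry of the maximum equals the first on the conic;
  -- off it, it makes the radius at t = 0 at least the actual one, so that nothing moves at t = 0.
  √(1 + (1 - t) ^ 2 * max (q.1.im ^ 2 + q.2.re ^ 2) (q.1.re ^ 2 + q.2.im ^ 2 - 1))

/-- The factor by which the deformation shrinks `(Re y, Im d)`. -/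
def shrinkFactor (t : ℝ) (q : ℂ × ℂ) : ℝ :=
  shrinkRadius t q / max (shrinkRadius t q) √(q.1.re ^ 2 + q.2.im ^ 2)

/-- A deformation of `ℂ²` to the disc `{(y, d) | Im y = Re d = 0, y² - d² ≤ 1}` that preserves the
conic `y² - d² = 1`. -/
def shrink (t : ℝ) (q : ℂ × ℂ) : ℂ × ℂ :=
  (⟨shrinkFactor t q * q.1.re, (1 - t) * q.1.im⟩, ⟨(1 - t) * q.2.re, shrinkFactor t q * q.2.im⟩)

theorem one_le_shrinkRadius (t : ℝ) (q : ℂ × ℂ) : 1 ≤ shrinkRadius t q := by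
  rw [shrinkRadius, Real.one_le_sqrt]
  have : 0 ≤ max (q.1.im ^ 2 + q.2.re ^ 2) (q.1.re ^ 2 + q.2.im ^ 2 - 1) :=
    le_max_of_le_left (by positivity)
  have : 0 ≤ (1 - t) ^ 2 * max (q.1.im ^ 2 + q.2.re ^ 2) (q.1.re ^ 2 + q.2.im ^ 2 - 1) := by
    positivity
  linarith

theorem shrinkDenom_pos (t : ℝ) (q : ℂ × ℂ) :
    0 < max (shrinkRadius t q) √(q.1.re ^ 2 + q.2.im ^ 2) :=
  lt_max_of_lt_left (one_pos.trans_le (one_le_shrinkRadius t q))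

theorem continuous_shrink : Continuous fun a : ℝ × (ℂ × ℂ) => shrink a.1 a.2 := by
  have h1 : Continuous fun a : ℝ × (ℂ × ℂ) => shrinkRadius a.1 a.2 := by
    unfold shrinkRadius
    fun_prop
  have h2 : Continuous fun a : ℝ × (ℂ × ℂ) => shrinkFactor a.1 a.2 :=
    h1.div (h1.max (by fun_prop)) fun a => (shrinkDenom_pos a.1 a.2).ne'
  have hmk : ∀ (f g : ℝ × (ℂ × ℂ) → ℝ), Continuous f → Continuous g →
      Continuous fun a => (⟨f a, g a⟩ : ℂ) := fun f g hf hg =>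
    Complex.equivRealProdCLM.symm.continuous.comp (hf.prodMk hg)
  exact (hmk _ _ (by fun_prop) (by fun_prop)).prodMk (hmk _ _ (by fun_prop) (by fun_prop))

theorem shrinkFactor_eq_one {t : ℝ} {q : ℂ × ℂ}
    (h : √(q.1.re ^ 2 + q.2.im ^ 2) ≤ shrinkRadius t q) : shrinkFactor t q = 1 := by
  rw [shrinkFactor, max_eq_left h, div_self]
  linarith [one_le_shrinkRadius t q]

theorem shrink_zero (q : ℂ × ℂ) : shrink 0 q = q := by
  have h : shrinkFactor 0 q = 1 := by
    apply shrinkFactor_eq_one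
    apply Real.sqrt_le_sqrt
    have := le_max_right (q.1.im ^ 2 + q.2.re ^ 2) (q.1.re ^ 2 + q.2.im ^ 2 - 1)
    linarith
  simp [shrink, h]

theorem shrink_fixed (t : ℝ) {q : ℂ × ℂ} (h1 : q.1.im = 0) (h2 : q.2.re = 0)
    (h3 : q.1.re ^ 2 + q.2.im ^ 2 ≤ 1) : shrink t q = q := by
  have h : shrinkFactor t q = 1 := by
    apply shrinkFactor_eq_one
    refine le_trans ?_ (one_le_shrinkRadius t q)
    exact Real.sqrt_le_one.mpr h3
  obtain ⟨y, d⟩ := q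
  simp only at h1 h2
  simp only [shrink, h, h1, h2, one_mul, mul_zero, Prod.mk.injEq]
  exact ⟨Complex.ext rfl h1.symm, Complex.ext h2.symm rfl⟩

/-- This symmetry lets the deformation descend to the quotient by (w, d) ↦ (−w, −d). -/
theorem shrink_neg (t : ℝ) (q : ℂ × ℂ) :
    shrink t (q.1, -q.2) = ((shrink t q).1, -(shrink t q).2) := by
  have h : shrinkFactor t (q.1, -q.2) = shrinkFactor t q := by
    simp [shrinkFactor, shrinkRadius]
  simp only [shrink, h, Prod.mk.injEq, true_and]
  apply Complex.ext <;> simp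

theorem conic_iff {y d : ℂ} : y ^ 2 - d ^ 2 = 1 ↔
    y.re ^ 2 - y.im ^ 2 - d.re ^ 2 + d.im ^ 2 = 1 ∧ y.re * y.im = d.re * d.im := by
  rw [Complex.ext_iff]
  simp only [sq, Complex.sub_re, Complex.mul_re, Complex.sub_im, Complex.mul_im, Complex.one_re,
    Complex.one_im]
  constructor
  · rintro ⟨h1, h2⟩; constructor <;> linarith
  · rintro ⟨h1, h2⟩; constructor <;> linarith

/-- The real part of the equation holds by the choice of the radius. The imaginary part, Re y · Im y
= Re d · Im d, has both sides multiplied by the same factor. -/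
theorem shrink_conic {t : ℝ} (h0 : 0 ≤ t) (h1 : t ≤ 1) {q : ℂ × ℂ} (h : q.1 ^ 2 - q.2 ^ 2 = 1) :
    (shrink t q).1 ^ 2 - (shrink t q).2 ^ 2 = 1 := by
  obtain ⟨y, d⟩ := q
  simp only at h
  rw [conic_iff] at h ⊢
  obtain ⟨hr, hi⟩ := h
  have hN : max (y.im ^ 2 + d.re ^ 2) (y.re ^ 2 + d.im ^ 2 - 1) = y.im ^ 2 + d.re ^ 2 :=
    max_eq_left (by linarith)
  have hR : shrinkRadius t (y, d) ^ 2 = 1 + (1 - t) ^ 2 * (y.im ^ 2 + d.re ^ 2) := by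
    rw [shrinkRadius, hN, Real.sq_sqrt (by positivity)]
  have hle : shrinkRadius t (y, d) ≤ √(y.re ^ 2 + d.im ^ 2) := by
    apply Real.le_sqrt_of_sq_le
    rw [hR]
    have : (1 - t) ^ 2 ≤ 1 := by nlinarith
    nlinarith [sq_nonneg y.im, sq_nonneg d.re]
  have hu : 0 < y.re ^ 2 + d.im ^ 2 := by nlinarith [sq_nonneg y.im, sq_nonneg d.re]
  have hc : shrinkFactor t (y, d) ^ 2 * (y.re ^ 2 + d.im ^ 2) =
      1 + (1 - t) ^ 2 * (y.im ^ 2 + d.re ^ 2) := by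
    rw [shrinkFactor, max_eq_right hle, div_pow, Real.sq_sqrt hu.le, hR]
    field_simp
  simp only [shrink]
  constructor
  · linear_combination hc
  · linear_combination shrinkFactor t (y, d) * (1 - t) * hi

theorem shrink_one_le (q : ℂ × ℂ) : (shrink 1 q).1.re ^ 2 + (shrink 1 q).2.im ^ 2 ≤ 1 := by
  have hR : shrinkRadius 1 q = 1 := by simp [shrinkRadius]
  have h0 : 0 ≤ q.1.re ^ 2 + q.2.im ^ 2 := by positivity
  have hpos : 0 < max 1 √(q.1.re ^ 2 + q.2.im ^ 2) := lt_max_of_lt_left one_pos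
  simp only [shrink, shrinkFactor, hR]
  have h1 : q.1.re ^ 2 + q.2.im ^ 2 ≤ max 1 √(q.1.re ^ 2 + q.2.im ^ 2) ^ 2 := by
    calc q.1.re ^ 2 + q.2.im ^ 2 = √(q.1.re ^ 2 + q.2.im ^ 2) ^ 2 := (Real.sq_sqrt h0).symm
      _ ≤ _ := by gcongr; exact le_max_right _ _
  rw [mul_pow, mul_pow, ← mul_add, div_pow, one_pow, one_div, inv_mul_le_one₀ (by positivity)]
  exact h1

/-- Over a plane x = cos(πj/n) one has w = ±i sin(πj/n), a point of the real circle, which does not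
move. Hence the deformation preserves each plane. -/
theorem shrink_slice {n j : ℕ} (t : ℝ) {q : ℂ × ℂ} (hx : q.1 = Real.cos (Real.pi * j / n))
    (h : q.1 ^ 2 - q.2 ^ 2 = 1) : shrink t q = q := by
  have hsc := Real.sin_sq_add_cos_sq (Real.pi * j / n)
  refine shrink_fixed t ?_ ?_ ?_
  · rw [hx, Complex.ofReal_im]
  · rcases slice_eq hx h with h | h <;> rw [h] <;> simp [-Complex.ofReal_sin]
  · rcases slice_eq hx h with h | h <;> rw [h, hx] <;>
      simp [-Complex.ofReal_sin, -Complex.ofReal_cos]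

theorem shrink_mem_coverModel {n : ℕ} {t : ℝ} (h0 : 0 ≤ t) (h1 : t ≤ 1)
    {q : (ℂ × ℂ) × (ℂ × ℂ)} (hq : q ∈ coverModel n) :
    (shrink t q.1, shrink t q.2) ∈ coverModel n := by
  refine ⟨shrink_conic h0 h1 hq.1, ?_⟩
  rcases hq.2 with h | ⟨j, hj0, hj1, hj⟩
  · exact Or.inl (shrink_conic h0 h1 h)
  · refine Or.inr ⟨j, hj0, hj1, ?_⟩
    simp only
    rw [shrink_slice t hj hq.1, hj]

/-- The inclusion of the real model into the complex one. -/
theorem ofReal_mem_complexModel {n : ℕ} {p : ℝ × ℝ × ℝ} (hp : p ∈ slicedBody n) :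
    ((p.1 : ℂ), (p.2.1 : ℂ), (p.2.2 : ℂ)) ∈ complexModel n := by
  rcases hp.2.2.2 with h | ⟨j, h0, h1, hj⟩
  · left
    simp only
    exact_mod_cast h
  · right
    refine ⟨j, h0, h1, ?_⟩
    simp only
    rw [hj]

/-- The deformation of the cover is constant on the fibres of the quotient map. Regarding it as a
map into a path space, it descends by the universal property. -/
theorem exists_deformation (n : ℕ) : ∃ H : C(complexModel n, C(unitInterval, complexModel n)),
    ∀ (q : coverModel n) (t : unitInterval),
      ((H (coverMap n q) t : complexModel n) : ℂ × ℂ × ℂ) =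
        halfTraces (shrink t q.1.1, shrink t q.1.2) := by
  let F : C(coverModel n × unitInterval, complexModel n) :=
    ⟨fun a => coverMap n ⟨_, shrink_mem_coverModel a.2.2.1 a.2.2.2 a.1.2⟩, by
      refine (coverMap n).continuous.comp (Continuous.subtype_mk ?_ _)
      refine Continuous.prodMk ?_ ?_
      · exact continuous_shrink.comp (Continuous.prodMk (by fun_prop) (by fun_prop))
      · exact continuous_shrink.comp (Continuous.prodMk (by fun_prop) (by fun_prop))⟩
  have hfac : Function.FactorsThrough F.curry (coverMap n) := by
    intro q q' h
    ext1 t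
    apply Subtype.ext
    change halfTraces (shrink t q.1.1, shrink t q.1.2) =
      halfTraces (shrink t q'.1.1, shrink t q'.1.2)
    rcases eq_or_eq_swap_of_halfTraces_eq q.2 q'.2 (congrArg Subtype.val h) with h | h
    · rw [h]
    · rw [h]
      simp only [shrink_neg, halfTraces]
      ring_nf
  have hl : ∀ q, (isQuotientMap_coverMap n).lift F.curry hfac (coverMap n q) = F.curry q :=
    DFunLike.congr_fun ((isQuotientMap_coverMap n).lift_comp F.curry hfac)
  refine ⟨(isQuotientMap_coverMap n).lift F.curry hfac, fun q t => ?_⟩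
  rw [hl]
  rfl

theorem shrink_one_eq (q : ℂ × ℂ) : shrink 1 q =
    (((shrink 1 q).1.re : ℂ), Complex.I * ((shrink 1 q).2.im : ℂ)) := by
  ext
  · apply Complex.ext <;> simp [shrink]
  · apply Complex.ext <;> simp [shrink]

theorem halfTraces_real (x w y d : ℝ) :
    halfTraces (((x : ℂ), Complex.I * (w : ℂ)), ((y : ℂ), Complex.I * (d : ℂ))) =
      ((x : ℂ), (y : ℂ), ((x * y - w * d : ℝ) : ℂ)) := by
  simp only [halfTraces, Prod.mk.injEq, true_and]
  push_cast
  linear_combination (w * d : ℂ) * Complex.I_sq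

theorem real_conic_iff (x w : ℝ) :
    (x : ℂ) ^ 2 - (Complex.I * (w : ℂ)) ^ 2 = 1 ↔ x ^ 2 + w ^ 2 = 1 := by
  rw [mul_pow, Complex.I_sq]
  constructor
  · intro h
    have : ((x ^ 2 + w ^ 2 : ℝ) : ℂ) = (1 : ℝ) := by push_cast; linear_combination h
    exact_mod_cast this
  · intro h
    have : ((x ^ 2 + w ^ 2 : ℝ) : ℂ) = (1 : ℝ) := by rw [h]
    push_cast at this
    linear_combination this

theorem real_mem_slicedBody {n : ℕ} {x w y d : ℝ}
    (h : (((x : ℂ), Complex.I * (w : ℂ)), ((y : ℂ), Complex.I * (d : ℂ))) ∈ coverModel n)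
    (hyd : y ^ 2 + d ^ 2 ≤ 1) : (x, y, x * y - w * d) ∈ slicedBody n := by
  have h1 : x ^ 2 + w ^ 2 = 1 := (real_conic_iff x w).mp h.1
  have hw : 1 - x ^ 2 = w ^ 2 := by linarith
  refine ⟨?_, ?_, ?_, ?_⟩
  · rw [← sq_le_one_iff_abs_le_one]; nlinarith
  · rw [← sq_le_one_iff_abs_le_one]; nlinarith
  · simp only
    rw [hw, show (x * y - w * d - x * y) ^ 2 = w ^ 2 * d ^ 2 by ring]
    exact mul_le_mul_of_nonneg_left (by linarith) (sq_nonneg _)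
  · rcases h.2 with h2 | ⟨j, h0, hj, hx⟩
    · left
      have h2' := (real_conic_iff y d).mp h2
      simp only
      rw [hw]
      linear_combination w ^ 2 * h2'
    · simp only at hx
      exact Or.inr ⟨j, h0, hj, by exact_mod_cast hx⟩

/-- The real counterpart of surjectivity of the cover, with w and d replaced by iw and id: take w =
√(1 − x²) and d = (xy − z)/w. The inequality defining the body becomes y² + d² ≤ 1, so the lift lies
where the deformation is stationary. -/
theorem exists_real_lift {n : ℕ} {p : ℝ × ℝ × ℝ} (hp : p ∈ slicedBody n) :
    ∃ w d : ℝ, (((p.1 : ℂ), Complex.I * (w : ℂ)), ((p.2.1 : ℂ), Complex.I * (d : ℂ))) ∈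
      coverModel n ∧ p.2.1 ^ 2 + d ^ 2 ≤ 1 ∧ p.2.2 = p.1 * p.2.1 - w * d := by
  obtain ⟨x, y, z⟩ := p
  obtain ⟨hx, hy, h, h'⟩ := hp
  simp only at *
  rw [← sq_le_one_iff_abs_le_one] at hx hy
  have hw2 : √(1 - x ^ 2) ^ 2 = 1 - x ^ 2 := Real.sq_sqrt (by linarith)
  have hd2 : √(1 - y ^ 2) ^ 2 = 1 - y ^ 2 := Real.sq_sqrt (by linarith)
  by_cases hw : √(1 - x ^ 2) = 0
  · refine ⟨√(1 - x ^ 2), √(1 - y ^ 2), ⟨(real_conic_iff _ _).mpr (by linarith),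
      Or.inl ((real_conic_iff _ _).mpr (by linarith))⟩, by linarith, ?_⟩
    rw [hw] at hw2 ⊢
    rw [← hw2] at h
    have : z - x * y = 0 := by
      apply pow_eq_zero_iff two_ne_zero |>.mp
      nlinarith [sq_nonneg (z - x * y)]
    linarith
  · have hwp : 0 < √(1 - x ^ 2) ^ 2 := by positivity
    have hd : ((x * y - z) / √(1 - x ^ 2)) ^ 2 = (z - x * y) ^ 2 / √(1 - x ^ 2) ^ 2 := by
      rw [div_pow]; congr 1; ring
    refine ⟨√(1 - x ^ 2), (x * y - z) / √(1 - x ^ 2),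
      ⟨(real_conic_iff _ _).mpr (by linarith), ?_⟩, ?_, ?_⟩
    · rcases h' with h' | ⟨j, h0, hj, hxj⟩
      · left
        refine (real_conic_iff _ _).mpr ?_
        rw [hd, h', hw2, mul_div_cancel_left₀ _ (hw2 ▸ hwp.ne')]
        ring
      · exact Or.inr ⟨j, h0, hj, by simp only; rw [hxj]⟩
    · rw [hd]
      have : (z - x * y) ^ 2 / √(1 - x ^ 2) ^ 2 ≤ 1 - y ^ 2 := by
        rw [div_le_iff₀ hwp, hw2]
        linarith
      linarith
    · rw [mul_div_cancel₀ _ hw]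
      ring

/-- The complex model is homotopy equivalent to the real one. -/
theorem complexModel_homotopyEquiv (n : ℕ) : Nonempty (complexModel n ≃ₕ slicedBody n) := by
  obtain ⟨H, hH⟩ := exists_deformation n
  have hH1 : ∀ q : coverModel n, ((H (coverMap n q) 1 : complexModel n) : ℂ × ℂ × ℂ) =
      halfTraces (shrink 1 q.1.1, shrink 1 q.1.2) := fun q => hH q 1
  have key : ∀ v, ∃ p ∈ slicedBody n, (H v 1).1 = ((p.1 : ℂ), (p.2.1 : ℂ), (p.2.2 : ℂ)) := by
    intro v
    obtain ⟨q, rfl⟩ := coverMap_surjective n v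
    have hm := shrink_mem_coverModel zero_le_one le_rfl q.2
    rw [shrink_one_eq q.1.1, shrink_one_eq q.1.2] at hm
    refine ⟨_, real_mem_slicedBody hm (shrink_one_le q.1.2), ?_⟩
    rw [hH1, shrink_one_eq q.1.1, shrink_one_eq q.1.2, halfTraces_real]
    simp
  let re3 : ℂ × ℂ × ℂ → ℝ × ℝ × ℝ := fun v => (v.1.re, v.2.1.re, v.2.2.re)
  have hre : ∀ v, re3 (H v 1).1 ∈ slicedBody n := by
    intro v
    obtain ⟨p, hp, h⟩ := key v
    rw [h]
    simpa [re3] using hp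
  have hre' : ∀ v, (((re3 (H v 1).1).1 : ℂ), ((re3 (H v 1).1).2.1 : ℂ), ((re3 (H v 1).1).2.2 : ℂ)) =
      (H v 1).1 := by
    intro v
    obtain ⟨p, hp, h⟩ := key v
    rw [h]
    simp [re3]
  let r : C(complexModel n, slicedBody n) := ⟨fun v => ⟨re3 (H v 1).1, hre v⟩, by
    refine Continuous.subtype_mk ?_ _
    have h3 : Continuous re3 := by fun_prop
    have h1 : Continuous fun v => H v 1 := by fun_prop
    exact h3.comp (continuous_subtype_val.comp h1)⟩
  let i : C(slicedBody n, complexModel n) := ⟨fun p => ⟨_, ofReal_mem_complexModel p.2⟩, by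
    refine Continuous.subtype_mk ?_ _
    fun_prop⟩
  -- Both factors of a real lift lie in the disc fixed by `shrink`, so the retraction is the
  -- identity on real points.
  have hri : r.comp i = ContinuousMap.id _ := by
    ext1 p
    obtain ⟨w, d, hmem, hle, hz⟩ := exists_real_lift p.2
    have hi : i p = coverMap n ⟨_, hmem⟩ := by
      apply Subtype.ext
      change _ = halfTraces _
      rw [halfTraces_real, ← hz]
      rfl
    apply Subtype.ext
    change re3 (H (i p) 1).1 = p.1
    rw [hi, hH1]
    simp only
    have hw : (p.1.1) ^ 2 + w ^ 2 = 1 := (real_conic_iff _ _).mp hmem.1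
    rw [shrink_fixed 1 (by simp) (by simp) (by simpa using hw.le),
      shrink_fixed 1 (by simp) (by simp) (by simpa using hle), halfTraces_real, ← hz]
    simp [re3]
  have hir : (ContinuousMap.id _).Homotopic (i.comp r) := by
    refine ⟨⟨⟨fun a => H a.2 a.1, by fun_prop⟩, fun v => ?_, fun v => ?_⟩⟩
    · obtain ⟨q, rfl⟩ := coverMap_surjective n v
      apply Subtype.ext
      change (H (coverMap n q) 0).1 = halfTraces q.1
      rw [hH]
      change halfTraces (shrink 0 q.1.1, shrink 0 q.1.2) = _
      rw [shrink_zero, shrink_zero]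
    · apply Subtype.ext
      exact (hre' v).symm
  exact ⟨⟨r, i, hir.symm, by rw [hri]⟩⟩

/-! ### Representations of the link group -/

theorem linkGroup_induction {n : ℕ} {P : LinkGroup n → Prop} (hA : P (genA n)) (hB : P (genB n))
    (h1 : P 1) (hmul : ∀ x y, P x → P y → P (x * y)) (hinv : ∀ x, P x → P x⁻¹) (γ : LinkGroup n) :
    P γ := by
  have hγ : γ ∈ Subgroup.closure (Set.range
      (PresentedGroup.of : Fin 2 → LinkGroup n)) := by
    rw [PresentedGroup.closure_range_of]; trivial
  induction hγ using Subgroup.closure_induction with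
  | mem x hx =>
    obtain ⟨i, rfl⟩ := hx
    fin_cases i
    · exact hA
    · exact hB
  | one => exact h1
  | mul x y _ _ hx hy => exact hmul x y hx hy
  | inv x _ hx => exact hinv x hx

theorem linkGroup_hom_ext {n : ℕ} {G : Type*} [Group G] {ρ σ : LinkGroup n →* G}
    (hA : ρ (genA n) = σ (genA n)) (hB : ρ (genB n) = σ (genB n)) : ρ = σ :=
  PresentedGroup.ext fun i => by
    fin_cases i
    · exact hA
    · exact hB

theorem genA_pow_comm (n : ℕ) : genA n ^ n * genB n = genB n * genA n ^ n := by
  have h : PresentedGroup.mk ({relator n} : Set (FreeGroup (Fin 2))) (relator n) = 1 :=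
    PresentedGroup.one_of_mem (Set.mem_singleton _)
  rw [relator, map_mul, map_mul, map_mul, map_inv, map_inv, map_pow, mul_inv_eq_one,
    mul_inv_eq_iff_eq_mul] at h
  exact h

theorem rep_pow_comm {n : ℕ} {G : Type*} [Group G] (ρ : LinkGroup n →* G) :
    ρ (genA n) ^ n * ρ (genB n) = ρ (genB n) * ρ (genA n) ^ n := by
  rw [← map_pow, ← map_mul, genA_pow_comm, map_mul]

/-- A point of the representation space, as a homomorphism. -/
def RepSpace.hom {Γ G : Type*} [Group Γ] [Group G] (ρ : RepSpace Γ G) : Γ →* G := ρ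

/-- A homomorphism, as a point of the representation space. -/
def RepSpace.of {Γ G : Type*} [Group Γ] [Group G] (ρ : Γ →* G) : RepSpace Γ G := ρ

theorem continuous_repSpace_apply {n : ℕ} {G : Type*} [Group G] [TopologicalSpace G]
    (γ : LinkGroup n) :
    Continuous fun ρ : RepSpace (LinkGroup n) G => ρ.hom γ :=
  (continuous_apply γ).comp continuous_induced_dom

theorem continuous_to_repSpace {n : ℕ} {G Y : Type*} [Group G] [TopologicalSpace G]
    [IsTopologicalGroup G] [TopologicalSpace Y] {f : Y → RepSpace (LinkGroup n) G}
    (hA : Continuous fun y => (f y).hom (genA n)) (hB : Continuous fun y => (f y).hom (genB n)) :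
    Continuous f := by
  refine continuous_induced_rng.mpr (continuous_pi fun γ => ?_)
  change Continuous fun y => (f y).hom γ
  induction γ using linkGroup_induction with
  | hA => exact hA
  | hB => exact hB
  | h1 => simp only [map_one]; exact continuous_const
  | hmul x y hx hy => simp only [map_mul]; exact hx.mul hy
  | hinv x hx => simp only [map_inv]; exact hx.inv

/-! ### Elements of `SU(2)` -/

instance : IsTopologicalGroup SU2 where
  continuous_inv := by
    change Continuous fun A : SU2 => star A
    refine Continuous.subtype_mk (f := fun A : SU2 => star A.1) ?_ _
    exact continuous_subtype_val.star

/-- The element of `SU(2)` with first column `(a, b)`. -/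
def suMat (a b : ℂ) (h : ‖a‖ ^ 2 + ‖b‖ ^ 2 = 1) : SU2 :=
  ⟨!![a, -(starRingEnd ℂ) b; b, (starRingEnd ℂ) a], by
    have h' : a * (starRingEnd ℂ) a + b * (starRingEnd ℂ) b = 1 := by
      rw [Complex.mul_conj, Complex.mul_conj, Complex.normSq_eq_norm_sq, Complex.normSq_eq_norm_sq]
      exact_mod_cast h
    rw [Matrix.mem_specialUnitaryGroup_iff, Matrix.mem_unitaryGroup_iff]
    refine ⟨?_, ?_⟩
    · ext i j
      fin_cases i <;> fin_cases j <;>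
        simp [Matrix.mul_apply, Fin.sum_univ_two, Matrix.star_apply]
      · linear_combination h'
      · ring
      · ring
      · linear_combination h'
    · rw [Matrix.det_fin_two_of]
      linear_combination h'⟩

/-- The conjugate transpose and the adjugate are both inverse to A. -/
theorem su2_entries (A : SU2) : A.1 1 1 = (starRingEnd ℂ) (A.1 0 0) ∧
    A.1 0 1 = -(starRingEnd ℂ) (A.1 1 0) := by
  have h := Matrix.mem_specialUnitaryGroup_iff.mp A.2
  have h1 : star A.1 = Matrix.adjugate A.1 := by
    have e := Matrix.mem_unitaryGroup_iff'.mp h.1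
    calc star A.1 = star A.1 * (A.1 * Matrix.adjugate A.1) := by
          rw [Matrix.mul_adjugate, h.2, one_smul, mul_one]
      _ = _ := by rw [← mul_assoc, e, one_mul]
  rw [Matrix.adjugate_fin_two] at h1
  have e00 := congrFun (congrFun h1 0) 0
  have e01 := congrFun (congrFun h1 0) 1
  simp [Matrix.star_apply] at e00 e01
  refine ⟨e00.symm, ?_⟩
  rw [e01, neg_neg]

theorem su2_norm (A : SU2) : ‖A.1 0 0‖ ^ 2 + ‖A.1 1 0‖ ^ 2 = 1 := by
  have h := (Matrix.mem_specialUnitaryGroup_iff.mp A.2).2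
  rw [Matrix.det_fin_two, (su2_entries A).1, (su2_entries A).2] at h
  have h2 : ((‖A.1 0 0‖ ^ 2 + ‖A.1 1 0‖ ^ 2 : ℝ) : ℂ) = 1 := by
    push_cast
    rw [← Complex.mul_conj', ← Complex.mul_conj']
    linear_combination h
  exact_mod_cast h2

theorem su2_eq_suMat (A : SU2) : A = suMat (A.1 0 0) (A.1 1 0) (su2_norm A) := by
  apply Subtype.ext
  ext i j
  fin_cases i <;> fin_cases j
  · rfl
  · exact (su2_entries A).2
  · rfl
  · exact (su2_entries A).1

theorem su2_ext {A B : SU2} (h0 : A.1 0 0 = B.1 0 0) (h1 : A.1 1 0 = B.1 1 0) : A = B := by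
  rw [su2_eq_suMat A, su2_eq_suMat B]
  simp only [h0, h1]

theorem diagSU_coe (z : Circle) :
    (diagSU z).1 = !![(z : ℂ), 0; 0, ((z⁻¹ : Circle) : ℂ)] := rfl

theorem su2_mul_entries (A B : SU2) :
    (A * B).1 0 0 = A.1 0 0 * B.1 0 0 - (starRingEnd ℂ) (A.1 1 0) * B.1 1 0 ∧
    (A * B).1 1 0 = A.1 1 0 * B.1 0 0 + (starRingEnd ℂ) (A.1 0 0) * B.1 1 0 := by
  change (A.1 * B.1) 0 0 = _ ∧ (A.1 * B.1) 1 0 = _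
  rw [Matrix.mul_apply, Matrix.mul_apply, Fin.sum_univ_two, Fin.sum_univ_two, (su2_entries A).1,
    (su2_entries A).2]
  constructor
  · ring
  · ring

theorem su2_inv_entries (A : SU2) :
    (A⁻¹).1 0 0 = (starRingEnd ℂ) (A.1 0 0) ∧ (A⁻¹).1 1 0 = -A.1 1 0 := by
  change (star A.1) 0 0 = _ ∧ (star A.1) 1 0 = _
  rw [Matrix.star_apply, Matrix.star_apply, (su2_entries A).2]
  simp

theorem eq_diagSU_of_entry {A : SU2} (h : A.1 1 0 = 0) :
    ∃ z : Circle, (z : ℂ) = A.1 0 0 ∧ A = diagSU z := by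
  have hn := su2_norm A
  rw [h, norm_zero, zero_pow two_ne_zero, add_zero] at hn
  have hn' : ‖A.1 0 0‖ = 1 := by
    nlinarith [norm_nonneg (A.1 0 0)]
  refine ⟨⟨A.1 0 0, mem_sphere_zero_iff_norm.mpr hn'⟩, rfl, su2_ext rfl ?_⟩
  rw [h]
  rfl

/-- Every element of `SU(2)` is conjugate to a diagonal one. -/
theorem exists_conj_diagSU (A : SU2) : ∃ (g : SU2) (z : Circle), g * A * g⁻¹ = diagSU z := by
  obtain ⟨μ, hμ⟩ := Module.End.exists_eigenvalue (Matrix.toLin' A.1)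
  obtain ⟨v, hv⟩ := hμ.exists_hasEigenvector
  have hv1 : A.1.mulVec v = μ • v := hv.apply_eq_smul
  have hv0 : v ≠ 0 := hv.2
  have hN : 0 < ‖v 0‖ ^ 2 + ‖v 1‖ ^ 2 := by
    by_contra! h
    have h0 : ‖v 0‖ = 0 := by nlinarith [sq_nonneg ‖v 0‖, sq_nonneg ‖v 1‖]
    have h1 : ‖v 1‖ = 0 := by nlinarith [sq_nonneg ‖v 0‖, sq_nonneg ‖v 1‖]
    apply hv0
    ext i
    fin_cases i
    · exact norm_eq_zero.mp h0
    · exact norm_eq_zero.mp h1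
  set N := √(‖v 0‖ ^ 2 + ‖v 1‖ ^ 2) with hNdef
  have hNp : 0 < N := Real.sqrt_pos.mpr hN
  have hN2 : N ^ 2 = ‖v 0‖ ^ 2 + ‖v 1‖ ^ 2 := Real.sq_sqrt hN.le
  have hab : ‖v 0 / N‖ ^ 2 + ‖v 1 / N‖ ^ 2 = 1 := by
    rw [norm_div, norm_div, Complex.norm_real, Real.norm_of_nonneg hNp.le, div_pow, div_pow,
      ← add_div, ← hN2, div_self (by positivity)]
  -- The first column of g is a unit eigenvector of A, so g⁻¹Ag has zero lower left entry; in SU(2)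
  -- this makes it diagonal.
  set g := suMat (v 0 / N) (v 1 / N) hab with hg
  have hentry : (g⁻¹ * A * g).1 1 0 = 0 := by
    have e0 := congrFun hv1 0
    have e1 := congrFun hv1 1
    simp only [Matrix.mulVec, dotProduct, Fin.sum_univ_two, Pi.smul_apply, smul_eq_mul] at e0 e1
    rw [(su2_entries A).2] at e0
    rw [(su2_entries A).1] at e1
    rw [(su2_mul_entries _ _).2, (su2_mul_entries _ _).2, (su2_mul_entries _ _).1,
      (su2_inv_entries g).1, (su2_inv_entries g).2]
    have g0 : g.1 0 0 = v 0 / N := rfl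
    have g1 : g.1 1 0 = v 1 / N := rfl
    rw [g0, g1]
    simp only [map_neg, map_sub, map_mul, Complex.conj_conj]
    linear_combination (-(v 1 / N) / N) * e0 + (v 0 / N / N) * e1
  obtain ⟨z, -, hz⟩ := eq_diagSU_of_entry hentry
  exact ⟨g⁻¹, z, by rw [inv_inv]; exact hz⟩

theorem diagSU_entries (z : Circle) : (diagSU z).1 0 0 = z ∧ (diagSU z).1 1 0 = 0 := ⟨rfl, rfl⟩

theorem conj_mul_self_circle (z : Circle) : (starRingEnd ℂ) (z : ℂ) * z = 1 := by
  rw [mul_comm, Complex.mul_conj, Circle.normSq_coe, Complex.ofReal_one]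

/-- The Weyl element of `SU(2)`. -/
def weylSU : SU2 := suMat 0 1 (by simp)

theorem weyl_conj_diagSU (z : Circle) : weylSU * diagSU z * weylSU⁻¹ = diagSU z⁻¹ := by
  have w0 : weylSU.1 0 0 = 0 := rfl
  have w1 : weylSU.1 1 0 = 1 := rfl
  apply su2_ext
  · rw [(su2_mul_entries _ _).1, (su2_mul_entries _ _).1, (su2_mul_entries _ _).2,
      (su2_inv_entries _).1, (su2_inv_entries _).2, (diagSU_entries _).1, (diagSU_entries _).2,
      (diagSU_entries _).1, w0, w1, Circle.coe_inv_eq_conj]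
    simp
  · rw [(su2_mul_entries _ _).2, (su2_mul_entries _ _).1, (su2_mul_entries _ _).2,
      (su2_inv_entries _).1, (su2_inv_entries _).2, (diagSU_entries _).1, (diagSU_entries _).2,
      (diagSU_entries _).2, w0, w1]
    simp

theorem exists_conj_diagSU_im_nonneg (A : SU2) :
    ∃ (g : SU2) (z : Circle), g * A * g⁻¹ = diagSU z ∧ 0 ≤ (z : ℂ).im := by
  obtain ⟨g, z, h⟩ := exists_conj_diagSU A
  rcases le_total 0 (z : ℂ).im with hz | hz
  · exact ⟨g, z, h, hz⟩
  · refine ⟨weylSU * g, z⁻¹, ?_, ?_⟩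
    · rw [← weyl_conj_diagSU, ← h]
      group
    · rw [Circle.coe_inv_eq_conj, Complex.conj_im]
      linarith

/-- Conjugation by the diagonal torus only rotates the lower left entry, so it can be made real and
nonnegative. -/
theorem diagSU_conj_suMat (μ : Circle) (A : SU2) :
    (diagSU μ * A * (diagSU μ)⁻¹).1 0 0 = A.1 0 0 ∧
    (diagSU μ * A * (diagSU μ)⁻¹).1 1 0 = (starRingEnd ℂ) (μ : ℂ) ^ 2 * A.1 1 0 := by
  have h := conj_mul_self_circle μ
  rw [(su2_mul_entries (diagSU μ * A) _).1, (su2_mul_entries (diagSU μ * A) _).2,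
    (su2_mul_entries (diagSU μ) A).1, (su2_mul_entries (diagSU μ) A).2, (su2_inv_entries _).1,
    (su2_inv_entries _).2, (diagSU_entries _).1, (diagSU_entries _).2]
  constructor
  · simp only [map_zero]
    linear_combination A.1 0 0 * h
  · ring

theorem exists_circle_sq_mul (b : ℂ) : ∃ μ : Circle, (starRingEnd ℂ) (μ : ℂ) ^ 2 * b = ‖b‖ := by
  refine ⟨Circle.exp (Complex.arg b / 2), ?_⟩
  rw [← Circle.coe_inv_eq_conj, ← Circle.exp_neg, ← Circle.coe_pow, ← Circle.exp_natCast_mul]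
  have h : ((2 : ℕ) : ℝ) * -(Complex.arg b / 2) = -Complex.arg b := by push_cast; ring
  rw [h]
  conv_lhs => rw [← Complex.norm_mul_exp_arg_mul_I b]
  rw [Circle.coe_exp, mul_left_comm, ← Complex.exp_add]
  push_cast
  simp

/-! ### The normal form of representations in `SU(2)` -/

/-- The element of `SU(2)` with diagonal `(p, p̄)` and nonnegative real lower left entry. -/
def discSU (p : ClosedDisc) : SU2 :=
  suMat p √(1 - ‖(p : ℂ)‖ ^ 2) (by
    have h1 : ‖(p : ℂ)‖ ≤ 1 := mem_closedBall_zero_iff.mp p.2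
    have h2 : 0 ≤ 1 - ‖(p : ℂ)‖ ^ 2 := by nlinarith [norm_nonneg (p : ℂ)]
    rw [Complex.norm_real, Real.norm_of_nonneg (Real.sqrt_nonneg _), Real.sq_sqrt h2]
    ring)

theorem ClosedDisc.norm_le (p : ClosedDisc) : ‖(p : ℂ)‖ ≤ 1 := mem_closedBall_zero_iff.mp p.2

theorem discSU_entries (p : ClosedDisc) :
    (discSU p).1 0 0 = p ∧ (discSU p).1 1 0 = (√(1 - ‖(p : ℂ)‖ ^ 2) : ℝ) := ⟨rfl, rfl⟩

theorem discSU_eq_diagSU {p : ClosedDisc} {z : Circle} (h : (p : ℂ) = z) : discSU p = diagSU z := by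
  apply su2_ext
  · exact h
  · rw [(discSU_entries p).2, h, Circle.norm_coe]
    simp [(diagSU_entries z).2]

theorem continuous_discSU : Continuous discSU := by
  refine Continuous.subtype_mk ?_ _
  refine continuous_matrix fun i j => ?_
  fin_cases i <;> fin_cases j <;> simp <;> fun_prop

theorem continuous_circle_coe : Continuous fun z : Circle => (z : ℂ) := continuous_subtype_val

theorem continuous_diagSU : Continuous diagSU := by
  refine Continuous.subtype_mk (f := fun z : Circle =>
    (!![(z : ℂ), 0; 0, ((z⁻¹ : Circle) : ℂ)] : Matrix (Fin 2) (Fin 2) ℂ)) ?_ _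
  refine continuous_matrix fun i j => ?_
  fin_cases i <;> fin_cases j <;> simp
  · exact continuous_circle_coe
  · exact continuous_const
  · exact continuous_const
  · exact continuous_circle_coe.inv₀ fun z => z.coe_ne_zero

theorem diagSU_comm_iff {z : Circle} {A : SU2} :
    diagSU z * A = A * diagSU z ↔ A.1 1 0 = 0 ∨ z ^ 2 = 1 := by
  have key : (starRingEnd ℂ) (z : ℂ) * A.1 1 0 = A.1 1 0 * z ↔ A.1 1 0 = 0 ∨ z ^ 2 = 1 := by
    have h := conj_mul_self_circle z
    rw [← Circle.coe_inj, Circle.coe_pow, Circle.coe_one]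
    constructor
    · intro h1
      by_cases h0 : A.1 1 0 = 0
      · exact Or.inl h0
      · right
        apply mul_left_cancel₀ h0
        linear_combination -z * h1 + A.1 1 0 * h
    · rintro (h1 | h1)
      · rw [h1]; ring
      · linear_combination A.1 1 0 * z * h - A.1 1 0 * (starRingEnd ℂ) (z : ℂ) * h1
  rw [← key]
  constructor
  · intro h
    have := congrArg (fun B : SU2 => B.1 1 0) h
    simpa [(su2_mul_entries _ _).2, (diagSU_entries z).1, (diagSU_entries z).2] using this
  · intro h
    apply su2_ext
    · rw [(su2_mul_entries _ _).1, (su2_mul_entries _ _).1, (diagSU_entries z).1,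
        (diagSU_entries z).2]
      simp [mul_comm]
    · rw [(su2_mul_entries _ _).2, (su2_mul_entries _ _).2, (diagSU_entries z).1,
        (diagSU_entries z).2]
      simpa using h

/-- Parameters of the representations `a ↦ diag(z, z⁻¹)`, `b ↦ discSU p` of `Γ_n`. -/
def Params (n : ℕ) : Set (Circle × ClosedDisc) :=
  {q | ‖(q.2 : ℂ)‖ = 1 ∨ q.1 ^ (2 * n) = 1}

theorem isClosed_params (n : ℕ) : IsClosed (Params n) := by
  simp only [Params, Set.ofPred_or]
  exact (isClosed_eq (by fun_prop) (by fun_prop)).union (isClosed_eq (by fun_prop) (by fun_prop))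

instance (n : ℕ) : CompactSpace (Params n) :=
  isCompact_iff_compactSpace.mp (isClosed_params n).isCompact

theorem discSU_entry_eq_zero_iff {p : ClosedDisc} : (discSU p).1 1 0 = 0 ↔ ‖(p : ℂ)‖ = 1 := by
  have h1 := p.norm_le
  have h2 : 0 ≤ 1 - ‖(p : ℂ)‖ ^ 2 := by nlinarith [norm_nonneg (p : ℂ)]
  rw [(discSU_entries p).2, Complex.ofReal_eq_zero, Real.sqrt_eq_zero h2]
  constructor
  · intro h
    nlinarith [norm_nonneg (p : ℂ)]
  · intro h
    rw [h]; ring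

theorem params_comm_iff {n : ℕ} {z : Circle} {p : ClosedDisc} :
    diagSU z ^ n * discSU p = discSU p * diagSU z ^ n ↔ (z, p) ∈ Params n := by
  rw [← map_pow, diagSU_comm_iff, discSU_entry_eq_zero_iff, ← pow_mul, mul_comm n 2]
  rfl

/-- The representation `a ↦ diag(z, z⁻¹)`, `b ↦ discSU p` of `Γ_n`. -/
def discRep {n : ℕ} (q : Params n) : LinkGroup n →* SU2 :=
  homOfPair n (diagSU q.1.1) (discSU q.1.2) (params_comm_iff.mpr q.2)

theorem discRep_genA {n : ℕ} (q : Params n) : discRep q (genA n) = diagSU q.1.1 :=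
  homOfPair_genA _ _ _ _

theorem discRep_genB {n : ℕ} (q : Params n) : discRep q (genB n) = discSU q.1.2 :=
  homOfPair_genB _ _ _ _

theorem discRep_eq_diagRep {n : ℕ} {q : Params n} {w : Circle} (h : (q.1.2 : ℂ) = w) :
    discRep q = diagRep n q.1.1 w := by
  apply linkGroup_hom_ext
  · rw [discRep_genA, diagRep, MonoidHom.comp_apply, homOfPair_genA]
  · rw [discRep_genB, diagRep, MonoidHom.comp_apply, homOfPair_genB, discSU_eq_diagSU h]

theorem suClass_eq_iff {n : ℕ} {ρ σ : LinkGroup n →* SU2} : suClass ρ = suClass σ ↔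
    ∃ g : SU2, σ (genA n) = g * ρ (genA n) * g⁻¹ ∧ σ (genB n) = g * ρ (genB n) * g⁻¹ := by
  constructor
  · intro h
    obtain ⟨g, hg⟩ := Quotient.exact h
    subst hg
    exact ⟨g, rfl, rfl⟩
  · rintro ⟨g, hA, hB⟩
    exact Quotient.sound ⟨g, linkGroup_hom_ext hA hB⟩

theorem continuous_suClass_discRep (n : ℕ) :
    Continuous fun q : Params n => suClass (discRep q) := by
  refine continuous_quot_mk.comp (f := fun q : Params n =>
    RepSpace.of (discRep q)) (continuous_to_repSpace ?_ ?_)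
  · change Continuous fun q : Params n => discRep q (genA n)
    simp only [discRep_genA]
    exact continuous_diagSU.comp (by fun_prop)
  · change Continuous fun q : Params n => discRep q (genB n)
    simp only [discRep_genB]
    exact continuous_discSU.comp (by fun_prop)

/-- The parameters of the normal form of a representation. -/
def IsNormal (z : Circle) (p : ClosedDisc) : Prop :=
  -- If z = ±1, the image of a is central. The whole group is then free to diagonalize b, with
  -- eigenvalue p in the upper half circle.
  0 ≤ (z : ℂ).im ∧ ((z : ℂ).im = 0 → ‖(p : ℂ)‖ = 1 ∧ 0 ≤ (p : ℂ).im)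

theorem circle_sq_eq_one_of_im {z : Circle} (h : (z : ℂ).im = 0) : z ^ 2 = 1 := by
  have h1 := conj_mul_self_circle z
  rw [← Circle.coe_inj, Circle.coe_pow, Circle.coe_one]
  rw [Complex.conj_eq_iff_im.mpr h] at h1
  rw [sq, h1]

theorem exists_normal_form {n : ℕ} (ρ : LinkGroup n →* SU2) :
    ∃ q : Params n, IsNormal q.1.1 q.1.2 ∧ suClass ρ = suClass (discRep q) := by
  obtain ⟨g, z, hz, him⟩ := exists_conj_diagSU_im_nonneg (ρ (genA n))
  by_cases h0 : (z : ℂ).im = 0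
  · have hz2 := circle_sq_eq_one_of_im h0
    have hcomm : ∀ B, diagSU z * B = B * diagSU z := fun B => diagSU_comm_iff.mpr (Or.inr hz2)
    obtain ⟨k, w, hw, hwim⟩ := exists_conj_diagSU_im_nonneg (ρ (genB n))
    have hA : ∀ l : SU2, l * ρ (genA n) * l⁻¹ = diagSU z := by
      intro l
      have : ρ (genA n) = diagSU z := by
        calc ρ (genA n) = g⁻¹ * (g * ρ (genA n) * g⁻¹) * g := by group
          _ = diagSU z := by rw [hz, mul_assoc, hcomm, ← mul_assoc, inv_mul_cancel, one_mul]
      rw [this, ← hcomm, mul_assoc, mul_inv_cancel, mul_one]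
    let p : ClosedDisc := ⟨w, by rw [mem_closedBall_zero_iff, Circle.norm_coe]⟩
    refine ⟨⟨(z, p), Or.inl (Circle.norm_coe w)⟩, ⟨him, fun _ => ⟨Circle.norm_coe w, hwim⟩⟩, ?_⟩
    rw [suClass_eq_iff]
    refine ⟨k, ?_, ?_⟩
    · rw [discRep_genA, hA]
    · rw [discRep_genB, hw]
      exact discSU_eq_diagSU rfl
  · set B := g * ρ (genB n) * g⁻¹ with hB
    -- The torus element commutes with the diagonal image of a and rotates the lower left entry of b
    -- to its absolute value.
    obtain ⟨μ, hμ⟩ := exists_circle_sq_mul (B.1 1 0)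
    have hBn := su2_norm B
    let p : ClosedDisc := ⟨B.1 0 0, by
      rw [mem_closedBall_zero_iff]; nlinarith [norm_nonneg (B.1 0 0), sq_nonneg ‖B.1 1 0‖]⟩
    have hp : diagSU μ * B * (diagSU μ)⁻¹ = discSU p := by
      apply su2_ext
      · exact (diagSU_conj_suMat μ B).1
      · rw [(diagSU_conj_suMat μ B).2, hμ, (discSU_entries p).2]
        have : 1 - ‖(p : ℂ)‖ ^ 2 = ‖B.1 1 0‖ ^ 2 := by
          change 1 - ‖B.1 0 0‖ ^ 2 = _; linarith
        rw [this, Real.sqrt_sq (norm_nonneg _)]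
    have hA' : diagSU μ * g * ρ (genA n) * (diagSU μ * g)⁻¹ = diagSU z := by
      calc diagSU μ * g * ρ (genA n) * (diagSU μ * g)⁻¹ =
          diagSU μ * (g * ρ (genA n) * g⁻¹) * (diagSU μ)⁻¹ := by group
        _ = diagSU z := by rw [hz, ← map_inv, ← map_mul, ← map_mul]; congr 1; rw [mul_comm μ, mul_inv_cancel_right]
    have hB' : diagSU μ * g * ρ (genB n) * (diagSU μ * g)⁻¹ = discSU p := by
      rw [← hp, hB]; group
    have hcomm : (z, p) ∈ Params n := by
      rw [← params_comm_iff, ← hA', ← hB', conj_pow]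
      have := rep_pow_comm ρ
      calc _ = diagSU μ * g * (ρ (genA n) ^ n * ρ (genB n)) * (diagSU μ * g)⁻¹ := by group
        _ = _ := by rw [this]; group
    refine ⟨⟨(z, p), hcomm⟩, ⟨him, fun h => absurd h h0⟩, ?_⟩
    rw [suClass_eq_iff]
    exact ⟨diagSU μ * g, by rw [discRep_genA, hA'], by rw [discRep_genB, hB']⟩

/-! ### The half traces of a representation in `SU(2)` -/

/-- The real part of half the trace. -/
def halfTraceSU (A : SU2) : ℝ := (A.1.trace / 2).re

theorem halfTraceSU_conj (g A : SU2) : halfTraceSU (g * A * g⁻¹) = halfTraceSU A := by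
  have h : (g * A * g⁻¹).1.trace = A.1.trace := by
    have e : (g * A * g⁻¹).1 = g.1 * A.1 * (g⁻¹).1 := rfl
    rw [e, Matrix.trace_mul_comm, ← mul_assoc]
    have e2 : (g⁻¹).1 * g.1 = 1 := congrArg Subtype.val (inv_mul_cancel g)
    rw [e2, one_mul]
  rw [halfTraceSU, h, halfTraceSU]

theorem halfTraceSU_eq (A : SU2) : halfTraceSU A = (A.1 0 0).re := by
  rw [halfTraceSU, Matrix.trace_fin_two, (su2_entries A).1, Complex.add_conj]
  simp

theorem continuous_halfTraceSU : Continuous halfTraceSU := by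
  have : halfTraceSU = fun A => (A.1 0 0).re := funext halfTraceSU_eq
  rw [this]
  exact Complex.continuous_re.comp ((continuous_apply_apply 0 0).comp continuous_subtype_val)

/-- The half traces of the images of `a`, `b` and `ab`. -/
def suTraces (n : ℕ) : SUCharVar (LinkGroup n) → ℝ × ℝ × ℝ :=
  Quotient.lift (fun ρ : RepSpace (LinkGroup n) SU2 => (halfTraceSU (ρ.hom (genA n)),
    halfTraceSU (ρ.hom (genB n)), halfTraceSU (ρ.hom (genA n * genB n)))) (by
      rintro ρ σ ⟨g, rfl⟩
      change _ = (halfTraceSU (g * ρ.hom (genA n) * g⁻¹), halfTraceSU (g * ρ.hom (genB n) * g⁻¹),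
        halfTraceSU (g * ρ.hom (genA n * genB n) * g⁻¹))
      simp only [halfTraceSU_conj])

theorem continuous_suTraces (n : ℕ) : Continuous (suTraces n) := by
  refine continuous_quot_lift _ ?_
  exact (continuous_halfTraceSU.comp (continuous_repSpace_apply _)).prodMk
    ((continuous_halfTraceSU.comp (continuous_repSpace_apply _)).prodMk
    (continuous_halfTraceSU.comp (continuous_repSpace_apply _)))

theorem suTraces_discRep {n : ℕ} (q : Params n) : suTraces n (suClass (discRep q)) =
    ((q.1.1 : ℂ).re, (q.1.2 : ℂ).re,
      (q.1.1 : ℂ).re * (q.1.2 : ℂ).re - (q.1.1 : ℂ).im * (q.1.2 : ℂ).im) := by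
  change (halfTraceSU (discRep q (genA n)), halfTraceSU (discRep q (genB n)),
    halfTraceSU (discRep q (genA n * genB n))) = _
  rw [map_mul, discRep_genA, discRep_genB, halfTraceSU_eq, halfTraceSU_eq, halfTraceSU_eq,
    (su2_mul_entries _ _).1, (discSU_entries _).1, (diagSU_entries _).1, (diagSU_entries _).2]
  simp

theorem circle_re_im (z : Circle) : (z : ℂ).re ^ 2 + (z : ℂ).im ^ 2 = 1 := by
  have := Circle.normSq_coe z
  rw [Complex.normSq_apply] at this
  linarith

theorem norm_sq_re_im (z : ℂ) : ‖z‖ ^ 2 = z.re ^ 2 + z.im ^ 2 := by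
  rw [← Complex.normSq_eq_norm_sq, Complex.normSq_apply]; ring

/-- The first two half traces are Re z and Re p, and Im z is determined by its sign. If Im z ≠ 0,
the third half trace gives Im p; if Im z = 0, then |p| = 1 and Im p ≥ 0 do. -/
theorem normal_params_unique {n : ℕ} {q q' : Params n} (hq : IsNormal q.1.1 q.1.2)
    (hq' : IsNormal q'.1.1 q'.1.2)
    (h : suTraces n (suClass (discRep q)) = suTraces n (suClass (discRep q'))) : q = q' := by
  obtain ⟨⟨z, p⟩, hm⟩ := q
  obtain ⟨⟨z', p'⟩, hm'⟩ := q'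
  rw [suTraces_discRep, suTraces_discRep] at h
  simp only [Prod.mk.injEq] at h hq hq'
  obtain ⟨h1, h2, h3⟩ := h
  have c := circle_re_im z
  have c' := circle_re_im z'
  have him : (z : ℂ).im = (z' : ℂ).im := by
    have : (z : ℂ).im ^ 2 = (z' : ℂ).im ^ 2 := by rw [h1] at c; linarith
    exact (pow_left_inj₀ hq.1 hq'.1 two_ne_zero).mp this
  have hz : z = z' := Circle.ext (Complex.ext h1 him)
  subst hz
  have hp : (p : ℂ).im = (p' : ℂ).im := by
    by_cases h0 : (z : ℂ).im = 0
    · obtain ⟨a1, a2⟩ := hq.2 h0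
      obtain ⟨b1, b2⟩ := hq'.2 h0
      have e1 := norm_sq_re_im p
      have e2 := norm_sq_re_im p'
      rw [a1] at e1
      rw [b1] at e2
      have : (p : ℂ).im ^ 2 = (p' : ℂ).im ^ 2 := by rw [h2] at e1; linarith
      exact (pow_left_inj₀ a2 b2 two_ne_zero).mp this
    · apply mul_left_cancel₀ h0
      rw [h2] at h3
      linarith
  have : p = p' := Subtype.ext (Complex.ext h2 hp)
  subst this
  rfl

theorem suTraces_injective (n : ℕ) : Function.Injective (suTraces n) := by
  intro x y h
  induction x using Quotient.ind with | _ ρ => ?_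
  induction y using Quotient.ind with | _ σ => ?_
  change suTraces n (suClass ρ) = suTraces n (suClass σ) at h
  change suClass ρ = suClass σ
  obtain ⟨q, hq, e⟩ := exists_normal_form ρ
  obtain ⟨q', hq', e'⟩ := exists_normal_form σ
  rw [e, e'] at h ⊢
  rw [normal_params_unique hq hq' h]

instance (n : ℕ) : T2Space (SUCharVar (LinkGroup n)) :=
  T2Space.of_injective_continuous (suTraces_injective n) (continuous_suTraces n)

theorem surjective_suClass_discRep (n : ℕ) :
    Function.Surjective fun q : Params n => suClass (discRep q) := by
  intro x
  induction x using Quotient.ind with | _ ρ => ?_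
  obtain ⟨q, -, e⟩ := exists_normal_form ρ
  exact ⟨q, e.symm⟩

instance (n : ℕ) : CompactSpace (SUCharVar (LinkGroup n)) :=
  (surjective_suClass_discRep n).compactSpace (continuous_suClass_discRep n)

/-! ### Roots of unity in the upper half circle -/

theorem circle_exp_re_im (t : ℝ) :
    (Circle.exp t : ℂ).re = Real.cos t ∧ (Circle.exp t : ℂ).im = Real.sin t := by
  rw [Circle.coe_exp]
  exact ⟨Complex.exp_ofReal_mul_I_re t, Complex.exp_ofReal_mul_I_im t⟩

theorem exp_index_pow {n j : ℕ} (hn : 0 < n) : Circle.exp (Real.pi * j / n) ^ (2 * n) = 1 := by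
  rw [← Circle.exp_natCast_mul]
  have hn' : (n : ℝ) ≠ 0 := by positivity
  have : ((2 * n : ℕ) : ℝ) * (Real.pi * j / n) = ((j : ℤ) : ℝ) * (2 * Real.pi) := by
    push_cast
    field_simp
  rw [this, Circle.exp_int_mul_two_pi]

theorem upper_root_iff {n : ℕ} (hn : 1 ≤ n) (z : Circle) :
    (z ^ (2 * n) = 1 ∧ 0 < (z : ℂ).im) ↔
      ∃ j : ℕ, 0 < j ∧ j < n ∧ z = Circle.exp (Real.pi * j / n) := by
  have hn0 : (0 : ℝ) < n := by exact_mod_cast hn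
  have hpi := Real.pi_pos
  constructor
  · rintro ⟨h1, h2⟩
    obtain ⟨t, ht⟩ : ∃ t : ℝ, t = Complex.arg z := ⟨_, rfl⟩
    have hz : z = Circle.exp t := by rw [ht, Circle.exp_arg]
    have ht2 : t ≤ Real.pi := ht ▸ Complex.arg_le_pi _
    have ht0 : 0 ≤ t := ht ▸ (Complex.arg_nonneg_iff.mpr h2.le)
    rw [hz, ← Circle.exp_natCast_mul, Circle.exp_eq_one] at h1
    obtain ⟨m, hm⟩ := h1
    have hm' : (n : ℝ) * t = m * Real.pi := by push_cast at hm; linarith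
    rw [hz, (circle_exp_re_im t).2] at h2
    have ht0' : 0 < t := lt_of_le_of_ne ht0 fun h => by rw [← h] at h2; simp at h2
    have ht2' : t < Real.pi := lt_of_le_of_ne ht2 fun h => by rw [h] at h2; simp at h2
    have hm0 : (0 : ℝ) < m := by
      by_contra! h
      nlinarith [mul_pos hn0 ht0']
    have hmn : (m : ℝ) < n := by
      by_contra! h
      nlinarith [mul_pos hn0 ht0']
    have hm0' : 0 < m := by exact_mod_cast hm0
    have hmn' : m < n := by exact_mod_cast hmn
    lift m to ℕ using hm0'.le
    refine ⟨m, by exact_mod_cast hm0', by exact_mod_cast hmn', ?_⟩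
    rw [hz]
    congr 1
    rw [eq_div_iff hn0.ne']
    push_cast at hm'
    linarith
  · rintro ⟨j, h0, h1, rfl⟩
    exact ⟨exp_index_pow (by omega), by rw [(circle_exp_re_im _).2]; exact sin_index_pos h0 h1⟩

/-! ### The image of the half traces -/

/-- For the normal form (ζ, p) one has z − xy = −Im ζ · Im p and 1 − x² = (Im ζ)², so the inequality
says |p| ≤ 1, with equality on the surface when |p| = 1. -/
theorem suTraces_mem {n : ℕ} (hn : 1 ≤ n) (x : SUCharVar (LinkGroup n)) :
    suTraces n x ∈ slicedBody n := by
  induction x using Quotient.ind with | _ ρ => ?_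
  change suTraces n (suClass ρ) ∈ _
  obtain ⟨⟨⟨z, p⟩, hm⟩, ⟨him, -⟩, e⟩ := exists_normal_form ρ
  rw [e, suTraces_discRep]
  have hz := circle_re_im z
  have hp := norm_sq_re_im p
  have hp1 : ‖(p : ℂ)‖ ^ 2 ≤ 1 := by nlinarith [p.norm_le, norm_nonneg (p : ℂ)]
  simp only at him ⊢
  have hzim : 1 - (z : ℂ).re ^ 2 = (z : ℂ).im ^ 2 := by linarith
  refine ⟨?_, ?_, ?_, ?_⟩
  · rw [← sq_le_one_iff_abs_le_one]; nlinarith [sq_nonneg (z : ℂ).im]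
  · rw [← sq_le_one_iff_abs_le_one]; nlinarith [sq_nonneg (p : ℂ).im]
  · simp only
    rw [hzim]
    calc _ = (z : ℂ).im ^ 2 * (p : ℂ).im ^ 2 := by ring
      _ ≤ _ := mul_le_mul_of_nonneg_left (by linarith) (sq_nonneg _)
  · simp only
    rcases hm with h | h
    · left
      simp only at h
      rw [h] at hp
      rw [hzim]
      linear_combination (-(z : ℂ).im ^ 2) * hp
    · rcases eq_or_lt_of_le him with h0 | h0
      · left
        rw [hzim, ← h0]
        ring
      · right
        obtain ⟨j, hj0, hj1, hj⟩ := (upper_root_iff hn z).mp ⟨h, h0⟩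
        exact ⟨j, hj0, hj1, by rw [hj, (circle_exp_re_im _).1]⟩

/-- A real lift (x, w), (y, d) of the point is a representation in disguise: a has eigenvalue x + iw
and b has upper left entry y + id. Over a slice w = ± sin(πj/n), so the eigenvalue is a root of
unity or its inverse. -/
theorem exists_suTraces_eq {n : ℕ} {v : ℝ × ℝ × ℝ} (hv : v ∈ slicedBody n) :
    ∃ x, suTraces n x = v := by
  obtain ⟨w, d, hmem, hle, hz⟩ := exists_real_lift hv
  have h1 : v.1 ^ 2 + w ^ 2 = 1 := (real_conic_iff _ _).mp hmem.1
  have hnorm : ‖(⟨v.1, w⟩ : ℂ)‖ = 1 := by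
    have := norm_sq_re_im ⟨v.1, w⟩
    simp only at this
    rw [h1] at this
    nlinarith [norm_nonneg (⟨v.1, w⟩ : ℂ)]
  have hpn := norm_sq_re_im ⟨v.2.1, d⟩
  simp only at hpn
  let z : Circle := ⟨⟨v.1, w⟩, mem_sphere_zero_iff_norm.mpr hnorm⟩
  let p : ClosedDisc := ⟨⟨v.2.1, d⟩, by
    rw [mem_closedBall_zero_iff]
    nlinarith [norm_nonneg (⟨v.2.1, d⟩ : ℂ)]⟩
  have hq : (z, p) ∈ Params n := by
    rcases hmem.2 with h | ⟨j, h0, hj, hx⟩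
    · left
      have h2 : v.2.1 ^ 2 + d ^ 2 = 1 := (real_conic_iff _ _).mp h
      change ‖(⟨v.2.1, d⟩ : ℂ)‖ = 1
      nlinarith [norm_nonneg (⟨v.2.1, d⟩ : ℂ)]
    · right
      have hn : 0 < n := by omega
      have hx' : v.1 = Real.cos (Real.pi * j / n) := by
        simp only at hx
        exact_mod_cast hx
      have hw : w ^ 2 = Real.sin (Real.pi * j / n) ^ 2 := by
        have := Real.sin_sq_add_cos_sq (Real.pi * j / n)
        rw [hx'] at h1
        linarith
      change z ^ (2 * n) = 1
      rcases sq_eq_sq_iff_eq_or_eq_neg.mp hw with h | h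
      · have : z = Circle.exp (Real.pi * j / n) := by
          apply Circle.ext
          apply Complex.ext
          · rw [(circle_exp_re_im _).1]; exact hx'
          · rw [(circle_exp_re_im _).2]; exact h
        rw [this, exp_index_pow hn]
      · have : z = (Circle.exp (Real.pi * j / n))⁻¹ := by
          apply Circle.ext
          rw [Circle.coe_inv_eq_conj]
          apply Complex.ext
          · rw [Complex.conj_re, (circle_exp_re_im _).1]; exact hx'
          · rw [Complex.conj_im, (circle_exp_re_im _).2]; exact h
        rw [this, inv_pow, exp_index_pow hn, inv_one]
  refine ⟨suClass (discRep ⟨(z, p), hq⟩), ?_⟩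
  rw [suTraces_discRep]
  exact Prod.ext rfl (Prod.ext rfl hz.symm)

/-- The character variety is homeomorphic to its model. -/
def suCharVarHomeo {n : ℕ} (hn : 1 ≤ n) : SUCharVar (LinkGroup n) ≃ₜ slicedBody n :=
  Continuous.homeoOfEquivCompactToT2
    (f := Equiv.ofBijective (fun x => (⟨suTraces n x, suTraces_mem hn x⟩ : slicedBody n))
      ⟨fun x y h => suTraces_injective n (congrArg Subtype.val h), fun v => by
        obtain ⟨x, hx⟩ := exists_suTraces_eq v.2
        exact ⟨x, Subtype.ext hx⟩⟩)
    ((continuous_suTraces n).subtype_mk _)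

/-! ### Reducible and irreducible representations -/

theorem IsIrred.of_suClass_eq {Γ : Type*} [Group Γ] {ρ σ : Γ →* SU2} (h : suClass ρ = suClass σ)
    (hσ : IsIrred σ) : IsIrred ρ := by
  obtain ⟨g, hg⟩ := Quotient.exact h
  have hgγ : ∀ γ, (σ γ).1 = g.1 * (ρ γ).1 * (g⁻¹).1 := fun γ =>
    congrArg Subtype.val (DFunLike.congr_fun (show σ = _ from hg) γ)
  have hgg : (g⁻¹).1 * g.1 = 1 := congrArg Subtype.val (inv_mul_cancel g)
  have hgg' : g.1 * (g⁻¹).1 = 1 := congrArg Subtype.val (mul_inv_cancel g)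
  intro W hW
  set f := Matrix.toLin' g.1 with hf
  have hinj : Function.Injective f := by
    apply Function.LeftInverse.injective (g := Matrix.toLin' (g⁻¹).1)
    intro v
    rw [hf, ← LinearMap.comp_apply, ← Matrix.toLin'_mul, hgg, Matrix.toLin'_one]
    rfl
  have hsurj : Function.Surjective f := LinearMap.injective_iff_surjective.mp hinj
  have hinv : IsInvariant σ (W.map f) := by
    rintro γ _ ⟨w, hw, rfl⟩
    refine ⟨(ρ γ).1.mulVec w, hW γ w hw, ?_⟩
    rw [hgγ, hf, Matrix.toLin'_apply, Matrix.toLin'_apply, Matrix.mulVec_mulVec,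
      Matrix.mulVec_mulVec, mul_assoc, mul_assoc, hgg, mul_one]
  rcases hσ _ hinv with h | h
  · left
    exact (Submodule.map_injective_of_injective hinj) (by rw [h, Submodule.map_bot])
  · right
    refine (Submodule.map_injective_of_injective hinj) ?_
    rw [h, Submodule.map_top, LinearMap.range_eq_top.mpr hsurj]

theorem IsTotallyReducible.not_isIrred {Γ : Type*} [Group Γ] {ρ : Γ →* SU2}
    (h : IsTotallyReducible ρ) : ¬IsIrred ρ := by
  intro hi
  obtain ⟨W, -, hW, -, h1, -, -⟩ := h
  rcases hi W hW with rfl | rfl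
  · simp at h1
  · simp at h1

theorem isInvariant_span_single {n : ℕ} (z w : Circle) (i : Fin 2) :
    IsInvariant (diagRep n z w) (Submodule.span ℂ {Pi.single i 1}) := by
  intro γ v hv
  rw [Submodule.mem_span_singleton] at hv ⊢
  obtain ⟨c, rfl⟩ := hv
  obtain ⟨u, hu⟩ : ∃ u, diagRep n z w γ = diagSU u := ⟨_, rfl⟩
  rw [hu, diagSU_coe]
  refine ⟨(if i = 0 then (u : ℂ) else ((u⁻¹ : Circle) : ℂ)) * c, ?_⟩
  ext k
  fin_cases i <;> fin_cases k <;> simp [Matrix.mulVec, dotProduct, Fin.sum_univ_two]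

theorem isTotallyReducible_diagRep (n : ℕ) (z w : Circle) :
    IsTotallyReducible (diagRep n z w) := by
  refine ⟨Submodule.span ℂ {Pi.single 0 1}, Submodule.span ℂ {Pi.single 1 1},
    isInvariant_span_single z w 0, isInvariant_span_single z w 1,
    finrank_span_singleton (by simp), finrank_span_singleton (by simp), ?_, ?_⟩
  · rw [Submodule.disjoint_def]
    intro v h0 h1
    obtain ⟨c, rfl⟩ := Submodule.mem_span_singleton.mp h0
    obtain ⟨d, hd⟩ := Submodule.mem_span_singleton.mp h1
    have := congrFun hd 0
    simp at this
    rw [← this, zero_smul]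
  · rw [codisjoint_iff, eq_top_iff]
    intro v _
    rw [Submodule.mem_sup]
    refine ⟨v 0 • Pi.single 0 1, Submodule.mem_span_singleton.mpr ⟨_, rfl⟩,
      v 1 • Pi.single 1 1, Submodule.mem_span_singleton.mpr ⟨_, rfl⟩, ?_⟩
    ext i
    fin_cases i <;> simp

theorem submodule_eq_top_of_single {W : Submodule ℂ (Fin 2 → ℂ)} (h0 : Pi.single 0 1 ∈ W)
    (h1 : Pi.single 1 1 ∈ W) : W = ⊤ := by
  rw [eq_top_iff]
  intro v _
  have : v = v 0 • (Pi.single 0 1 : Fin 2 → ℂ) + v 1 • (Pi.single 1 1 : Fin 2 → ℂ) := by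
    ext i
    fin_cases i <;> simp
  rw [this]
  exact W.add_mem (W.smul_mem _ h0) (W.smul_mem _ h1)

/-- The image of a has distinct eigenvalues, so a nonzero invariant subspace contains a coordinate
vector. The off-diagonal entries of b are nonzero, so it then contains the other one too. -/
theorem isIrred_discRep {n : ℕ} {q : Params n} (hz : (q.1.1 : ℂ).im ≠ 0)
    (hp : ‖(q.1.2 : ℂ)‖ < 1) : IsIrred (discRep q) := by
  intro W hW
  have hA := hW (genA n)
  have hB := hW (genB n)
  rw [discRep_genA, diagSU_coe] at hA
  rw [discRep_genB] at hB
  have hs : (discSU q.1.2).1 1 0 ≠ 0 := fun h => hp.ne (discSU_entry_eq_zero_iff.mp h)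
  have hs' : (discSU q.1.2).1 0 1 ≠ 0 := by
    rw [(su2_entries _).2]
    simpa using hs
  have hne : (q.1.1 : ℂ) - ((q.1.1⁻¹ : Circle) : ℂ) ≠ 0 := by
    intro h
    have h2 := congrArg Complex.im h
    rw [Circle.coe_inv_eq_conj] at h2
    simp only [Complex.sub_im, Complex.conj_im, Complex.zero_im] at h2
    exact hz (by linarith)
  have h01 : Pi.single 0 1 ∈ W → Pi.single 1 1 ∈ W := by
    intro h0
    have h := hB _ h0
    have e : ((discSU q.1.2).1).mulVec (Pi.single 0 1) -
        (discSU q.1.2).1 0 0 • (Pi.single 0 1 : Fin 2 → ℂ) =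
        (discSU q.1.2).1 1 0 • (Pi.single 1 1 : Fin 2 → ℂ) := by
      ext i
      fin_cases i <;> simp
    have h2 := W.sub_mem h (W.smul_mem ((discSU q.1.2).1 0 0) h0)
    rw [e] at h2
    exact (W.smul_mem_iff hs).mp h2
  have h10 : Pi.single 1 1 ∈ W → Pi.single 0 1 ∈ W := by
    intro h0
    have h := hB _ h0
    have e : ((discSU q.1.2).1).mulVec (Pi.single 1 1) -
        (discSU q.1.2).1 1 1 • (Pi.single 1 1 : Fin 2 → ℂ) =
        (discSU q.1.2).1 0 1 • (Pi.single 0 1 : Fin 2 → ℂ) := by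
      ext i
      fin_cases i <;> simp
    have h2 := W.sub_mem h (W.smul_mem ((discSU q.1.2).1 1 1) h0)
    rw [e] at h2
    exact (W.smul_mem_iff hs').mp h2
  by_cases hbot : W = ⊥
  · exact Or.inl hbot
  · right
    obtain ⟨v, hv, hv0⟩ := Submodule.exists_mem_ne_zero_of_ne_bot hbot
    by_cases h0 : v 0 = 0
    · have e : v = v 1 • (Pi.single 1 1 : Fin 2 → ℂ) := by
        ext i
        fin_cases i <;> simp [h0]
      have h1 : v 1 ≠ 0 := by
        intro h1
        rw [e, h1, zero_smul] at hv0
        exact hv0 rfl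
      rw [e] at hv
      have h11 := (W.smul_mem_iff h1).mp hv
      exact submodule_eq_top_of_single (h10 h11) h11
    · have e : (!![(q.1.1 : ℂ), 0; 0, ((q.1.1⁻¹ : Circle) : ℂ)]).mulVec v -
          ((q.1.1⁻¹ : Circle) : ℂ) • v =
          (((q.1.1 : ℂ) - ((q.1.1⁻¹ : Circle) : ℂ)) * v 0) • (Pi.single 0 1 : Fin 2 → ℂ) := by
        ext i
        fin_cases i
        · simp [dotProduct, Fin.sum_univ_two]
          ring
        · simp [dotProduct, Fin.sum_univ_two]
      have h2 := W.sub_mem (hA v hv) (W.smul_mem ((q.1.1⁻¹ : Circle) : ℂ) hv)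
      rw [e] at h2
      have h00 := (W.smul_mem_iff (mul_ne_zero hne h0)).mp h2
      exact submodule_eq_top_of_single h00 (h01 h00)

/-- A representation is conjugate to a diagonal one or to an irreducible one in normal form. -/
theorem diag_or_irred {n : ℕ} (ρ : LinkGroup n →* SU2) :
    (∃ z w : Circle, suClass ρ = suClass (diagRep n z w)) ∨
    (IsIrred ρ ∧ ∃ q : Params n, 0 < (q.1.1 : ℂ).im ∧ ‖(q.1.2 : ℂ)‖ < 1 ∧ q.1.1 ^ (2 * n) = 1 ∧
      suClass ρ = suClass (discRep q)) := by
  obtain ⟨q, ⟨h0, h1⟩, e⟩ := exists_normal_form ρ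
  by_cases hp : ‖(q.1.2 : ℂ)‖ = 1
  · left
    refine ⟨q.1.1, ⟨q.1.2, mem_sphere_zero_iff_norm.mpr hp⟩, ?_⟩
    rw [e]
    exact congrArg suClass (discRep_eq_diagRep rfl)
  · right
    have hz : (q.1.1 : ℂ).im ≠ 0 := fun h => hp (h1 h).1
    have hp' : ‖(q.1.2 : ℂ)‖ < 1 := lt_of_le_of_ne q.1.2.norm_le hp
    exact ⟨IsIrred.of_suClass_eq e (isIrred_discRep hz hp'), q, lt_of_le_of_ne h0 (Ne.symm hz), hp',
      q.2.resolve_left hp, e⟩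

theorem disjoint_loci {n : ℕ} {x : SUCharVar (LinkGroup n)}
    (h1 : x ∈ totallyReducibleLocus (LinkGroup n)) (h2 : x ∈ irreducibleLocus (LinkGroup n)) :
    False := by
  obtain ⟨ρ, hρ, rfl⟩ := h1
  obtain ⟨σ, hσ, h⟩ := h2
  exact hρ.not_isIrred (IsIrred.of_suClass_eq h.symm hσ)

theorem isCompl_loci (n : ℕ) :
    IsCompl (totallyReducibleLocus (LinkGroup n)) (irreducibleLocus (LinkGroup n)) := by
  refine ⟨Set.disjoint_left.mpr fun x => disjoint_loci,
    codisjoint_iff.mpr (Set.eq_univ_of_forall fun x => ?_)⟩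
  induction x using Quotient.ind with | _ ρ => ?_
  rcases diag_or_irred ρ with ⟨z, w, h⟩ | ⟨h, -⟩
  · exact Or.inl ⟨_, isTotallyReducible_diagRep n z w, h.symm⟩
  · exact Or.inr ⟨_, h, rfl⟩

/-! ### The totally reducible locus -/

theorem continuous_suClass_diagRep (n : ℕ) :
    Continuous fun a : Circle × Circle => suClass (diagRep n a.1 a.2) := by
  let f : Circle × Circle → Params n := fun a =>
    ⟨(a.1, ⟨a.2, by rw [mem_closedBall_zero_iff, Circle.norm_coe]⟩), Or.inl (Circle.norm_coe a.2)⟩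
  have hf : Continuous f := by
    refine Continuous.subtype_mk (continuous_fst.prodMk (Continuous.subtype_mk ?_ _)) _
    exact continuous_circle_coe.comp continuous_snd
  have h := (continuous_suClass_discRep n).comp hf
  convert h using 2 with a
  exact congrArg suClass (discRep_eq_diagRep (q := f a) rfl).symm

theorem totallyReducibleLocus_eq_range (n : ℕ) : totallyReducibleLocus (LinkGroup n) =
    Set.range fun a : Circle × Circle => suClass (diagRep n a.1 a.2) := by
  ext x
  constructor
  · rintro ⟨ρ, hρ, rfl⟩
    rcases diag_or_irred ρ with ⟨z, w, h⟩ | ⟨h, -⟩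
    · exact ⟨(z, w), h.symm⟩
    · exact absurd h hρ.not_isIrred
  · rintro ⟨a, rfl⟩
    exact ⟨_, isTotallyReducible_diagRep n a.1 a.2, rfl⟩

theorem isCompact_totallyReducibleLocus (n : ℕ) :
    IsCompact (totallyReducibleLocus (LinkGroup n)) := by
  rw [totallyReducibleLocus_eq_range]
  exact isCompact_range (continuous_suClass_diagRep n)

theorem suTraces_diagRep (n : ℕ) (z w : Circle) : suTraces n (suClass (diagRep n z w)) =
    ((z : ℂ).re, (w : ℂ).re, ((z * w : Circle) : ℂ).re) := by
  have h := suTraces_discRep (n := n) ⟨(z, ⟨w, by rw [mem_closedBall_zero_iff, Circle.norm_coe]⟩),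
    Or.inl (Circle.norm_coe w)⟩
  rw [discRep_eq_diagRep (w := w) rfl] at h
  rw [h]
  simp

theorem exists_circle_angles {v : ℝ × ℝ × ℝ} : v ∈ pillowSurface ↔
    ∃ z w : Circle, v = ((z : ℂ).re, (w : ℂ).re, ((z * w : Circle) : ℂ).re) := by
  constructor
  · intro hv
    obtain ⟨θ, φ, -, -, rfl⟩ := exists_angles_of_mem_pillowSurface hv
    refine ⟨Circle.exp θ, Circle.exp φ, ?_⟩
    rw [← Circle.exp_add]
    simp only [circle_exp_re_im]
  · rintro ⟨z, w, rfl⟩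
    rw [← Circle.exp_arg z, ← Circle.exp_arg w, ← Circle.exp_add]
    simp only [circle_exp_re_im]
    exact cos_mem_pillowSurface _ _

/-- The totally reducible locus is homeomorphic to its model. -/
def totallyReducibleHomeo (n : ℕ) : totallyReducibleLocus (LinkGroup n) ≃ₜ pillowSurface :=
  haveI : CompactSpace (totallyReducibleLocus (LinkGroup n)) :=
    isCompact_iff_compactSpace.mp (isCompact_totallyReducibleLocus n)
  Continuous.homeoOfEquivCompactToT2
    (f := Equiv.ofBijective (fun x : totallyReducibleLocus (LinkGroup n) =>
        (⟨suTraces n x, by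
          obtain ⟨x, hx⟩ := x
          rw [totallyReducibleLocus_eq_range] at hx
          obtain ⟨a, rfl⟩ := hx
          exact exists_circle_angles.mpr ⟨a.1, a.2, suTraces_diagRep n a.1 a.2⟩⟩ : pillowSurface))
      ⟨fun x y h => Subtype.ext (suTraces_injective n (congrArg Subtype.val h)), fun v => by
        obtain ⟨z, w, h⟩ := exists_circle_angles.mp v.2
        exact ⟨⟨_, _, isTotallyReducible_diagRep n z w, rfl⟩,
          Subtype.ext ((suTraces_diagRep n z w).trans h.symm)⟩⟩)
    (((continuous_suTraces n).comp continuous_subtype_val).subtype_mk _)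

/-- The half traces of the diagonal representation defined by a point of the pillowcase. -/
def pillowTraces : Sym2 (Circle × Circle) → ℝ × ℝ × ℝ :=
  -- Averaging makes the formula symmetric. On the pillowcase the two points are inverse to each
  -- other, so the averaged terms are equal.
  Sym2.lift ⟨fun a b => ((((a.1 : ℂ).re + (b.1 : ℂ).re) / 2), (((a.2 : ℂ).re + (b.2 : ℂ).re) / 2),
    ((((a.1 * a.2 : Circle) : ℂ).re + ((b.1 * b.2 : Circle) : ℂ).re) / 2)), fun a b => by
      simp only [add_comm]⟩

theorem continuous_circle_re : Continuous fun z : Circle => (z : ℂ).re :=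
  Complex.continuous_re.comp continuous_circle_coe

theorem continuous_pillowTraces : Continuous pillowTraces := by
  refine continuous_coinduced_dom.mpr ?_
  have h := continuous_circle_re
  change Continuous fun p : (Circle × Circle) × (Circle × Circle) =>
    ((((p.1.1 : ℂ).re + (p.2.1 : ℂ).re) / 2), (((p.1.2 : ℂ).re + (p.2.2 : ℂ).re) / 2),
    ((((p.1.1 * p.1.2 : Circle) : ℂ).re + ((p.2.1 * p.2.2 : Circle) : ℂ).re) / 2))
  refine Continuous.prodMk ?_ (Continuous.prodMk ?_ ?_)
  · exact ((h.comp (by fun_prop)).add (h.comp (by fun_prop))).div_const 2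
  · exact ((h.comp (by fun_prop)).add (h.comp (by fun_prop))).div_const 2
  · exact ((h.comp (f := fun p : (Circle × Circle) × (Circle × Circle) => p.1.1 * p.1.2)
      (by fun_prop)).add (h.comp (f := fun p : (Circle × Circle) × (Circle × Circle) =>
        p.2.1 * p.2.2) (by fun_prop))).div_const 2

theorem circle_inv_re (z : Circle) : ((z⁻¹ : Circle) : ℂ).re = (z : ℂ).re := by
  rw [Circle.coe_inv_eq_conj, Complex.conj_re]

theorem pillowTraces_pillowPoint (z w : Circle) : pillowTraces (pillowPoint z w).1 =
    ((z : ℂ).re, (w : ℂ).re, ((z * w : Circle) : ℂ).re) := by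
  change ((((z : ℂ).re + ((z⁻¹ : Circle) : ℂ).re) / 2), (((w : ℂ).re + ((w⁻¹ : Circle) : ℂ).re) / 2),
    ((((z * w : Circle) : ℂ).re + ((z⁻¹ * w⁻¹ : Circle) : ℂ).re) / 2)) = _
  rw [← mul_inv, circle_inv_re, circle_inv_re, circle_inv_re]
  simp

theorem pillowPoint_surjective (p : Pillowcase) : ∃ z w, pillowPoint z w = p := by
  obtain ⟨p, z₁, w₁, z₂, w₂, rfl, hz, hw⟩ := p
  obtain rfl := eq_inv_of_mul_eq_one_right hz
  obtain rfl := eq_inv_of_mul_eq_one_right hw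
  exact ⟨z₁, w₁, rfl⟩

theorem pillowPoint_inv (z w : Circle) : pillowPoint z⁻¹ w⁻¹ = pillowPoint z w := by
  apply Subtype.ext
  change s((z⁻¹, w⁻¹), (z⁻¹⁻¹, w⁻¹⁻¹)) = s((z, w), (z⁻¹, w⁻¹))
  rw [inv_inv, inv_inv, Sym2.eq_swap]

theorem circle_eq_or_eq_inv {z w : Circle} (h : (z : ℂ).re = (w : ℂ).re) : z = w ∨ z = w⁻¹ := by
  have h1 := circle_re_im z
  have h2 := circle_re_im w
  have h3 : (z : ℂ).im ^ 2 = (w : ℂ).im ^ 2 := by rw [h] at h1; linarith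
  rcases sq_eq_sq_iff_eq_or_eq_neg.mp h3 with h4 | h4
  · exact Or.inl (Circle.ext (Complex.ext h h4))
  · refine Or.inr (Circle.ext ?_)
    rw [Circle.coe_inv_eq_conj]
    exact Complex.ext h h4

/-- Equal real parts mean equal up to inversion. After inverting both coordinates of one point, z =
z'. If then w = w'⁻¹, the third coordinate forces Im z · Im w' = 0, so z or w' is its own inverse
and the unordered pairs agree. -/
theorem pillowTraces_injective : Function.Injective fun p : Pillowcase => pillowTraces p.1 := by
  intro p p' h
  obtain ⟨z, w, rfl⟩ := pillowPoint_surjective p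
  obtain ⟨z', w', rfl⟩ := pillowPoint_surjective p'
  simp only [pillowTraces_pillowPoint, Prod.mk.injEq] at h
  obtain ⟨h1, h2, h3⟩ := h
  wlog hz : z = z' generalizing z' w'
  · have hz' : z = z'⁻¹ := (circle_eq_or_eq_inv h1).resolve_left hz
    rw [← pillowPoint_inv z' w']
    refine this z'⁻¹ w'⁻¹ (by rw [circle_inv_re, h1]) (by rw [circle_inv_re, h2]) ?_ hz'
    rw [← mul_inv, circle_inv_re, h3]
  subst hz
  rcases circle_eq_or_eq_inv h2 with rfl | rfl
  · rfl
  · have h4 : (z : ℂ).im * (w' : ℂ).im = 0 := by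
      rw [Circle.coe_mul, Circle.coe_mul, Circle.coe_inv_eq_conj] at h3
      simp only [Complex.mul_re, Complex.conj_re, Complex.conj_im] at h3
      linarith
    have key : ∀ u : Circle, (u : ℂ).im = 0 → u⁻¹ = u := by
      intro u hu
      apply Circle.ext
      rw [Circle.coe_inv_eq_conj]
      exact Complex.conj_eq_iff_im.mpr hu
    rcases mul_eq_zero.mp h4 with h5 | h5
    · conv_lhs => rw [← key z h5]
      exact pillowPoint_inv z w'
    · rw [key w' h5]

theorem continuous_pillowPoint : Continuous fun a : Circle × Circle => pillowPoint a.1 a.2 := by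
  refine Continuous.subtype_mk (f := fun a : Circle × Circle => s((a.1, a.2), (a.1⁻¹, a.2⁻¹))) ?_ _
  have h : Continuous fun p : (Circle × Circle) × (Circle × Circle) => s(p.1, p.2) :=
    continuous_coinduced_rng
  exact h.comp (f := fun a : Circle × Circle => (((a.1, a.2), (a.1⁻¹, a.2⁻¹)) :
    (Circle × Circle) × (Circle × Circle))) (by fun_prop)

instance : CompactSpace Pillowcase :=
  have h : Function.Surjective fun a : Circle × Circle => pillowPoint a.1 a.2 := fun p => by
    obtain ⟨z, w, h⟩ := pillowPoint_surjective p
    exact ⟨(z, w), h⟩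
  h.compactSpace continuous_pillowPoint

theorem pillowTraces_mem (p : Pillowcase) : pillowTraces p.1 ∈ pillowSurface := by
  obtain ⟨z, w, rfl⟩ := pillowPoint_surjective p
  exact exists_circle_angles.mpr ⟨z, w, pillowTraces_pillowPoint z w⟩

/-- The pillowcase is homeomorphic to its model. -/
def pillowcaseHomeo : Pillowcase ≃ₜ pillowSurface :=
  Continuous.homeoOfEquivCompactToT2
    (f := Equiv.ofBijective (fun p : Pillowcase => (⟨pillowTraces p.1, pillowTraces_mem p⟩ : pillowSurface))
      ⟨fun x y h => pillowTraces_injective (congrArg Subtype.val h), fun v => by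
        obtain ⟨z, w, h⟩ := exists_circle_angles.mp v.2
        exact ⟨pillowPoint z w, Subtype.ext ((pillowTraces_pillowPoint z w).trans h.symm)⟩⟩)
    ((continuous_pillowTraces.comp continuous_subtype_val).subtype_mk _)

theorem exists_pillowcase_homeo (n : ℕ) : ∃ e : Pillowcase ≃ₜ totallyReducibleLocus (LinkGroup n),
      ∀ z w : Circle, (e (pillowPoint z w) : SUCharVar (LinkGroup n)) =
        suClass (diagRep n z w) := by
  refine ⟨pillowcaseHomeo.trans (totallyReducibleHomeo n).symm, fun z w => ?_⟩
  have h : pillowcaseHomeo (pillowPoint z w) = totallyReducibleHomeo n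
      ⟨suClass (diagRep n z w), _, isTotallyReducible_diagRep n z w, rfl⟩ :=
    Subtype.ext ((pillowTraces_pillowPoint z w).trans (suTraces_diagRep n z w).symm)
  rw [Homeomorph.trans_apply, h, Homeomorph.symm_apply_apply]

/-! ### The attached discs -/

/-- The roots of unity of order dividing `2n` in the upper half circle. -/
def upperRoot (n : ℕ) (k : Fin (n - 1)) : Circle := Circle.exp (Real.pi * ((k + 1 : ℕ) : ℝ) / n)

theorem range_upperRoot {n : ℕ} (hn : 1 ≤ n) :
    Set.range (upperRoot n) = {z : Circle | z ^ (2 * n) = 1 ∧ 0 < (z : ℂ).im} := by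
  ext z
  rw [Set.mem_ofPred_eq, upper_root_iff hn]
  constructor
  · rintro ⟨k, rfl⟩
    exact ⟨k + 1, by omega, by have := k.2; omega, rfl⟩
  · rintro ⟨j, h0, h1, rfl⟩
    refine ⟨⟨j - 1, by omega⟩, ?_⟩
    simp only [upperRoot]
    rw [Nat.sub_add_cancel h0]

theorem upperRoot_spec {n : ℕ} (hn : 1 ≤ n) (k : Fin (n - 1)) :
    upperRoot n k ^ (2 * n) = 1 ∧ 0 < (upperRoot n k : ℂ).im := by
  have : upperRoot n k ∈ Set.range (upperRoot n) := ⟨k, rfl⟩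
  rwa [range_upperRoot hn] at this

theorem upperRoot_injective {n : ℕ} (hn : 1 ≤ n) : Function.Injective (upperRoot n) := by
  intro j k h
  have h1 := congrArg (fun z : Circle => (z : ℂ).re) h
  simp only [upperRoot, circle_exp_re_im] at h1
  have hn0 : (0 : ℝ) < n := by exact_mod_cast hn
  have h2 := Real.injOn_cos (angle_index_mem (by have := j.2; omega) hn)
    (angle_index_mem (by have := k.2; omega) hn) h1
  rw [div_left_inj' hn0.ne', mul_right_inj' Real.pi_pos.ne', Nat.cast_inj] at h2
  exact Fin.ext (by omega)

/-- The characteristic map of the `k`-th disc. -/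
def discMap {n : ℕ} (hn : 1 ≤ n) (k : Fin (n - 1)) (p : ClosedDisc) : SUCharVar (LinkGroup n) :=
  suClass (discRep ⟨(upperRoot n k, p), Or.inr (upperRoot_spec hn k).1⟩)

theorem discMap_boundary {n : ℕ} (hn : 1 ≤ n) (k : Fin (n - 1)) {p : ClosedDisc} {w : Circle}
    (h : (p : ℂ) = w) : discMap hn k p = suClass (diagRep n (upperRoot n k) w) :=
  congrArg suClass (discRep_eq_diagRep (q := ⟨(upperRoot n k, p), _⟩) h)

theorem isNormal_upperRoot {n : ℕ} (hn : 1 ≤ n) (k : Fin (n - 1)) (p : ClosedDisc) :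
    IsNormal (upperRoot n k) p :=
  ⟨(upperRoot_spec hn k).2.le, fun h => absurd h (upperRoot_spec hn k).2.ne'⟩

theorem discMap_injective {n : ℕ} (hn : 1 ≤ n) {j k : Fin (n - 1)} {p q : ClosedDisc}
    (h : discMap hn j p = discMap hn k q) : j = k ∧ p = q := by
  have h1 := normal_params_unique (q := ⟨(upperRoot n j, p), Or.inr (upperRoot_spec hn j).1⟩)
    (q' := ⟨(upperRoot n k, q), Or.inr (upperRoot_spec hn k).1⟩) (isNormal_upperRoot hn j p)
    (isNormal_upperRoot hn k q) (congrArg (suTraces n) h)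
  have h2 := congrArg Subtype.val h1
  simp only [Prod.mk.injEq] at h2
  exact ⟨upperRoot_injective hn h2.1, h2.2⟩

theorem isIrred_discMap {n : ℕ} (hn : 1 ≤ n) (k : Fin (n - 1)) {p : ClosedDisc}
    (hp : ‖(p : ℂ)‖ < 1) :
    IsIrred (discRep (n := n) ⟨(upperRoot n k, p), Or.inr (upperRoot_spec hn k).1⟩) :=
  isIrred_discRep (upperRoot_spec hn k).2.ne' hp

/-- The quotient topology comes for free, as the totally reducible locus and the finitely many discs
are compact and the character variety is Hausdorff. Injectivity holds on the closed discs: the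
eigenvalue has positive imaginary part, so every p is a normal form. -/
theorem isDiscAttachment_discMap {n : ℕ} (hn : 1 ≤ n) :
    IsDiscAttachment (totallyReducibleLocus (LinkGroup n)) (discMap hn) := by
  have hcont : ∀ k, Continuous (discMap hn k) := fun k =>
    (continuous_suClass_discRep n).comp (f := fun p : ClosedDisc => (⟨(upperRoot n k, p),
      Or.inr (upperRoot_spec hn k).1⟩ : Params n)) (by fun_prop)
  refine ⟨hcont, ?_, ?_, fun _ _ _ _ _ _ h => discMap_injective hn h, ?_⟩
  · intro k p hp
    rw [discMap_boundary hn k (w := ⟨p, mem_sphere_zero_iff_norm.mpr hp⟩) rfl]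
    exact ⟨_, isTotallyReducible_diagRep n _ _, rfl⟩
  · intro k p hp h
    exact disjoint_loci h ⟨_, isIrred_discMap hn k hp, rfl⟩
  · have : CompactSpace (totallyReducibleLocus (LinkGroup n)) :=
      isCompact_iff_compactSpace.mp (isCompact_totallyReducibleLocus n)
    refine IsQuotientMap.of_surjective_continuous ?_
      (continuous_subtype_val.sumElim (continuous_sigma hcont))
    intro x
    induction x using Quotient.ind with | _ ρ => ?_
    rcases diag_or_irred ρ with ⟨z, w, h⟩ | ⟨-, ⟨⟨z, p⟩, hq⟩, h0, hp, hz, e⟩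
    · exact ⟨Sum.inl ⟨_, _, isTotallyReducible_diagRep n z w, rfl⟩, h.symm⟩
    · have hz' : z ∈ Set.range (upperRoot n) := by rw [range_upperRoot hn]; exact ⟨hz, h0⟩
      obtain ⟨k, rfl⟩ := hz'
      exact ⟨Sum.inr ⟨k, p⟩, e.symm⟩

/-- The eigenvalue satisfies z² − Tz + 1 = 0 with T the trace, and z⁻¹ is the conjugate of z, so T =
2 Re z. -/
theorem re_eq_of_hasEigenvalue {A : SU2} {z : Circle}
    (h : Module.End.HasEigenvalue (Matrix.toLin' A.1) (z : ℂ)) : (z : ℂ).re = halfTraceSU A := by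
  obtain ⟨v, hv⟩ := h.exists_hasEigenvector
  have hv1 : A.1.mulVec v = (z : ℂ) • v := hv.apply_eq_smul
  have hv0 : v ≠ 0 := hv.2
  have hdet := (Matrix.mem_specialUnitaryGroup_iff.mp A.2).2
  rw [Matrix.det_fin_two] at hdet
  have e0 := congrFun hv1 0
  have e1 := congrFun hv1 1
  simp only [Matrix.mulVec, dotProduct, Fin.sum_univ_two, Pi.smul_apply, smul_eq_mul] at e0 e1
  have hchar : (z : ℂ) ^ 2 - (A.1 0 0 + A.1 1 1) * z + 1 = 0 := by
    have h0 : ((z : ℂ) ^ 2 - (A.1 0 0 + A.1 1 1) * z + 1) * v 0 = 0 := by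
      linear_combination (A.1 1 1 - z) * e0 - A.1 0 1 * e1 - v 0 * hdet
    have h1 : ((z : ℂ) ^ 2 - (A.1 0 0 + A.1 1 1) * z + 1) * v 1 = 0 := by
      linear_combination (A.1 0 0 - z) * e1 - A.1 1 0 * e0 - v 1 * hdet
    by_contra hne
    apply hv0
    ext i
    fin_cases i
    · exact (mul_eq_zero.mp h0).resolve_left hne
    · exact (mul_eq_zero.mp h1).resolve_left hne
  have hzz := conj_mul_self_circle z
  have h2 : (z : ℂ) + (starRingEnd ℂ) (z : ℂ) = A.1 0 0 + A.1 1 1 := by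
    apply mul_right_cancel₀ z.coe_ne_zero
    linear_combination hchar + hzz
  rw [halfTraceSU, Matrix.trace_fin_two, ← h2, Complex.add_conj]
  simp

theorem discMap_image {n : ℕ} (hn : 1 ≤ n) (k : Fin (n - 1)) :
    discMap hn k '' {z | ‖(z : ℂ)‖ < 1} =
        {x | ∃ ρ : LinkGroup n →* SU2, IsIrred ρ ∧ suClass ρ = x ∧
          Module.End.HasEigenvalue
            (Matrix.toLin' (ρ (genA n) : Matrix (Fin 2) (Fin 2) ℂ)) (upperRoot n k : ℂ)} := by
  ext x
  constructor
  · rintro ⟨p, hp, rfl⟩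
    refine ⟨_, isIrred_discMap hn k hp, rfl, ?_⟩
    rw [discRep_genA]
    refine Module.End.hasEigenvalue_of_hasEigenvector (x := Pi.single 0 1) ⟨?_, by simp⟩
    rw [Module.End.mem_eigenspace_iff, Matrix.toLin'_apply, diagSU_coe]
    ext i
    fin_cases i <;> simp
  · rintro ⟨ρ, hρ, rfl, hev⟩
    rcases diag_or_irred ρ with ⟨z, w, h⟩ | ⟨-, ⟨⟨z, p⟩, hq⟩, h0, hp, hz, e⟩
    · exact absurd hρ (fun h' => (isTotallyReducible_diagRep n z w).not_isIrred
        (IsIrred.of_suClass_eq h.symm h'))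
    · have hre : (z : ℂ).re = (upperRoot n k : ℂ).re := by
        have h1 := congrArg Prod.fst (congrArg (suTraces n) e)
        rw [suTraces_discRep] at h1
        rw [re_eq_of_hasEigenvalue hev]
        exact h1.symm
      have him : (z : ℂ).im = (upperRoot n k : ℂ).im := by
        have c1 := circle_re_im z
        have c2 := circle_re_im (upperRoot n k)
        rw [hre] at c1
        exact (pow_left_inj₀ h0.le (upperRoot_spec hn k).2.le two_ne_zero).mp (by linarith)
      have hzk : z = upperRoot n k := Circle.ext (Complex.ext hre him)
      subst hzk
      exact ⟨p, hp, e.symm⟩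

/-! ### Elements of `SL(2, ℂ)` -/

/-- A matrix in `SL(2, ℂ)` given by its entries. -/
def slMat (a b c d : ℂ) (h : a * d - b * c = 1) : SL2C :=
  ⟨!![a, b; c, d], by rw [Matrix.det_fin_two_of]; exact h⟩

theorem slMat_entries {a b c d : ℂ} (h : a * d - b * c = 1) :
    (slMat a b c d h).1 0 0 = a ∧ (slMat a b c d h).1 0 1 = b ∧ (slMat a b c d h).1 1 0 = c ∧
      (slMat a b c d h).1 1 1 = d := ⟨rfl, rfl, rfl, rfl⟩

theorem sl_ext {A B : SL2C} (h00 : A.1 0 0 = B.1 0 0) (h01 : A.1 0 1 = B.1 0 1)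
    (h10 : A.1 1 0 = B.1 1 0) (h11 : A.1 1 1 = B.1 1 1) : A = B := by
  apply Subtype.ext
  ext i j
  fin_cases i <;> fin_cases j
  · exact h00
  · exact h01
  · exact h10
  · exact h11

theorem sl_mul_entry (A B : SL2C) (i j : Fin 2) :
    (A * B).1 i j = A.1 i 0 * B.1 0 j + A.1 i 1 * B.1 1 j := by
  change (A.1 * B.1) i j = _
  rw [Matrix.mul_apply, Fin.sum_univ_two]

theorem sl_inv_entries (A : SL2C) : A⁻¹.1 0 0 = A.1 1 1 ∧ A⁻¹.1 0 1 = -A.1 0 1 ∧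
    A⁻¹.1 1 0 = -A.1 1 0 ∧ A⁻¹.1 1 1 = A.1 0 0 := by
  have h : A⁻¹.1 = Matrix.adjugate A.1 := rfl
  rw [h, Matrix.adjugate_fin_two]
  exact ⟨rfl, rfl, rfl, rfl⟩

theorem sl_det (A : SL2C) : A.1 0 0 * A.1 1 1 - A.1 0 1 * A.1 1 0 = 1 := by
  rw [← Matrix.det_fin_two]; exact A.2

/-- `u ↦ diag(u, u⁻¹)`. -/
def slDiag : ℂˣ →* SL2C where
  toFun u := slMat u 0 0 (u⁻¹ : ℂˣ) (by simp)
  map_one' := by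
    apply sl_ext <;> simp [slMat]
  map_mul' u v := by
    apply sl_ext <;> rw [sl_mul_entry] <;> simp [slMat, mul_comm]

theorem slDiag_entries (u : ℂˣ) : (slDiag u).1 0 0 = u ∧ (slDiag u).1 0 1 = 0 ∧
    (slDiag u).1 1 0 = 0 ∧ (slDiag u).1 1 1 = (u⁻¹ : ℂˣ) := ⟨rfl, rfl, rfl, rfl⟩

theorem slDiag_conj_entries (u : ℂˣ) (A : SL2C) :
    (slDiag u * A * (slDiag u)⁻¹).1 0 0 = A.1 0 0 ∧
    (slDiag u * A * (slDiag u)⁻¹).1 0 1 = (u : ℂ) ^ 2 * A.1 0 1 ∧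
    (slDiag u * A * (slDiag u)⁻¹).1 1 0 = ((u⁻¹ : ℂˣ) : ℂ) ^ 2 * A.1 1 0 ∧
    (slDiag u * A * (slDiag u)⁻¹).1 1 1 = A.1 1 1 := by
  obtain ⟨d0, d1, d2, d3⟩ := slDiag_entries u
  rw [← map_inv]
  obtain ⟨e0, e1, e2, e3⟩ := slDiag_entries u⁻¹
  have hu : (u : ℂ) * ((u⁻¹ : ℂˣ) : ℂ) = 1 := u.mul_inv
  simp only [sl_mul_entry, d0, d1, d2, d3, e0, e1, e2, e3, inv_inv]
  refine ⟨?_, ?_, ?_, ?_⟩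
  · linear_combination A.1 0 0 * hu
  · ring
  · ring
  · linear_combination A.1 1 1 * hu

theorem slDiag_comm_iff {u : ℂˣ} {A : SL2C} : slDiag u * A = A * slDiag u ↔
    (A.1 0 1 = 0 ∧ A.1 1 0 = 0) ∨ u ^ 2 = 1 := by
  obtain ⟨d0, d1, d2, d3⟩ := slDiag_entries u
  have hu : (u : ℂ) * ((u⁻¹ : ℂˣ) : ℂ) = 1 := u.mul_inv
  have h2 : u ^ 2 = 1 ↔ (u : ℂ) = ((u⁻¹ : ℂˣ) : ℂ) := by
    rw [Units.val_inj, sq, mul_eq_one_iff_eq_inv]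
  rw [h2]
  constructor
  · intro h
    by_cases hne : (u : ℂ) = ((u⁻¹ : ℂˣ) : ℂ)
    · exact Or.inr hne
    · left
      have e01 := congrArg (fun B : SL2C => B.1 0 1) h
      have e10 := congrArg (fun B : SL2C => B.1 1 0) h
      simp only [sl_mul_entry, d0, d1, d2, d3] at e01 e10
      have hne' := sub_ne_zero.mpr hne
      constructor
      · apply mul_left_cancel₀ hne'
        linear_combination e01
      · apply mul_left_cancel₀ hne'
        linear_combination -e10
  · rintro (⟨h1, h3⟩ | h)
    · apply sl_ext <;> simp only [sl_mul_entry, d0, d1, d2, d3, h1, h3] <;> ring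
    · apply sl_ext <;> simp only [sl_mul_entry, d0, d1, d2, d3, ← h] <;> ring

/-- The Weyl element of `SL(2, ℂ)`. -/
def weylSL : SL2C := slMat 0 (-1) 1 0 (by norm_num)

theorem weyl_conj_entries (A : SL2C) :
    (weylSL * A * weylSL⁻¹).1 0 0 = A.1 1 1 ∧ (weylSL * A * weylSL⁻¹).1 0 1 = -A.1 1 0 ∧
    (weylSL * A * weylSL⁻¹).1 1 0 = -A.1 0 1 ∧ (weylSL * A * weylSL⁻¹).1 1 1 = A.1 0 0 := by
  obtain ⟨d0, d1, d2, d3⟩ := slMat_entries (a := 0) (b := -1) (c := 1) (d := 0) (by norm_num)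
  obtain ⟨e0, e1, e2, e3⟩ := sl_inv_entries weylSL
  change weylSL.1 0 0 = 0 at d0
  change weylSL.1 0 1 = -1 at d1
  change weylSL.1 1 0 = 1 at d2
  change weylSL.1 1 1 = 0 at d3
  simp only [sl_mul_entry, d0, d1, d2, d3, e0, e1, e2, e3]
  refine ⟨?_, ?_, ?_, ?_⟩ <;> ring

/-- Every matrix in `SL(2, ℂ)` is conjugate to an upper triangular one with a prescribed eigenvalue
in the first place. -/
theorem exists_conj_upper {A : SL2C} {α : ℂ} (hα : α ^ 2 - (A.1 0 0 + A.1 1 1) * α + 1 = 0) :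
    ∃ g : SL2C, (g * A * g⁻¹).1 1 0 = 0 ∧ (g * A * g⁻¹).1 0 0 = α := by
  have hdet := sl_det A
  obtain ⟨v, hv0, hv⟩ : ∃ v : Fin 2 → ℂ, v ≠ 0 ∧ (A.1 - Matrix.scalar (Fin 2) α).mulVec v = 0 := by
    rw [Matrix.exists_mulVec_eq_zero_iff, Matrix.det_fin_two]
    simp
    linear_combination hα + hdet
  have e0 := congrFun hv 0
  have e1 := congrFun hv 1
  simp [Matrix.mulVec, dotProduct, Fin.sum_univ_two] at e0 e1
  -- Complete the eigenvector to a matrix of determinant 1 having it as first column.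
  obtain ⟨g, hg0, hg1⟩ : ∃ g : SL2C, g.1 0 0 = v 0 ∧ g.1 1 0 = v 1 := by
    by_cases h : v 0 = 0
    · have h1 : v 1 ≠ 0 := by
        intro h1
        apply hv0
        ext i
        fin_cases i
        · exact h
        · exact h1
      exact ⟨slMat (v 0) (-(v 1)⁻¹) (v 1) 0 (by simp [h1]), rfl, rfl⟩
    · exact ⟨slMat (v 0) 0 (v 1) (v 0)⁻¹ (by simp [h]), rfl, rfl⟩
  have hgdet := sl_det g
  obtain ⟨i0, i1, i2, i3⟩ := sl_inv_entries g
  refine ⟨g⁻¹, ?_, ?_⟩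
  · rw [inv_inv]
    simp only [sl_mul_entry, i2, i3, hg0, hg1]
    linear_combination v 0 * e1 - v 1 * e0
  · rw [inv_inv]
    simp only [sl_mul_entry, i0, i1, hg0, hg1]
    rw [hg0, hg1] at hgdet
    linear_combination g.1 1 1 * e0 - g.1 0 1 * e1 + α * hgdet

/-! ### Representations in `SL(2, ℂ)` -/

/-- The representation `a ↦ diag(u, u⁻¹)`, `b ↦ diag(v, v⁻¹)`. -/
def torusRep (n : ℕ) (u v : ℂˣ) : LinkGroup n →* SL2C :=
  slDiag.comp (homOfPair n u v (mul_comm _ _))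

theorem torusRep_gen (n : ℕ) (u v : ℂˣ) :
    torusRep n u v (genA n) = slDiag u ∧ torusRep n u v (genB n) = slDiag v := by
  simp [torusRep, homOfPair_genA, homOfPair_genB]

/-- The root of unity `exp (π i j / n)`, as a unit. -/
def sliceRoot (n j : ℕ) : ℂˣ := Circle.toUnits (Circle.exp (Real.pi * j / n))

theorem sliceRoot_coe (n j : ℕ) :
    (sliceRoot n j : ℂ) = Real.cos (Real.pi * j / n) + Complex.I * Real.sin (Real.pi * j / n) ∧
    ((sliceRoot n j)⁻¹ : ℂˣ) =
      (Real.cos (Real.pi * j / n) - Complex.I * Real.sin (Real.pi * j / n) : ℂ) := by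
  have h : (Circle.exp (Real.pi * j / n) : ℂ) =
      Real.cos (Real.pi * j / n) + Complex.I * Real.sin (Real.pi * j / n) := by
    apply Complex.ext
    · rw [(circle_exp_re_im _).1]; simp [-Complex.ofReal_cos, -Complex.ofReal_sin]
    · rw [(circle_exp_re_im _).2]; simp [-Complex.ofReal_cos, -Complex.ofReal_sin]
  constructor
  · exact h
  · rw [sliceRoot, ← map_inv]
    change ((Circle.exp (Real.pi * j / n))⁻¹ : Circle) = (_ : ℂ)
    rw [Circle.coe_inv_eq_conj, h]
    apply Complex.ext <;> simp [-Complex.ofReal_cos, -Complex.ofReal_sin]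

theorem sliceRoot_pow {n j : ℕ} (hn : 0 < n) : sliceRoot n j ^ (2 * n) = 1 := by
  rw [sliceRoot, ← map_pow, exp_index_pow hn, map_one]

/-- The image of `b` under the representation `sliceRep`. -/
def sliceMat (y d : ℂ) : SL2C := slMat (y + d) (y ^ 2 - d ^ 2 - 1) 1 (y - d) (by ring)

/-- A representation for which the image of `aⁿ` is central. -/
def sliceRep {n : ℕ} (hn : 0 < n) (j : ℕ) (y d : ℂ) : LinkGroup n →* SL2C :=
  homOfPair n (slDiag (sliceRoot n j)) (sliceMat y d) (by
    rw [← map_pow]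
    exact slDiag_comm_iff.mpr (Or.inr (by rw [← pow_mul, mul_comm, sliceRoot_pow hn])))

theorem sliceRep_gen {n : ℕ} (hn : 0 < n) (j : ℕ) (y d : ℂ) :
    sliceRep hn j y d (genA n) = slDiag (sliceRoot n j) ∧
    sliceRep hn j y d (genB n) = sliceMat y d :=
  ⟨homOfPair_genA _ _ _ _, homOfPair_genB _ _ _ _⟩

/-- For equal diagonal entries α and upper right entry s, the power Aⁿ has upper right entry nαⁿ⁻¹s,
stated here multiplied by α. It is nonzero when s is, so only triangular matrices commute with Aⁿ.
-/
theorem upper_pow {A : SL2C} (h : A.1 1 0 = 0) (hα : A.1 0 0 = A.1 1 1) (n : ℕ) :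
    (A ^ n).1 1 0 = 0 ∧ (A ^ n).1 0 0 = (A ^ n).1 1 1 ∧
      (A ^ n).1 0 1 * A.1 0 0 = n * A.1 0 0 ^ n * A.1 0 1 ∧ (A ^ n).1 0 0 = A.1 0 0 ^ n := by
  induction n with
  | zero => simp
  | succ n ih =>
    obtain ⟨h1, h2, h3, h4⟩ := ih
    rw [pow_succ]
    simp only [sl_mul_entry, h, h1]
    rw [← hα, ← h2, h4]
    refine ⟨by ring, by ring, ?_, by ring⟩
    push_cast
    linear_combination A.1 0 0 * h3

/-- Every representation is conjugate to an upper triangular one or to one of the representations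
`sliceRep`. -/
theorem upper_or_slice {n : ℕ} (hn : 0 < n) (ρ : LinkGroup n →* SL2C) :
    ∃ g : SL2C, ((g * ρ (genA n) * g⁻¹).1 1 0 = 0 ∧ (g * ρ (genB n) * g⁻¹).1 1 0 = 0) ∨
      ∃ (j : ℕ) (y d : ℂ), 0 < j ∧ j < n ∧ g * ρ (genA n) * g⁻¹ = slDiag (sliceRoot n j) ∧
        g * ρ (genB n) * g⁻¹ = sliceMat y d := by
  have hcomm : ∀ g : SL2C, (g * ρ (genA n) * g⁻¹) ^ n * (g * ρ (genB n) * g⁻¹) =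
      (g * ρ (genB n) * g⁻¹) * (g * ρ (genA n) * g⁻¹) ^ n := by
    intro g
    rw [conj_pow]
    calc _ = g * (ρ (genA n) ^ n * ρ (genB n)) * g⁻¹ := by group
      _ = _ := by rw [rep_pow_comm]; group
  -- an eigenvalue in the closed upper half plane
  obtain ⟨α, hα, him⟩ : ∃ α : ℂ, α ^ 2 - ((ρ (genA n)).1 0 0 + (ρ (genA n)).1 1 1) * α + 1 = 0 ∧
      0 ≤ α.im := by
    set T := (ρ (genA n)).1 0 0 + (ρ (genA n)).1 1 1
    obtain ⟨w, hw⟩ := IsAlgClosed.exists_pow_nat_eq (T ^ 2 / 4 - 1) (zero_lt_two)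
    have h1 : (T / 2 + w) ^ 2 - T * (T / 2 + w) + 1 = 0 := by linear_combination hw
    generalize T / 2 + w = r at h1
    -- The roots are r and r⁻¹, with imaginary parts of opposite sign. Choosing the upper one makes
    -- the slice index j satisfy 0 < j < n.
    rcases le_total 0 r.im with h | h
    · exact ⟨_, h1, h⟩
    · have hne : r ≠ 0 := by
        intro h0
        rw [h0] at h1
        norm_num at h1
      refine ⟨r⁻¹, ?_, ?_⟩
      · have h2 : (r⁻¹) ^ 2 * (r ^ 2 - T * r + 1) = 0 := by
          rw [h1, mul_zero]
        rw [← h2]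
        field_simp
        ring
      · rw [Complex.inv_im]
        exact div_nonneg (by linarith) (Complex.normSq_nonneg _)
  obtain ⟨g, hg10, hg00⟩ := exists_conj_upper hα
  set A := g * ρ (genA n) * g⁻¹ with hA
  have hdet := sl_det A
  rw [hg10, mul_zero, sub_zero] at hdet
  by_cases hαα : A.1 0 0 = A.1 1 1
  · by_cases hs : A.1 0 1 = 0
    · -- the image of `a` is central
      obtain ⟨β, hβ⟩ : ∃ β : ℂ, β ^ 2 - ((ρ (genB n)).1 0 0 + (ρ (genB n)).1 1 1) * β + 1 = 0 := by
        set T := (ρ (genB n)).1 0 0 + (ρ (genB n)).1 1 1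
        obtain ⟨w, hw⟩ := IsAlgClosed.exists_pow_nat_eq (T ^ 2 / 4 - 1) (zero_lt_two)
        exact ⟨T / 2 + w, by linear_combination hw⟩
      obtain ⟨k, hk, -⟩ := exists_conj_upper hβ
      have hcent : ∀ B : SL2C, A * B = B * A := by
        intro B
        apply sl_ext <;> simp only [sl_mul_entry, hg10, hs, ← hαα] <;> ring
      refine ⟨k, Or.inl ⟨?_, hk⟩⟩
      have : k * ρ (genA n) * k⁻¹ = A := by
        calc k * ρ (genA n) * k⁻¹ = (k * g⁻¹) * A * (k * g⁻¹)⁻¹ := by rw [hA]; group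
          _ = A := by rw [← hcent, mul_assoc, mul_inv_cancel, mul_one]
      rw [this]
      exact hg10
    · refine ⟨g, Or.inl ⟨hg10, ?_⟩⟩
      obtain ⟨p1, p2, p3, p4⟩ := upper_pow hg10 hαα n
      have hc := hcomm g
      rw [← hA] at hc
      generalize g * ρ (genB n) * g⁻¹ = B at hc ⊢
      -- The upper left entries of AⁿB and BAⁿ differ by the product of the upper right entry of Aⁿ
      -- and the lower left entry of B.
      have h := congrArg (fun B : SL2C => B.1 0 0) hc
      simp only [sl_mul_entry, p1] at h
      have hA0 : A.1 0 0 ≠ 0 := by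
        intro h0
        rw [h0, zero_mul] at hdet
        exact zero_ne_one hdet
      have h01 : (A ^ n).1 0 1 ≠ 0 := by
        intro h0
        rw [h0, zero_mul] at p3
        have : (n : ℂ) ≠ 0 := by exact_mod_cast hn.ne'
        exact mul_ne_zero (mul_ne_zero this (pow_ne_zero n hA0)) hs p3.symm
      apply mul_left_cancel₀ h01
      linear_combination h
  · -- the image of `a` has distinct eigenvalues
    obtain ⟨u, hu0, hu1⟩ : ∃ u : ℂˣ, (u : ℂ) = A.1 0 0 ∧ ((u⁻¹ : ℂˣ) : ℂ) = A.1 1 1 :=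
      ⟨⟨A.1 0 0, A.1 1 1, hdet, by rw [mul_comm, hdet]⟩, rfl, rfl⟩
    have hne := sub_ne_zero.mpr hαα
    -- The unipotent matrix that removes the upper right entry of A.
    set k := slMat 1 (A.1 0 1 / (A.1 0 0 - A.1 1 1)) 0 1 (by ring) with hk
    obtain ⟨k0, k1, k2, k3⟩ := slMat_entries (a := 1) (b := A.1 0 1 / (A.1 0 0 - A.1 1 1)) (c := 0)
      (d := 1) (by ring)
    rw [← hk] at k0 k1 k2 k3
    obtain ⟨i0, i1, i2, i3⟩ := sl_inv_entries k
    have hkA : (k * g) * ρ (genA n) * (k * g)⁻¹ = slDiag u := by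
      have : (k * g) * ρ (genA n) * (k * g)⁻¹ = k * A * k⁻¹ := by rw [hA]; group
      rw [this]
      obtain ⟨d0, d1, d2, d3⟩ := slDiag_entries u
      apply sl_ext <;>
        simp only [sl_mul_entry, i0, i1, i2, i3, k0, k1, k2, k3, hg10, d0, d1, d2, d3, hu0, hu1]
      · ring
      · field_simp
        ring
      · ring
      · ring
    have hc := hcomm (k * g)
    rw [hkA, ← map_pow, slDiag_comm_iff] at hc
    set B := (k * g) * ρ (genB n) * (k * g)⁻¹ with hB
    by_cases hB0 : B.1 1 0 = 0
    · refine ⟨k * g, Or.inl ⟨?_, hB0⟩⟩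
      rw [hkA]
      exact (slDiag_entries u).2.2.1
    · rcases hc with ⟨-, h⟩ | h
      · exact absurd h hB0
      rw [← pow_mul, mul_comm] at h
      obtain ⟨j, hj0, hj1, hj⟩ : ∃ j : ℕ, 0 < j ∧ j < n ∧ u = sliceRoot n j := by
        have hupow : (u : ℂ) ^ (2 * n) = 1 := by
          rw [← Units.val_pow_eq_pow_val, h, Units.val_one]
        have hnorm : ‖(u : ℂ)‖ = 1 := Complex.norm_eq_one_of_pow_eq_one hupow (by omega)
        set z : Circle := ⟨u, mem_sphere_zero_iff_norm.mpr hnorm⟩ with hz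
        have hzu : (z : ℂ) = u := rfl
        have hzim : 0 < (z : ℂ).im := by
          refine lt_of_le_of_ne (by rw [hzu, hu0, hg00]; exact him) fun h0 => hαα ?_
          have h2 := circle_sq_eq_one_of_im h0.symm
          rw [← hu0, ← hu1]
          have h3 : u ^ 2 = 1 := by
            apply Units.ext
            rw [Units.val_pow_eq_pow_val, Units.val_one, ← hzu, ← Circle.coe_pow, h2,
              Circle.coe_one]
          rw [Units.val_inj, ← mul_eq_one_iff_eq_inv, ← sq, h3]
        have hzpow : z ^ (2 * n) = 1 := by
          apply Circle.ext
          rw [Circle.coe_pow, hzu, hupow, Circle.coe_one]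
        obtain ⟨j, hj0, hj1, hj⟩ := (upper_root_iff hn z).mp ⟨hzpow, hzim⟩
        refine ⟨j, hj0, hj1, Units.ext ?_⟩
        rw [← hzu, hj]
        rfl
      subst hj
      -- Conjugation by diag(t, t⁻¹) divides the lower left entry of B by t², which normalizes it to
      -- 1.
      obtain ⟨t, ht⟩ := IsAlgClosed.exists_pow_nat_eq (B.1 1 0) (zero_lt_two)
      have ht0 : t ≠ 0 := by
        rintro rfl
        exact hB0 (by rw [← ht]; ring)
      obtain ⟨c0, c1, c2, c3⟩ := slDiag_conj_entries (Units.mk0 t ht0) B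
      set τ := slDiag (Units.mk0 t ht0) with hτ
      have hBdet := sl_det B
      have e2 : ((((Units.mk0 t ht0)⁻¹ : ℂˣ) : ℂ)) ^ 2 * B.1 1 0 = 1 := by
        rw [← ht, ← mul_pow, Units.val_inv_eq_inv_val, Units.val_mk0, inv_mul_cancel₀ ht0, one_pow]
      refine ⟨τ * (k * g), Or.inr ⟨j, (B.1 0 0 + B.1 1 1) / 2, (B.1 0 0 - B.1 1 1) / 2, hj0, hj1,
        ?_, ?_⟩⟩
      · calc _ = τ * ((k * g) * ρ (genA n) * (k * g)⁻¹) * τ⁻¹ := by group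
          _ = slDiag (sliceRoot n j) := by
            rw [hkA, hτ, ← map_inv, ← map_mul, ← map_mul]
            congr 1
            rw [mul_comm (Units.mk0 t ht0), mul_inv_cancel_right]
      · have : τ * (k * g) * ρ (genB n) * (τ * (k * g))⁻¹ = τ * B * τ⁻¹ := by rw [hB]; group
        rw [this]
        obtain ⟨s0, s1, s2, s3⟩ := slMat_entries (a := (B.1 0 0 + B.1 1 1) / 2 +
          (B.1 0 0 - B.1 1 1) / 2) (b := ((B.1 0 0 + B.1 1 1) / 2) ^ 2 -
          ((B.1 0 0 - B.1 1 1) / 2) ^ 2 - 1) (c := 1) (d := (B.1 0 0 + B.1 1 1) / 2 -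
          (B.1 0 0 - B.1 1 1) / 2) (by ring)
        apply sl_ext
        · rw [c0]
          exact (s0.trans (by ring)).symm
        · rw [c1]
          refine Eq.trans ?_ s1.symm
          rw [Units.val_mk0, ht]
          linear_combination -hBdet
        · rw [c2, e2]
          exact s2.symm
        · rw [c3]
          exact (s3.trans (by ring)).symm

/-! ### Regular functions and polynomial functions -/

theorem comp_mem_of_mem_adjoin {S T : Type*} {s : Set (T → ℂ)} {φ : S → T}
    {𝒜 : Subalgebra ℂ (S → ℂ)} (h : ∀ f ∈ s, f ∘ φ ∈ 𝒜) {f : T → ℂ}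
    (hf : f ∈ Algebra.adjoin ℂ s) : f ∘ φ ∈ 𝒜 := by
  induction hf using Algebra.adjoin_induction with
  | mem f hf => exact h f hf
  | algebraMap c => exact 𝒜.algebraMap_mem c
  | add f g _ _ hf hg => exact 𝒜.add_mem hf hg
  | mul f g _ _ hf hg => exact 𝒜.mul_mem hf hg

/-- If the matrix entries of `a` and `b` in a family of representations lie in an algebra of
functions, then so does every regular function along the family. -/
theorem regular_comp_mem {n : ℕ} {S : Type*} {r : S → (LinkGroup n →* SL2C)}
    {𝒜 : Subalgebra ℂ (S → ℂ)} (hA : ∀ i j, (fun s => (r s (genA n)).1 i j) ∈ 𝒜)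
    (hB : ∀ i j, (fun s => (r s (genB n)).1 i j) ∈ 𝒜) {f : RepSpace (LinkGroup n) SL2C → ℂ}
    (hf : f ∈ regularFunctions (LinkGroup n)) : (fun s => f (RepSpace.of (r s))) ∈ 𝒜 := by
  refine comp_mem_of_mem_adjoin (φ := fun s => RepSpace.of (r s)) ?_ hf
  rintro _ ⟨γ, i, j, rfl⟩
  change (fun s => (r s γ).1 i j) ∈ 𝒜
  revert i j
  induction γ using linkGroup_induction with
  | hA => exact hA
  | hB => exact hB
  | h1 =>
    intro i j
    simp only [map_one]
    exact 𝒜.algebraMap_mem ((1 : SL2C).1 i j)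
  | hmul x y hx hy =>
    intro i j
    simp only [map_mul, sl_mul_entry]
    exact 𝒜.add_mem (𝒜.mul_mem (hx i 0) (hy 0 j)) (𝒜.mul_mem (hx i 1) (hy 1 j))
  | hinv x hx =>
    intro i j
    simp only [map_inv]
    fin_cases i <;> fin_cases j
    · simpa only [Fin.zero_eta, (sl_inv_entries _).1] using hx 1 1
    · simp only [Fin.zero_eta, Fin.mk_one, (sl_inv_entries _).2.1]
      exact 𝒜.neg_mem (hx 0 1)
    · simp only [Fin.zero_eta, Fin.mk_one, (sl_inv_entries _).2.2.1]
      exact 𝒜.neg_mem (hx 1 0)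
    · simpa only [Fin.mk_one, (sl_inv_entries _).2.2.2] using hx 0 0

/-- The polynomial functions on `ℂ²`. -/
def poly2 : Subalgebra ℂ (ℂ × ℂ → ℂ) :=
  Algebra.adjoin ℂ {fun q => q.1, fun q => q.2}

/-- The polynomial functions on `ℂ³`. -/
def poly3 : Subalgebra ℂ (ℂ × ℂ × ℂ → ℂ) :=
  Algebra.adjoin ℂ {fun p => p.1, fun p => p.2.1, fun p => p.2.2}

theorem poly2_fst : (fun q : ℂ × ℂ => q.1) ∈ poly2 := Algebra.subset_adjoin (by simp)

theorem poly2_snd : (fun q : ℂ × ℂ => q.2) ∈ poly2 := Algebra.subset_adjoin (by simp)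

theorem poly3_x : (fun p : ℂ × ℂ × ℂ => p.1) ∈ poly3 := Algebra.subset_adjoin (by simp)

theorem poly3_y : (fun p : ℂ × ℂ × ℂ => p.2.1) ∈ poly3 := Algebra.subset_adjoin (by simp)

theorem poly3_z : (fun p : ℂ × ℂ × ℂ => p.2.2) ∈ poly3 := Algebra.subset_adjoin (by simp)

theorem poly2_comp {S : Type*} {𝒜 : Subalgebra ℂ (S → ℂ)} {φ : S → ℂ × ℂ}
    (h1 : (fun s => (φ s).1) ∈ 𝒜) (h2 : (fun s => (φ s).2) ∈ 𝒜) {F : ℂ × ℂ → ℂ}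
    (hF : F ∈ poly2) : (fun s => F (φ s)) ∈ 𝒜 := by
  refine comp_mem_of_mem_adjoin (φ := φ) ?_ hF
  rintro _ (rfl | rfl)
  · exact h1
  · exact h2

theorem poly3_comp {S : Type*} {𝒜 : Subalgebra ℂ (S → ℂ)} {φ : S → ℂ × ℂ × ℂ}
    (h1 : (fun s => (φ s).1) ∈ 𝒜) (h2 : (fun s => (φ s).2.1) ∈ 𝒜)
    (h3 : (fun s => (φ s).2.2) ∈ 𝒜) {F : ℂ × ℂ × ℂ → ℂ}
    (hF : F ∈ poly3) : (fun s => F (φ s)) ∈ 𝒜 := by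
  refine comp_mem_of_mem_adjoin (φ := φ) ?_ hF
  rintro _ (rfl | rfl | rfl)
  · exact h1
  · exact h2
  · exact h3

theorem continuous_of_mem_poly3 {F : ℂ × ℂ × ℂ → ℂ} (hF : F ∈ poly3) : Continuous F := by
  induction hF using Algebra.adjoin_induction with
  | mem f hf => rcases hf with rfl | rfl | rfl <;> fun_prop
  | algebraMap c => exact continuous_const
  | add f g _ _ hf hg => exact hf.add hg
  | mul f g _ _ hf hg => exact hf.mul hg

/-- Division with remainder by `y² - d² - 1`. -/
theorem poly2_division {G : ℂ × ℂ → ℂ} (hG : G ∈ poly2) :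
    ∃ (A B : Polynomial ℂ), ∃ Q ∈ poly2, ∀ y d,
      G (y, d) = A.eval y + B.eval y * d + (y ^ 2 - d ^ 2 - 1) * Q (y, d) := by
  have hpoly : ∀ A : Polynomial ℂ, (fun q : ℂ × ℂ => A.eval q.1) ∈ poly2 := by
    intro A
    induction A using Polynomial.induction_on' with
    | add p q hp hq => simp only [Polynomial.eval_add]; exact poly2.add_mem hp hq
    | monomial k c =>
      simp only [Polynomial.eval_monomial]
      exact poly2.mul_mem (poly2.algebraMap_mem c) (poly2.pow_mem poly2_fst k)
  induction hG using Algebra.adjoin_induction with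
  | mem f hf =>
    rcases hf with rfl | rfl
    · exact ⟨Polynomial.X, 0, 0, poly2.zero_mem, fun y d => by simp⟩
    · exact ⟨0, 1, 0, poly2.zero_mem, fun y d => by simp⟩
  | algebraMap c => exact ⟨Polynomial.C c, 0, 0, poly2.zero_mem, fun y d => by simp⟩
  | add f g _ _ hf hg =>
    obtain ⟨A, B, Q, hQ, h⟩ := hf
    obtain ⟨A', B', Q', hQ', h'⟩ := hg
    refine ⟨A + A', B + B', Q + Q', poly2.add_mem hQ hQ', fun y d => ?_⟩
    simp only [Pi.add_apply, Polynomial.eval_add, h, h']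
    ring
  | mul f g hf' hg' hf hg =>
    obtain ⟨A, B, Q, hQ, h⟩ := hf
    obtain ⟨A', B', Q', hQ', h'⟩ := hg
    have hg2 : g ∈ poly2 := hg'
    refine ⟨A * A' + B * B' * (Polynomial.X ^ 2 - 1), A * B' + B * A',
      (fun q => -(B.eval q.1 * B'.eval q.1)) + (fun q => A.eval q.1 + B.eval q.1 * q.2) * Q' +
        Q * g, ?_, fun y d => ?_⟩
    · refine poly2.add_mem (poly2.add_mem ?_ (poly2.mul_mem ?_ hQ')) (poly2.mul_mem hQ hg2)
      · exact poly2.neg_mem (poly2.mul_mem (hpoly B) (hpoly B'))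
      · exact poly2.add_mem (hpoly A) (poly2.mul_mem (hpoly B) poly2_snd)
    · simp only [Pi.mul_apply, Pi.add_apply, Polynomial.eval_add, Polynomial.eval_mul,
        Polynomial.eval_sub, Polynomial.eval_pow, Polynomial.eval_X, Polynomial.eval_one, h, h']
      ring

/-- A polynomial function that vanishes on the conic `y² - d² = 1` is divisible by
`y² - d² - 1`. -/
theorem poly2_divisible {G : ℂ × ℂ → ℂ} (hG : G ∈ poly2)
    (h0 : ∀ y d : ℂ, y ^ 2 - d ^ 2 = 1 → G (y, d) = 0) :
    ∃ Q ∈ poly2, ∀ y d, G (y, d) = (y ^ 2 - d ^ 2 - 1) * Q (y, d) := by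
  obtain ⟨A, B, Q, hQ, h⟩ := poly2_division hG
  have key : ∀ y : ℂ, A.eval y * (y ^ 2 - 1) = 0 ∧ B.eval y * (y ^ 2 - 1) = 0 := by
    intro y
    obtain ⟨d, hd⟩ := IsAlgClosed.exists_pow_nat_eq (y ^ 2 - 1) (zero_lt_two)
    have hc : y ^ 2 - d ^ 2 = 1 := by rw [hd]; ring
    -- Both square roots d and −d of y² − 1 give points of the conic. Adding and subtracting the two
    -- relations yields A(y) = 0 and B(y)d = 0, and multiplying by d turns the latter into a
    -- polynomial identity in y.
    have e1 := h y d
    have e2 := h y (-d)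
    rw [h0 y d hc] at e1
    rw [h0 y (-d) (by rw [neg_sq]; exact hc)] at e2
    have hA : A.eval y = 0 := by linear_combination -(1 / 2) * e1 - (1 / 2) * e2 -
      ((Q (y, d) + Q (y, -d)) / 2) * hc
    have hB : B.eval y * d = 0 := by linear_combination -(1 / 2) * e1 + (1 / 2) * e2 -
      ((Q (y, d) - Q (y, -d)) / 2) * hc
    refine ⟨by rw [hA, zero_mul], ?_⟩
    linear_combination d * hB - B.eval y * hd
  have hX : (Polynomial.X ^ 2 - 1 : Polynomial ℂ) ≠ 0 := by
    intro h1
    have := congrArg (Polynomial.eval 0) h1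
    simp at this
  have hzero : ∀ C : Polynomial ℂ, (∀ y : ℂ, C.eval y * (y ^ 2 - 1) = 0) → C = 0 := by
    intro C hC
    have : C * (Polynomial.X ^ 2 - 1) = 0 := Polynomial.funext fun y => by simpa using hC y
    exact (mul_eq_zero.mp this).resolve_right hX
  have hA := hzero A fun y => (key y).1
  have hB := hzero B fun y => (key y).2
  refine ⟨Q, hQ, fun y d => ?_⟩
  rw [h, hA, hB]
  simp

/-! ### Invariant functions on the torus -/

/-- Half the sum and half the difference of a unit and its inverse. -/
def unitHalves (u : ℂˣ) : ℂ × ℂ := (((u : ℂ) + (u⁻¹ : ℂˣ)) / 2, ((u : ℂ) - (u⁻¹ : ℂˣ)) / 2)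

theorem unitHalves_sq (u : ℂˣ) : (unitHalves u).1 ^ 2 - (unitHalves u).2 ^ 2 = 1 := by
  have hu : (u : ℂ) * ((u⁻¹ : ℂˣ) : ℂ) = 1 := u.mul_inv
  simp only [unitHalves]
  linear_combination hu

theorem exists_unitHalves {x w : ℂ} (h : x ^ 2 - w ^ 2 = 1) : ∃ u : ℂˣ, unitHalves u = (x, w) := by
  refine ⟨⟨x + w, x - w, by linear_combination h, by linear_combination h⟩, ?_⟩
  simp only [unitHalves, Units.inv_mk, Prod.mk.injEq]
  constructor <;> ring

/-- The functions on the torus of the form `p + q w + r d`, where `p`, `q`, `r` are polynomial in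
the half traces. -/
def torusAlgebra : Subalgebra ℂ (ℂˣ × ℂˣ → ℂ) where
  carrier := {f | ∃ p ∈ poly3, ∃ q ∈ poly3, ∃ r ∈ poly3, ∀ u v,
    f (u, v) = p (halfTraces (unitHalves u, unitHalves v)) +
      q (halfTraces (unitHalves u, unitHalves v)) * (unitHalves u).2 +
      r (halfTraces (unitHalves u, unitHalves v)) * (unitHalves v).2}
  algebraMap_mem' c := ⟨_, poly3.algebraMap_mem c, 0, poly3.zero_mem, 0, poly3.zero_mem,
    fun u v => by simp⟩
  add_mem' := by
    rintro f g ⟨p, hp, q, hq, r, hr, h⟩ ⟨p', hp', q', hq', r', hr', h'⟩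
    refine ⟨p + p', poly3.add_mem hp hp', q + q', poly3.add_mem hq hq', r + r',
      poly3.add_mem hr hr', fun u v => ?_⟩
    simp only [Pi.add_apply, h, h']
    ring
  -- Products are reduced by w² = x² − 1, d² = y² − 1 and wd = z − xy.
  mul_mem' := by
    rintro f g ⟨p, hp, q, hq, r, hr, h⟩ ⟨p', hp', q', hq', r', hr', h'⟩
    refine ⟨p * p' + q * q' * ((fun a => a.1) ^ 2 - 1) + r * r' * ((fun a => a.2.1) ^ 2 - 1) +
      (q * r' + r * q') * ((fun a => a.2.2) - (fun a => a.1) * (fun a => a.2.1)), ?_,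
      p * q' + q * p', ?_, p * r' + r * p', ?_, fun u v => ?_⟩
    · refine poly3.add_mem (poly3.add_mem (poly3.add_mem (poly3.mul_mem hp hp') ?_) ?_) ?_
      · exact poly3.mul_mem (poly3.mul_mem hq hq')
          (poly3.sub_mem (poly3.pow_mem poly3_x 2) poly3.one_mem)
      · exact poly3.mul_mem (poly3.mul_mem hr hr')
          (poly3.sub_mem (poly3.pow_mem poly3_y 2) poly3.one_mem)
      · exact poly3.mul_mem (poly3.add_mem (poly3.mul_mem hq hr') (poly3.mul_mem hr hq'))
          (poly3.sub_mem poly3_z (poly3.mul_mem poly3_x poly3_y))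
    · exact poly3.add_mem (poly3.mul_mem hp hq') (poly3.mul_mem hq hp')
    · exact poly3.add_mem (poly3.mul_mem hp hr') (poly3.mul_mem hr hp')
    · have hu := unitHalves_sq u
      have hv := unitHalves_sq v
      set T := halfTraces (unitHalves u, unitHalves v) with hT
      have t1 : T.1 = (unitHalves u).1 := rfl
      have t2 : T.2.1 = (unitHalves v).1 := rfl
      have t3 : T.2.2 = (unitHalves u).1 * (unitHalves v).1 + (unitHalves u).2 * (unitHalves v).2 :=
        rfl
      simp only [Pi.mul_apply, Pi.add_apply, Pi.sub_apply, Pi.pow_apply, Pi.one_apply, h, h', t1,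
        t2, t3, ← hT]
      linear_combination (-q T * q' T) * hu - (r T * r' T) * hv

theorem torusAlgebra_mem {p q r : ℂ × ℂ × ℂ → ℂ} (hp : p ∈ poly3) (hq : q ∈ poly3) (hr : r ∈ poly3)
    {f : ℂˣ × ℂˣ → ℂ} (h : ∀ u v, f (u, v) = p (halfTraces (unitHalves u, unitHalves v)) +
      q (halfTraces (unitHalves u, unitHalves v)) * (unitHalves u).2 +
      r (halfTraces (unitHalves u, unitHalves v)) * (unitHalves v).2) : f ∈ torusAlgebra :=
  ⟨p, hp, q, hq, r, hr, h⟩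

theorem slDiag_fst_mem (i j : Fin 2) :
    (fun s : ℂˣ × ℂˣ => (slDiag s.1).1 i j) ∈ torusAlgebra := by
  fin_cases i <;> fin_cases j
  · refine torusAlgebra_mem poly3_x poly3.one_mem poly3.zero_mem fun u v => ?_
    refine (slDiag_entries u).1.trans ?_
    simp only [halfTraces, unitHalves, Pi.one_apply, Pi.zero_apply]
    ring
  · exact torusAlgebra.zero_mem
  · exact torusAlgebra.zero_mem
  · refine torusAlgebra_mem poly3_x (poly3.neg_mem poly3.one_mem) poly3.zero_mem fun u v => ?_
    refine (slDiag_entries u).2.2.2.trans ?_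
    simp only [halfTraces, unitHalves, Pi.one_apply, Pi.zero_apply, Pi.neg_apply]
    ring

theorem slDiag_snd_mem (i j : Fin 2) :
    (fun s : ℂˣ × ℂˣ => (slDiag s.2).1 i j) ∈ torusAlgebra := by
  fin_cases i <;> fin_cases j
  · refine torusAlgebra_mem poly3_y poly3.zero_mem poly3.one_mem fun u v => ?_
    refine (slDiag_entries v).1.trans ?_
    simp only [halfTraces, unitHalves, Pi.one_apply, Pi.zero_apply]
    ring
  · exact torusAlgebra.zero_mem
  · exact torusAlgebra.zero_mem
  · refine torusAlgebra_mem poly3_y poly3.zero_mem (poly3.neg_mem poly3.one_mem) fun u v => ?_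
    refine (slDiag_entries v).2.2.2.trans ?_
    simp only [halfTraces, unitHalves, Pi.one_apply, Pi.zero_apply, Pi.neg_apply]
    ring

theorem invariant_conj {n : ℕ} {f : RepSpace (LinkGroup n) SL2C → ℂ}
    (hf : f ∈ invariantFunctions (LinkGroup n)) {ρ σ : LinkGroup n →* SL2C} (g : SL2C)
    (hA : g * ρ (genA n) * g⁻¹ = σ (genA n)) (hB : g * ρ (genB n) * g⁻¹ = σ (genB n)) :
    f (RepSpace.of ρ) = f (RepSpace.of σ) := by
  have h : RepSpace.of σ = conjRep g (RepSpace.of ρ) :=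
    linkGroup_hom_ext (ρ := σ) (σ := conjRep g (RepSpace.of ρ)) hA.symm hB.symm
  rw [h, hf.2]

theorem weyl_conj_slDiag (u : ℂˣ) : weylSL * slDiag u * weylSL⁻¹ = slDiag u⁻¹ := by
  obtain ⟨h0, h1, h2, h3⟩ := weyl_conj_entries (slDiag u)
  apply sl_ext
  · rw [h0]; rfl
  · rw [h1, (slDiag_entries u).2.2.1, (slDiag_entries u⁻¹).2.1, neg_zero]
  · rw [h2, (slDiag_entries u).2.1, (slDiag_entries u⁻¹).2.2.1, neg_zero]
  · rw [h3, (slDiag_entries u).1, (slDiag_entries u⁻¹).2.2.2, inv_inv]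

theorem unitHalves_inv (u : ℂˣ) : unitHalves u⁻¹ = ((unitHalves u).1, -(unitHalves u).2) := by
  simp only [unitHalves, inv_inv, Prod.mk.injEq]
  constructor <;> ring

theorem invariant_torusRep_inv {n : ℕ} {f : RepSpace (LinkGroup n) SL2C → ℂ}
    (hf : f ∈ invariantFunctions (LinkGroup n)) (u v : ℂˣ) :
    f (RepSpace.of (torusRep n u v)) = f (RepSpace.of (torusRep n u⁻¹ v⁻¹)) := by
  refine invariant_conj hf weylSL ?_ ?_
  · rw [(torusRep_gen n _ _).1, (torusRep_gen n _ _).1, weyl_conj_slDiag]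
  · rw [(torusRep_gen n _ _).2, (torusRep_gen n _ _).2, weyl_conj_slDiag]

/-- On the torus, an invariant function is a polynomial in the half traces. -/
theorem exists_poly_torus {n : ℕ} {f : RepSpace (LinkGroup n) SL2C → ℂ}
    (hf : f ∈ invariantFunctions (LinkGroup n)) : ∃ F ∈ poly3, ∀ u v,
      f (RepSpace.of (torusRep n u v)) = F (halfTraces (unitHalves u, unitHalves v)) := by
  obtain ⟨p, hp, q, hq, r, hr, h⟩ : (fun s : ℂˣ × ℂˣ => f (RepSpace.of (torusRep n s.1 s.2))) ∈
      torusAlgebra := by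
    refine regular_comp_mem (fun i j => ?_) (fun i j => ?_) hf.1
    · simp only [(torusRep_gen n _ _).1]
      exact slDiag_fst_mem i j
    · simp only [(torusRep_gen n _ _).2]
      exact slDiag_snd_mem i j
  refine ⟨p, hp, fun u v => ?_⟩
  have h1 : f (RepSpace.of (torusRep n u v)) = _ := h u v
  have h2 : f (RepSpace.of (torusRep n u⁻¹ v⁻¹)) = _ := h u⁻¹ v⁻¹
  have hT : halfTraces (unitHalves u⁻¹, unitHalves v⁻¹) =
      halfTraces (unitHalves u, unitHalves v) := by
    simp only [unitHalves_inv, halfTraces]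
    ring_nf
  -- Inverting u and v preserves the half traces and the value of f but changes the signs of w and
  -- d. Averaging the two expressions leaves only the polynomial p.
  rw [hT, ← invariant_torusRep_inv hf] at h2
  simp only [unitHalves_inv] at h2
  linear_combination (1 / 2) * h1 + (1 / 2) * h2

/-! ### Degeneration of triangular representations -/

theorem continuous_of_mem_regularFunctions {n : ℕ} {f : RepSpace (LinkGroup n) SL2C → ℂ}
    (hf : f ∈ regularFunctions (LinkGroup n)) : Continuous f := by
  induction hf using Algebra.adjoin_induction with
  | mem f hf =>
    obtain ⟨γ, i, j, rfl⟩ := hf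
    have h : Continuous fun A : SL2C => A.1 i j :=
      (continuous_apply_apply i j).comp continuous_subtype_val
    exact h.comp (continuous_repSpace_apply γ)
  | algebraMap c => exact continuous_const
  | add f g _ _ hf hg => exact hf.add hg
  | mul f g _ _ hf hg => exact hf.mul hg

theorem continuous_slMat {a b c d : ℂ → ℂ} {h : ∀ t, a t * d t - b t * c t = 1}
    (ha : Continuous a) (hb : Continuous b) (hc : Continuous c) (hd : Continuous d) :
    Continuous fun t => slMat (a t) (b t) (c t) (d t) (h t) := by
  refine Continuous.subtype_mk ?_ _
  refine continuous_matrix fun i j => ?_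
  fin_cases i <;> fin_cases j
  · exact ha
  · exact hb
  · exact hc
  · exact hd

/-- An invariant function takes the same value at a triangular representation and at its diagonal
part. -/
theorem invariant_upper {n : ℕ} {f : RepSpace (LinkGroup n) SL2C → ℂ}
    (hf : f ∈ invariantFunctions (LinkGroup n)) {ρ : LinkGroup n →* SL2C}
    (hA : (ρ (genA n)).1 1 0 = 0) (hB : (ρ (genB n)).1 1 0 = 0) {u v : ℂˣ}
    (hu : (u : ℂ) = (ρ (genA n)).1 0 0) (hv : (v : ℂ) = (ρ (genB n)).1 0 0) :
    f (RepSpace.of ρ) = f (RepSpace.of (torusRep n u v)) := by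
  have hu' : ((u⁻¹ : ℂˣ) : ℂ) = (ρ (genA n)).1 1 1 := by
    have h := sl_det (ρ (genA n))
    rw [hA, mul_zero, sub_zero, ← hu] at h
    rw [Units.val_inv_eq_inv_val]
    exact inv_eq_of_mul_eq_one_right h
  have hv' : ((v⁻¹ : ℂˣ) : ℂ) = (ρ (genB n)).1 1 1 := by
    have h := sl_det (ρ (genB n))
    rw [hB, mul_zero, sub_zero, ← hv] at h
    rw [Units.val_inv_eq_inv_val]
    exact inv_eq_of_mul_eq_one_right h
  -- Scaling the upper right entries by t is conjugation by diag(√t, 1/√t) for t ≠ 0, so f is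
  -- constant there. By continuity it has the same value at t = 0, which is the diagonal part.
  let A : ℂ → SL2C := fun t => slMat u (t * (ρ (genA n)).1 0 1) 0 (u⁻¹ : ℂˣ) (by simp)
  let B : ℂ → SL2C := fun t => slMat v (t * (ρ (genB n)).1 0 1) 0 (v⁻¹ : ℂˣ) (by simp)
  have hconj : ∀ t : ℂ, t ≠ 0 → ∃ g : SL2C, g * ρ (genA n) * g⁻¹ = A t ∧
      g * ρ (genB n) * g⁻¹ = B t := by
    intro t ht
    obtain ⟨τ, hτ⟩ := IsAlgClosed.exists_pow_nat_eq t (zero_lt_two)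
    have hτ0 : τ ≠ 0 := by rintro rfl; exact ht (by rw [← hτ]; ring)
    refine ⟨slDiag (Units.mk0 τ hτ0), ?_, ?_⟩
    · obtain ⟨c0, c1, c2, c3⟩ := slDiag_conj_entries (Units.mk0 τ hτ0) (ρ (genA n))
      apply sl_ext
      · rw [c0]; exact hu.symm
      · rw [c1, Units.val_mk0, hτ]; rfl
      · rw [c2, hA, mul_zero]; rfl
      · rw [c3]; exact hu'.symm
    · obtain ⟨c0, c1, c2, c3⟩ := slDiag_conj_entries (Units.mk0 τ hτ0) (ρ (genB n))
      apply sl_ext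
      · rw [c0]; exact hv.symm
      · rw [c1, Units.val_mk0, hτ]; rfl
      · rw [c2, hB, mul_zero]; rfl
      · rw [c3]; exact hv'.symm
  have hA0 : A 0 = slDiag u := sl_ext rfl (zero_mul _) rfl rfl
  have hB0 : B 0 = slDiag v := sl_ext rfl (zero_mul _) rfl rfl
  have hcomm : ∀ t, A t ^ n * B t = B t * A t ^ n := by
    intro t
    by_cases ht : t = 0
    · rw [ht, hA0, hB0, ← map_pow, ← map_mul, ← map_mul, mul_comm]
    · obtain ⟨g, h1, h2⟩ := hconj t ht
      rw [← h1, ← h2, conj_pow]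
      calc _ = g * (ρ (genA n) ^ n * ρ (genB n)) * g⁻¹ := by group
        _ = _ := by rw [rep_pow_comm]; group
  let r : ℂ → RepSpace (LinkGroup n) SL2C := fun t =>
    RepSpace.of (homOfPair n (A t) (B t) (hcomm t))
  have hrA : ∀ t, (r t).hom (genA n) = A t := fun t => homOfPair_genA _ _ _ (hcomm t)
  have hrB : ∀ t, (r t).hom (genB n) = B t := fun t => homOfPair_genB _ _ _ (hcomm t)
  have hrc : Continuous r := by
    refine continuous_to_repSpace ?_ ?_
    · simp only [hrA]
      exact continuous_slMat (by fun_prop) (by fun_prop) (by fun_prop) (by fun_prop)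
    · simp only [hrB]
      exact continuous_slMat (by fun_prop) (by fun_prop) (by fun_prop) (by fun_prop)
  have hfr : Continuous fun t => f (r t) := (continuous_of_mem_regularFunctions hf.1).comp hrc
  have hne : ∀ t, t ≠ 0 → f (r t) = f (RepSpace.of ρ) := by
    intro t ht
    obtain ⟨g, h1, h2⟩ := hconj t ht
    exact (invariant_conj hf g (h1.trans (hrA t).symm) (h2.trans (hrB t).symm)).symm
  have hall : (fun t => f (r t)) = fun _ => f (RepSpace.of ρ) :=
    Continuous.ext_on (dense_compl_singleton (0 : ℂ)) hfr continuous_const fun t ht => hne t ht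
  have h0 : r 0 = RepSpace.of (torusRep n u v) := by
    refine linkGroup_hom_ext (ρ := (r 0).hom) (σ := torusRep n u v) ?_ ?_
    · rw [hrA, hA0, (torusRep_gen n u v).1]
    · rw [hrB, hB0, (torusRep_gen n u v).2]
  rw [← h0]
  exact (congrFun hall 0).symm

/-! ### Invariant functions are polynomials in the half traces -/

theorem unitHalves_add_sub (u : ℂˣ) : (u : ℂ) = (unitHalves u).1 + (unitHalves u).2 ∧
    ((u⁻¹ : ℂˣ) : ℂ) = (unitHalves u).1 - (unitHalves u).2 := by
  simp only [unitHalves]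
  constructor <;> ring

theorem unitHalves_sliceRoot (n j : ℕ) : unitHalves (sliceRoot n j) =
    ((Real.cos (Real.pi * j / n) : ℂ), Complex.I * (Real.sin (Real.pi * j / n) : ℂ)) := by
  simp only [unitHalves, sliceRoot_coe, Prod.mk.injEq]
  constructor <;> ring

theorem sliceMat_entries (y d : ℂ) : (sliceMat y d).1 0 0 = y + d ∧
    (sliceMat y d).1 0 1 = y ^ 2 - d ^ 2 - 1 ∧ (sliceMat y d).1 1 0 = 1 ∧
    (sliceMat y d).1 1 1 = y - d := ⟨rfl, rfl, rfl, rfl⟩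

/-- On the conic `y² - d² = 1`, the representations `sliceRep` are reducible. -/
theorem invariant_sliceRep_conic {n : ℕ} (hn : 0 < n) {f : RepSpace (LinkGroup n) SL2C → ℂ}
    (hf : f ∈ invariantFunctions (LinkGroup n)) (j : ℕ) {y d : ℂ} {v : ℂˣ}
    (hv : unitHalves v = (y, d)) :
    f (RepSpace.of (sliceRep hn j y d)) = f (RepSpace.of (torusRep n (sliceRoot n j) v)) := by
  have hc := unitHalves_sq v
  obtain ⟨-, hv2⟩ := unitHalves_add_sub v
  simp only [hv] at hc hv2
  obtain ⟨w0, -, w2, -⟩ := weyl_conj_entries (sliceMat y d)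
  obtain ⟨s0, s1, s2, s3⟩ := sliceMat_entries y d
  -- On the conic the upper right entry of `sliceMat` vanishes. The Weyl element turns this lower
  -- triangular representation into an upper triangular one, with inverted eigenvalues.
  let σ : LinkGroup n →* SL2C := (MulAut.conj weylSL).toMonoidHom.comp (sliceRep hn j y d)
  have hA : σ (genA n) = slDiag (sliceRoot n j)⁻¹ := by
    change weylSL * sliceRep hn j y d (genA n) * weylSL⁻¹ = _
    rw [(sliceRep_gen hn j y d).1, weyl_conj_slDiag]
  have hB : σ (genB n) = weylSL * sliceMat y d * weylSL⁻¹ := by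
    change weylSL * sliceRep hn j y d (genB n) * weylSL⁻¹ = _
    rw [(sliceRep_gen hn j y d).2]
  rw [invariant_torusRep_inv hf, invariant_conj hf weylSL (σ := σ) rfl rfl]
  refine invariant_upper hf ?_ ?_ ?_ ?_
  · rw [hA]; exact (slDiag_entries _).2.2.1
  · rw [hB, w2, s1, hc]; ring
  · rw [hA]; exact (slDiag_entries _).1.symm
  · rw [hB, w0, s3, hv2]

theorem cos_index_injective {n i j : ℕ} (hi : i ≤ n) (hj : j ≤ n) (hn : 0 < n)
    (h : (Real.cos (Real.pi * i / n) : ℂ) = Real.cos (Real.pi * j / n)) : i = j := by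
  have h1 := Real.injOn_cos (angle_index_mem hi hn) (angle_index_mem hj hn)
    (Complex.ofReal_injective h)
  have hn0 : (n : ℝ) ≠ 0 := by exact_mod_cast hn.ne'
  rw [div_left_inj' hn0, mul_right_inj' Real.pi_ne_zero] at h1
  exact_mod_cast h1

/-- The polynomial cutting out the half traces of the reducible representations. -/
def reducibleDisc : ℂ × ℂ × ℂ → ℂ :=
  (1 - (fun p => p.1) ^ 2) * (1 - (fun p => p.2.1) ^ 2) -
    ((fun p => p.2.2) - (fun p => p.1) * (fun p => p.2.1)) ^ 2

theorem reducibleDisc_apply (x y z : ℂ) :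
    reducibleDisc (x, y, z) = (1 - x ^ 2) * (1 - y ^ 2) - (z - x * y) ^ 2 := rfl

theorem reducibleDisc_mem : reducibleDisc ∈ poly3 :=
  poly3.sub_mem (poly3.mul_mem (poly3.sub_mem poly3.one_mem (poly3.pow_mem poly3_x 2))
    (poly3.sub_mem poly3.one_mem (poly3.pow_mem poly3_y 2)))
    (poly3.pow_mem (poly3.sub_mem poly3_z (poly3.mul_mem poly3_x poly3_y)) 2)

/-- The polynomial vanishing on the slices `0 < i < m`. -/
def sliceProduct (n m : ℕ) : ℂ × ℂ × ℂ → ℂ := fun p =>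
  ∏ i ∈ Finset.Ioo 0 m, (p.1 - (Real.cos (Real.pi * i / n) : ℂ))

theorem sliceProduct_mem (n m : ℕ) : sliceProduct n m ∈ poly3 := by
  have : sliceProduct n m = ∏ i ∈ Finset.Ioo 0 m,
      ((fun p : ℂ × ℂ × ℂ => p.1) - fun _ => (Real.cos (Real.pi * i / n) : ℂ)) := by
    funext p
    simp only [sliceProduct, Finset.prod_apply, Pi.sub_apply]
  rw [this]
  exact poly3.prod_mem fun i _ => poly3.sub_mem poly3_x (poly3.algebraMap_mem _)

theorem sliceProduct_eq_zero_iff {n m : ℕ} {p : ℂ × ℂ × ℂ} : sliceProduct n m p = 0 ↔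
    ∃ i : ℕ, 0 < i ∧ i < m ∧ p.1 = Real.cos (Real.pi * i / n) := by
  simp only [sliceProduct, Finset.prod_eq_zero_iff, Finset.mem_Ioo, sub_eq_zero, and_assoc]

/-- Interpolation, one slice at a time. On slice m the error of the current polynomial is a
polynomial in (y, d) that vanishes on the conic, where the representations degenerate to diagonal
ones; hence it is divisible by y² − d² − 1. On that slice `reducibleDisc` is w²(y² − d² − 1). A
multiple of `reducibleDisc * sliceProduct n m` therefore repairs the error without changing the
values on diagonal representations or on earlier slices. -/
theorem exists_poly_slices {n : ℕ} (hn : 0 < n) {f : RepSpace (LinkGroup n) SL2C → ℂ}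
    (hf : f ∈ invariantFunctions (LinkGroup n)) (m : ℕ) : ∃ F ∈ poly3,
      (∀ u v, f (RepSpace.of (torusRep n u v)) = F (halfTraces (unitHalves u, unitHalves v))) ∧
      ∀ j y d, 0 < j → j < n → j < m → f (RepSpace.of (sliceRep hn j y d)) =
        F (halfTraces (unitHalves (sliceRoot n j), (y, d))) := by
  induction m with
  | zero =>
    obtain ⟨F, hF, h⟩ := exists_poly_torus hf
    exact ⟨F, hF, h, fun j y d _ _ hj => absurd hj (Nat.not_lt_zero j)⟩
  | succ m ih =>
    obtain ⟨F, hF, hFt, hFs⟩ := ih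
    by_cases hm : 0 < m ∧ m < n
    swap
    · refine ⟨F, hF, hFt, fun j y d h0 h1 h2 => hFs j y d h0 h1 ?_⟩
      refine lt_of_le_of_ne (Nat.lt_succ_iff.mp h2) ?_
      rintro rfl
      exact hm ⟨h0, h1⟩
    obtain ⟨hm0, hmn⟩ := hm
    obtain ⟨x, w, hxw⟩ : ∃ x w, unitHalves (sliceRoot n m) = (x, w) := ⟨_, _, rfl⟩
    have hsq := unitHalves_sq (sliceRoot n m)
    have hx : x = Real.cos (Real.pi * m / n) := by
      rw [unitHalves_sliceRoot] at hxw
      exact (congrArg Prod.fst hxw).symm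
    simp only [hxw] at hsq
    have hw0 : w ≠ 0 := slice_ne_zero hm0 hmn hx hsq
    obtain ⟨Q, hQ, hdiv⟩ := poly2_divisible (G := fun q => f (RepSpace.of (sliceRep hn m q.1 q.2)) -
        F (halfTraces ((x, w), q))) (by
      refine poly2.sub_mem (regular_comp_mem (r := fun q : ℂ × ℂ => sliceRep hn m q.1 q.2)
        (fun i j => ?_) (fun i j => ?_) hf.1) (poly3_comp ?_ ?_ ?_ hF)
      · simp only [(sliceRep_gen hn m _ _).1]
        exact poly2.algebraMap_mem _
      · simp only [(sliceRep_gen hn m _ _).2]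
        fin_cases i <;> fin_cases j
        · exact poly2.add_mem poly2_fst poly2_snd
        · exact poly2.sub_mem (poly2.sub_mem (poly2.pow_mem poly2_fst 2)
            (poly2.pow_mem poly2_snd 2)) poly2.one_mem
        · exact poly2.one_mem
        · exact poly2.sub_mem poly2_fst poly2_snd
      · exact poly2.algebraMap_mem x
      · exact poly2_fst
      · exact poly2.add_mem (poly2.mul_mem (poly2.algebraMap_mem x) poly2_fst)
          (poly2.mul_mem (poly2.algebraMap_mem w) poly2_snd)) (by
      intro y d hyd
      obtain ⟨v, hv⟩ := exists_unitHalves hyd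
      simp only
      rw [invariant_sliceRep_conic hn hf m hv, hFt, hxw, hv, sub_self])
    -- The constant factor of the correction on slice m, nonzero since w ≠ 0 and the slice heights
    -- are distinct. Below, d is expressed through the half traces as (z − xy)/w.
    set c := w ^ 2 * sliceProduct n m (x, 0, 0) with hc
    have hc0 : c ≠ 0 := by
      refine mul_ne_zero (pow_ne_zero 2 hw0) fun h => ?_
      obtain ⟨i, -, h1, h2⟩ := sliceProduct_eq_zero_iff.mp h
      rw [show (x, (0 : ℂ), (0 : ℂ)).1 = x from rfl, hx] at h2
      exact h1.ne (cos_index_injective hmn.le (h1.trans hmn).le hn h2).symm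
    refine ⟨F + (fun _ => c⁻¹) * reducibleDisc * sliceProduct n m *
      (fun p => Q (p.2.1, (p.2.2 - x * p.2.1) * w⁻¹)), ?_, fun u v => ?_, fun j y d h0 h1 h2 => ?_⟩
    · refine poly3.add_mem hF (poly3.mul_mem (poly3.mul_mem (poly3.mul_mem
        (poly3.algebraMap_mem c⁻¹) reducibleDisc_mem) (sliceProduct_mem n m))
        (poly2_comp
        (φ := fun p : ℂ × ℂ × ℂ => (p.2.1, (p.2.2 - x * p.2.1) * w⁻¹)) poly3_y ?_ hQ))
      exact poly3.mul_mem (poly3.sub_mem poly3_z (poly3.mul_mem (poly3.algebraMap_mem x) poly3_y))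
        (poly3.algebraMap_mem w⁻¹)
    · have hD : reducibleDisc (halfTraces (unitHalves u, unitHalves v)) = 0 := by
        have hu := unitHalves_sq u
        have hv := unitHalves_sq v
        rw [halfTraces, reducibleDisc_apply]
        simp only
        linear_combination -(1 - (unitHalves v).1 ^ 2) * hu + (unitHalves u).2 ^ 2 * hv
      simp only [Pi.add_apply, Pi.mul_apply, hD, mul_zero, zero_mul, add_zero, hFt]
    · rcases (Nat.lt_succ_iff.mp h2).lt_or_eq with h3 | rfl
      · have hP : sliceProduct n m (halfTraces (unitHalves (sliceRoot n j), (y, d))) = 0 := by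
          refine sliceProduct_eq_zero_iff.mpr ⟨j, h0, h3, ?_⟩
          rw [unitHalves_sliceRoot]
          rfl
        simp only [Pi.add_apply, Pi.mul_apply, hP, mul_zero, zero_mul, add_zero]
        exact hFs j y d h0 h1 h3
      · have e := hdiv y d
        have hP : sliceProduct n j (halfTraces ((x, w), (y, d))) = sliceProduct n j (x, 0, 0) := rfl
        have hD : reducibleDisc (halfTraces ((x, w), (y, d))) = w ^ 2 * (y ^ 2 - d ^ 2 - 1) := by
          rw [halfTraces, reducibleDisc_apply]
          simp only
          linear_combination -(1 - y ^ 2) * hsq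
        have hd : ((halfTraces ((x, w), (y, d))).2.2 - x * (halfTraces ((x, w), (y, d))).2.1) * w⁻¹ =
            d := by
          simp only [halfTraces]
          field_simp
          ring
        rw [hxw]
        simp only [Pi.add_apply, Pi.mul_apply, hP, hD, hd]
        rw [show (halfTraces ((x, w), (y, d))).2.1 = y from rfl]
        simp only at e
        have hcc : c⁻¹ * c = 1 := inv_mul_cancel₀ hc0
        rw [hc] at hcc ⊢
        linear_combination e - (y ^ 2 - d ^ 2 - 1) * Q (y, d) * hcc

/-- The half traces of two matrices and of their product. -/
def pairTraces (A B : SL2C) : ℂ × ℂ × ℂ :=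
  ((A.1 0 0 + A.1 1 1) / 2, (B.1 0 0 + B.1 1 1) / 2, ((A * B).1 0 0 + (A * B).1 1 1) / 2)

theorem sl_trace_conj (g A : SL2C) :
    (g * A * g⁻¹).1 0 0 + (g * A * g⁻¹).1 1 1 = A.1 0 0 + A.1 1 1 := by
  obtain ⟨i0, i1, i2, i3⟩ := sl_inv_entries g
  simp only [sl_mul_entry, i0, i1, i2, i3]
  linear_combination (A.1 0 0 + A.1 1 1) * sl_det g

theorem pairTraces_conj (g A B : SL2C) :
    pairTraces (g * A * g⁻¹) (g * B * g⁻¹) = pairTraces A B := by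
  have h : g * A * g⁻¹ * (g * B * g⁻¹) = g * (A * B) * g⁻¹ := by group
  simp only [pairTraces, h, sl_trace_conj]

/-- The half traces of the images of `a`, `b` and `ab`. -/
def slTraces {n : ℕ} (ρ : LinkGroup n →* SL2C) : ℂ × ℂ × ℂ := pairTraces (ρ (genA n)) (ρ (genB n))

theorem slTraces_sliceRep {n : ℕ} (hn : 0 < n) (j : ℕ) (y d : ℂ) :
    slTraces (sliceRep hn j y d) = halfTraces (unitHalves (sliceRoot n j), (y, d)) := by
  obtain ⟨d0, d1, d2, d3⟩ := slDiag_entries (sliceRoot n j)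
  obtain ⟨s0, s1, s2, s3⟩ := sliceMat_entries y d
  simp only [slTraces, (sliceRep_gen hn j y d).1, (sliceRep_gen hn j y d).2, pairTraces,
    sl_mul_entry, d0, d1, d2, d3, s0, s1, s2, s3, halfTraces, unitHalves, Prod.mk.injEq,
    true_and]
  refine ⟨?_, ?_⟩ <;> ring

theorem slTraces_torusRep (n : ℕ) (u v : ℂˣ) :
    slTraces (torusRep n u v) = halfTraces (unitHalves u, unitHalves v) := by
  obtain ⟨d0, d1, d2, d3⟩ := slDiag_entries u
  obtain ⟨s0, s1, s2, s3⟩ := slDiag_entries v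
  simp only [slTraces, (torusRep_gen n u v).1, (torusRep_gen n u v).2, pairTraces,
    sl_mul_entry, d0, d1, d2, d3, s0, s1, s2, s3, halfTraces, unitHalves, Prod.mk.injEq,
    true_and]
  ring

/-- The invariant functions do not separate a representation from some representation in one of the
standard families. -/
theorem exists_standard_rep {n : ℕ} (hn : 0 < n) (ρ : LinkGroup n →* SL2C) :
    ∃ σ : LinkGroup n →* SL2C, slTraces ρ = slTraces σ ∧
      (∀ f ∈ invariantFunctions (LinkGroup n), f (RepSpace.of ρ) = f (RepSpace.of σ)) ∧
      ((∃ u v, σ = torusRep n u v) ∨ ∃ j y d, 0 < j ∧ j < n ∧ σ = sliceRep hn j y d) := by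
  obtain ⟨g, ⟨hA, hB⟩ | ⟨j, y, d, h0, h1, hA, hB⟩⟩ := upper_or_slice hn ρ
  · let τ : LinkGroup n →* SL2C := (MulAut.conj g).toMonoidHom.comp ρ
    have key : ∀ A : SL2C, A.1 1 0 = 0 →
        ∃ u : ℂˣ, (u : ℂ) = A.1 0 0 ∧ ((u⁻¹ : ℂˣ) : ℂ) = A.1 1 1 := by
      intro A hA
      have h := sl_det A
      rw [hA, mul_zero, sub_zero] at h
      exact ⟨⟨A.1 0 0, A.1 1 1, h, by rw [mul_comm, h]⟩, rfl, rfl⟩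
    obtain ⟨u, hu, hu'⟩ := key (τ (genA n)) hA
    obtain ⟨v, hv, hv'⟩ := key (τ (genB n)) hB
    refine ⟨torusRep n u v, ?_, fun f hf => ?_, Or.inl ⟨u, v, rfl⟩⟩
    · rw [slTraces, ← pairTraces_conj g]
      obtain ⟨d0, d1, d2, d3⟩ := slDiag_entries u
      obtain ⟨s0, s1, s2, s3⟩ := slDiag_entries v
      simp only [slTraces, (torusRep_gen n u v).1, (torusRep_gen n u v).2]
      generalize hA' : g * ρ (genA n) * g⁻¹ = A
      generalize hB' : g * ρ (genB n) * g⁻¹ = B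
      change (_ : ℂ) = (g * ρ (genA n) * g⁻¹).1 0 0 at hu
      change (_ : ℂ) = (g * ρ (genA n) * g⁻¹).1 1 1 at hu'
      change (_ : ℂ) = (g * ρ (genB n) * g⁻¹).1 0 0 at hv
      change (_ : ℂ) = (g * ρ (genB n) * g⁻¹).1 1 1 at hv'
      rw [hA'] at hA hu hu'
      rw [hB'] at hB hv hv'
      simp only [pairTraces, sl_mul_entry, d0, d1, d2, d3, s0, s1, s2, s3, hA, hB, hu, hu', hv,
        hv', mul_zero, zero_mul, add_zero, zero_add]
    · rw [invariant_conj hf g (σ := τ) rfl rfl]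
      exact invariant_upper hf hA hB hu hv
  · refine ⟨sliceRep hn j y d, ?_, fun f hf => ?_, Or.inr ⟨j, y, d, h0, h1, rfl⟩⟩
    · rw [slTraces, ← pairTraces_conj g, hA, hB, slTraces, (sliceRep_gen hn j y d).1,
        (sliceRep_gen hn j y d).2]
    · exact invariant_conj hf g (hA.trans (sliceRep_gen hn j y d).1.symm)
        (hB.trans (sliceRep_gen hn j y d).2.symm)

theorem exists_poly_invariant {n : ℕ} (hn : 0 < n) {f : RepSpace (LinkGroup n) SL2C → ℂ}
    (hf : f ∈ invariantFunctions (LinkGroup n)) :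
    ∃ F ∈ poly3, ∀ ρ : LinkGroup n →* SL2C, f (RepSpace.of ρ) = F (slTraces ρ) := by
  obtain ⟨F, hF, ht, hs⟩ := exists_poly_slices hn hf n
  refine ⟨F, hF, fun ρ => ?_⟩
  obtain ⟨σ, h1, h2, ⟨u, v, rfl⟩ | ⟨j, y, d, h3, h4, rfl⟩⟩ := exists_standard_rep hn ρ
  · rw [h1, h2 f hf, slTraces_torusRep, ht]
  · rw [h1, h2 f hf, slTraces_sliceRep, hs j y d h3 h4 h4]

theorem slTraces_mem {n : ℕ} (hn : 0 < n) (ρ : LinkGroup n →* SL2C) :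
    slTraces ρ ∈ complexModel n := by
  obtain ⟨σ, h1, -, ⟨u, v, rfl⟩ | ⟨j, y, d, h3, h4, rfl⟩⟩ := exists_standard_rep hn ρ
  · rw [h1, slTraces_torusRep]
    exact halfTraces_mem ⟨unitHalves_sq u, Or.inl (unitHalves_sq v)⟩
  · rw [h1, slTraces_sliceRep]
    refine Or.inr ⟨j, h3, h4, ?_⟩
    rw [unitHalves_sliceRoot]
    rfl

theorem exists_slTraces_eq {n : ℕ} (hn : 0 < n) {p : ℂ × ℂ × ℂ} (hp : p ∈ complexModel n) :
    ∃ ρ : LinkGroup n →* SL2C, slTraces ρ = p := by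
  obtain ⟨⟨⟨⟨x, w⟩, y, d⟩, h1, h2⟩, hq⟩ := coverMap_surjective n ⟨p, hp⟩
  replace hq : halfTraces ((x, w), (y, d)) = p := congrArg Subtype.val hq
  simp only at h1 h2
  rcases h2 with h2 | ⟨j, h3, h4, hx⟩
  · obtain ⟨u, hu⟩ := exists_unitHalves h1
    obtain ⟨v, hv⟩ := exists_unitHalves h2
    exact ⟨torusRep n u v, by rw [slTraces_torusRep, hu, hv, hq]⟩
  · rcases slice_eq hx h1 with hw | hw
    · refine ⟨sliceRep hn j y d, ?_⟩
      rw [slTraces_sliceRep, unitHalves_sliceRoot, ← hx, ← hw, hq]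
    -- The lift has the opposite sign of w; only wd enters the half traces, so the sign is moved to
    -- d.
    · refine ⟨sliceRep hn j y (-d), ?_⟩
      rw [slTraces_sliceRep, unitHalves_sliceRoot, ← hx, ← hq, hw]
      simp only [halfTraces, mul_neg, neg_mul]

/-! ### The `SL(2, ℂ)`-character variety in half trace coordinates -/

theorem regular_entry {n : ℕ} (γ : LinkGroup n) (i j : Fin 2) :
    (fun ρ : RepSpace (LinkGroup n) SL2C => (ρ.hom γ).1 i j) ∈ regularFunctions (LinkGroup n) :=
  Algebra.subset_adjoin ⟨γ, i, j, rfl⟩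

/-- Half the trace of the image of `γ`, as an invariant function. -/
def traceFunction {n : ℕ} (γ : LinkGroup n) : invariantFunctions (LinkGroup n) :=
  ⟨fun ρ => ((ρ.hom γ).1 0 0 + (ρ.hom γ).1 1 1) / 2, by
    constructor
    · simp only [div_eq_mul_inv]
      exact Subalgebra.mul_mem _ (Subalgebra.add_mem _ (regular_entry γ 0 0) (regular_entry γ 1 1))
        (Subalgebra.algebraMap_mem _ _)
    · intro g ρ
      exact congrArg (· / 2) (sl_trace_conj g (ρ.hom γ))⟩

/-- The half trace coordinates on the character variety. -/
def slCoordinates (n : ℕ) (φ : SLCharVar (LinkGroup n)) : ℂ × ℂ × ℂ :=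
  let ψ : invariantFunctions (LinkGroup n) →ₐ[ℂ] ℂ := φ
  (ψ (traceFunction (genA n)), ψ (traceFunction (genB n)), ψ (traceFunction (genA n * genB n)))

/-- The point of the character variety defined by a representation. -/
def slClass {n : ℕ} (ρ : LinkGroup n →* SL2C) : SLCharVar (LinkGroup n) :=
  (Pi.evalAlgHom ℂ (fun _ : RepSpace (LinkGroup n) SL2C => ℂ) (RepSpace.of ρ)).comp
    (invariantFunctions (LinkGroup n)).val

theorem slTraces_eq {n : ℕ} (ρ : LinkGroup n →* SL2C) : slTraces ρ =
    ((traceFunction (genA n)).1 (RepSpace.of ρ), (traceFunction (genB n)).1 (RepSpace.of ρ),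
      (traceFunction (genA n * genB n)).1 (RepSpace.of ρ)) := by
  have h : ρ (genA n) * ρ (genB n) = ρ (genA n * genB n) := (map_mul ρ _ _).symm
  rw [slTraces, pairTraces, h]
  rfl

theorem slCoordinates_slClass {n : ℕ} (ρ : LinkGroup n →* SL2C) :
    slCoordinates n (slClass ρ) = slTraces ρ := (slTraces_eq ρ).symm

theorem exists_invariant_of_poly {n : ℕ} {F : ℂ × ℂ × ℂ → ℂ} (hF : F ∈ poly3) :
    ∃ f : invariantFunctions (LinkGroup n),
      (∀ ρ : LinkGroup n →* SL2C, f.1 (RepSpace.of ρ) = F (slTraces ρ)) ∧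
      ∀ φ : invariantFunctions (LinkGroup n) →ₐ[ℂ] ℂ, φ f = F (slCoordinates n φ) := by
  induction hF using Algebra.adjoin_induction with
  | mem F hF =>
    rcases hF with rfl | rfl | rfl
    · exact ⟨traceFunction (genA n), fun ρ => by rw [slTraces_eq], fun φ => rfl⟩
    · exact ⟨traceFunction (genB n), fun ρ => by rw [slTraces_eq], fun φ => rfl⟩
    · exact ⟨traceFunction (genA n * genB n), fun ρ => by rw [slTraces_eq], fun φ => rfl⟩
  | algebraMap c =>
    exact ⟨algebraMap ℂ _ c, fun ρ => rfl, fun φ => φ.commutes c⟩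
  | add F G _ _ hF hG =>
    obtain ⟨f, hf, hf'⟩ := hF
    obtain ⟨g, hg, hg'⟩ := hG
    refine ⟨f + g, fun ρ => ?_, fun φ => ?_⟩
    · rw [Pi.add_apply, ← hf, ← hg]; rfl
    · rw [map_add, hf', hg']; rfl
  | mul F G _ _ hF hG =>
    obtain ⟨f, hf, hf'⟩ := hF
    obtain ⟨g, hg, hg'⟩ := hG
    refine ⟨f * g, fun ρ => ?_, fun φ => ?_⟩
    · rw [Pi.mul_apply, ← hf, ← hg]; rfl
    · rw [map_mul, hf', hg']; rfl

/-- That f is a polynomial in the half traces is an identity in the ring of invariants, so every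
character of that ring respects it, not just evaluations at representations. -/
theorem exists_poly_character {n : ℕ} (hn : 0 < n) (f : invariantFunctions (LinkGroup n)) :
    ∃ F ∈ poly3, ∀ φ : invariantFunctions (LinkGroup n) →ₐ[ℂ] ℂ, φ f = F (slCoordinates n φ) := by
  obtain ⟨F, hF, h⟩ := exists_poly_invariant hn f.2
  obtain ⟨f', h1, h2⟩ := exists_invariant_of_poly (n := n) hF
  have : f = f' := Subtype.ext (funext fun ρ => (h ρ).trans (h1 ρ).symm)
  exact ⟨F, hF, fun φ => by rw [this, h2]⟩

/-- The equation `reducibleDisc * sliceProduct n n` of the model vanishes at all representations, so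
it is zero in the ring of invariants and every character kills it. -/
theorem slCoordinates_mem {n : ℕ} (hn : 0 < n) (φ : SLCharVar (LinkGroup n)) :
    slCoordinates n φ ∈ complexModel n := by
  obtain ⟨f, h1, h2⟩ := exists_invariant_of_poly (n := n)
    (poly3.mul_mem reducibleDisc_mem (sliceProduct_mem n n))
  have hzero : ∀ p ∈ complexModel n, (reducibleDisc * sliceProduct n n) p = 0 := by
    rintro p (hp | hp)
    · rw [Pi.mul_apply, show reducibleDisc p = 0 from sub_eq_zero.mpr hp.symm, zero_mul]
    · rw [Pi.mul_apply, sliceProduct_eq_zero_iff.mpr hp, mul_zero]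
  have hf : f = 0 := Subtype.ext (funext fun ρ => (h1 ρ).trans (hzero _ (slTraces_mem hn ρ)))
  rw [hf] at h2
  have h3 : (reducibleDisc * sliceProduct n n) (slCoordinates n φ) = 0 :=
    (h2 φ).symm.trans (map_zero (show invariantFunctions (LinkGroup n) →ₐ[ℂ] ℂ from φ))
  rcases mul_eq_zero.mp h3 with h | h
  · exact Or.inl (sub_eq_zero.mp h).symm
  · exact Or.inr (sliceProduct_eq_zero_iff.mp h)

theorem continuous_slCharVar_apply {n : ℕ} (f : invariantFunctions (LinkGroup n)) :
    Continuous fun φ : SLCharVar (LinkGroup n) =>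
      (show invariantFunctions (LinkGroup n) →ₐ[ℂ] ℂ from φ) f :=
  (continuous_apply f).comp continuous_induced_dom

theorem slCoordinates_injective {n : ℕ} (hn : 0 < n) : Function.Injective (slCoordinates n) := by
  intro φ ψ h
  refine AlgHom.ext fun f => ?_
  obtain ⟨F, -, hF⟩ := exists_poly_character hn f
  exact (hF φ).trans ((congrArg F h).trans (hF ψ).symm)

/-- The character variety in half trace coordinates. -/
def slCharVarHomeo {n : ℕ} (hn : 0 < n) : SLCharVar (LinkGroup n) ≃ₜ complexModel n where
  toFun φ := ⟨slCoordinates n φ, slCoordinates_mem hn φ⟩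
  invFun p := slClass (exists_slTraces_eq hn p.2).choose
  left_inv φ := by
    apply slCoordinates_injective hn
    rw [slCoordinates_slClass]
    exact (exists_slTraces_eq hn (slCoordinates_mem hn φ)).choose_spec
  right_inv p := by
    apply Subtype.ext
    exact (slCoordinates_slClass _).trans (exists_slTraces_eq hn p.2).choose_spec
  continuous_toFun := ((continuous_slCharVar_apply _).prodMk
    ((continuous_slCharVar_apply _).prodMk (continuous_slCharVar_apply _))).subtype_mk _
  continuous_invFun := by
    refine continuous_induced_rng.mpr (continuous_pi fun f => ?_)
    obtain ⟨F, hF, h⟩ := exists_poly_character hn f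
    have hc : Continuous fun p : complexModel n => F p :=
      (continuous_of_mem_poly3 hF).comp continuous_subtype_val
    refine hc.congr fun p => ?_
    refine Eq.trans ?_ (h _).symm
    rw [slCoordinates_slClass, (exists_slTraces_eq hn p.2).choose_spec]

end TwistedHopf

end

/-! ### The theorem -/

open TwistedHopf in
theorem mainTheorem2 (n : ℕ) (hn : 1 ≤ n) :
    -- the totally reducible and the irreducible locus are complementary
    IsCompl (totallyReducibleLocus (LinkGroup n)) (irreducibleLocus (LinkGroup n)) ∧
    -- the totally reducible locus is the pillowcase
    (∃ e : Pillowcase ≃ₜ totallyReducibleLocus (LinkGroup n),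
      ∀ z w : Circle, (e (pillowPoint z w) : SUCharVar (LinkGroup n)) =
        suClass (diagRep n z w)) ∧
    -- the totally reducible locus is a topological 2-sphere
    Nonempty (totallyReducibleLocus (LinkGroup n) ≃ₜ Sphere2) ∧
    -- `n - 1` discs are attached to it
    (∃ (ev : Fin (n - 1) → Circle) (Φ : Fin (n - 1) → ClosedDisc → SUCharVar (LinkGroup n)),
      Function.Injective ev ∧
      Set.range ev = {z : Circle | z ^ (2 * n) = 1 ∧ 0 < (z : ℂ).im} ∧
      IsDiscAttachment (totallyReducibleLocus (LinkGroup n)) Φ ∧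
      -- the open discs are the parts of the irreducible locus where `a` has a given eigenvalue
      (∀ k, Φ k '' {z | ‖(z : ℂ)‖ < 1} =
        {x | ∃ ρ : LinkGroup n →* SU2, IsIrred ρ ∧ suClass ρ = x ∧
          Module.End.HasEigenvalue
            (Matrix.toLin' (ρ (genA n) : Matrix (Fin 2) (Fin 2) ℂ)) (ev k : ℂ)}) ∧
      -- the attaching maps
      (∀ k, ∀ z : ClosedDisc, ∀ w : Circle, (z : ℂ) = w →
        Φ k z = suClass (diagRep n (ev k) w)) ∧
      -- the attaching maps are injective, with disjoint images
      (∀ j k, ∀ z w : ClosedDisc, ‖(z : ℂ)‖ = 1 → ‖(w : ℂ)‖ = 1 →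
        Φ j z = Φ k w → j = k ∧ z = w)) ∧
    -- the homotopy types
    Nonempty (SUCharVar (LinkGroup n) ≃ₕ Wedge (Fin n) Sphere2 basePoint) ∧
    Nonempty (SLCharVar (LinkGroup n) ≃ₕ Wedge (Fin n) Sphere2 basePoint) := by
  refine ⟨isCompl_loci n, exists_pillowcase_homeo n,
    ⟨(totallyReducibleHomeo n).trans pillowSurfaceHomeo⟩,
    ⟨upperRoot n, discMap hn, upperRoot_injective hn, range_upperRoot hn,
      isDiscAttachment_discMap hn, discMap_image hn, fun k _ _ h => discMap_boundary hn k h,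
      fun _ _ _ _ _ _ => discMap_injective hn⟩, ?_, ?_⟩
  · obtain ⟨e⟩ := slicedBody_homotopyEquiv hn
    exact ⟨(suCharVarHomeo hn).toHomotopyEquiv.trans e⟩
  · obtain ⟨e⟩ := slicedBody_homotopyEquiv hn
    obtain ⟨e'⟩ := complexModel_homotopyEquiv n
    exact ⟨(slCharVarHomeo hn).toHomotopyEquiv.trans (e'.trans e)⟩
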